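/- Let $n\ge 2$, let $\Omega\subset\mathbb{R}^n$ be open and bounded with Lipschitz boundary, and let $\alpha\in\left(\frac{n-1}{n},1\right)$. For $s\in(0,1)$, $p\in[1,\infty)$ and $u$ defined on $\Omega$ put $$\|u\|_{W^{s,p}}=\|u\|_{L^p(\Omega)}+\left(\int_{\Omega\times\Omega}\frac{|u(x)-u(y)|^p}{|x-y|^{n+sp}}\,dx\,dy\right)^{1/p},\qquad \|u\|_{C^{0,\alpha}}=\sup_{x\in\Omega}|u(x)|+\sup_{x,y\in\Omega,\ x\neq y}\frac{|u(x)-u(y)|}{|x-y|^\alpha},$$ both with values in $[0,\infty]$, and for $u\in C^1(\Omega;\mathbb{R}^n)$ and $\psi\in C^1_c(\Omega)$ put $\langle Ju,\psi\rangle=\int_\Omega \det\nabla u(x)\,\psi(x)\,dx$. Then there is a constant $C>0$, depending only on $n$, $\Omega$ and $\alpha$, such that for all $u,v\in C^1(\Omega;\mathbb{R}^n)$ and all $\psi\in C^1_c(\Omega)$ $$\begin{aligned} |\langle Ju-Jv,\psi\rangle|\le C\min\Big(&\|u-v\|_{W^{\frac{n-1}{n},n}}\big(\|u\|_{W^{\frac{n-1}{n},n}}+\|v\|_{W^{\frac{n-1}{n},n}}\big)^{n-1}\|\nabla\psi\|_{L^\infty(\Omega)},\\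 &\|u-v\|_{W^{\frac{n}{n+1},n+1}}\big(\|u\|_{W^{\frac{n}{n+1},n+1}}+\|v\|_{W^{\frac{n}{n+1},n+1}}\big)^{n-1}\|\psi\|_{W^{\frac{n}{n+1},n+1}},\\ &\|u-v\|_{C^{0,\alpha}}\big(\|u\|_{C^{0,\alpha}}+\|v\|_{C^{0,\alpha}}\big)^{n-1}\|\nabla\psi\|_{L^1(\Omega)}\Big), \end{aligned}$$ where the products on the right are taken in $[0,\infty]$ with $0\cdot\infty=0$. -/

import Mathlib

open MeasureTheory Set
open scoped ENNReal NNReal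

namespace DistribJacobian

/-- `Ω ⊆ ℝⁿ` has Lipschitz boundary: near each of its boundary points, `Ω` is the part of a ball
that lies strictly above the graph, in the direction of some unit vector `ν`, of a Lipschitz
function `γ` defined on the hyperplane orthogonal to `ν`. -/
def HasLipschitzBoundary {n : ℕ} (Ω : Set (EuclideanSpace ℝ (Fin n))) : Prop :=
  ∀ x₀ ∈ frontier Ω, ∃ r > (0 : ℝ), ∃ ν : EuclideanSpace ℝ (Fin n), ‖ν‖ = 1 ∧
    ∃ (K : ℝ≥0) (γ : (Submodule.span ℝ {ν})ᗮ → ℝ), LipschitzWith K γ ∧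
      ∀ x ∈ Metric.ball x₀ r,
        (x ∈ Ω ↔ γ ((Submodule.span ℝ {ν})ᗮ.orthogonalProjectionOnto x) < inner ℝ x ν)

/-- The Gagliardo seminorm `[u]_{W^{s,p}(Ω)}`, with values in `[0,∞]`. -/
noncomputable def gagliardoSeminorm {n : ℕ} {F : Type*} [NormedAddCommGroup F]
    (Ω : Set (EuclideanSpace ℝ (Fin n))) (s p : ℝ) (u : EuclideanSpace ℝ (Fin n) → F) : ℝ≥0∞ :=
  (∫⁻ z in Ω ×ˢ Ω, ‖u z.1 - u z.2‖ₑ ^ p / ‖z.1 - z.2‖ₑ ^ ((n : ℝ) + s * p)) ^ (1 / p)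

/-- The fractional Sobolev norm `‖u‖_{W^{s,p}(Ω)} = ‖u‖_{L^p(Ω)} + [u]_{W^{s,p}(Ω)}`, with values
in `[0,∞]`. -/
noncomputable def sobolevNorm {n : ℕ} {F : Type*} [NormedAddCommGroup F]
    (Ω : Set (EuclideanSpace ℝ (Fin n))) (s p : ℝ) (u : EuclideanSpace ℝ (Fin n) → F) : ℝ≥0∞ :=
  eLpNorm u (ENNReal.ofReal p) (volume.restrict Ω) + gagliardoSeminorm Ω s p u

/-- The Hölder norm `‖u‖_{C^{0,α}(Ω)} = sup_Ω |u| + sup_{x ≠ y} |u(x) - u(y)| / |x - y|^α`, with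
values in `[0,∞]`. -/
noncomputable def holderNorm {n : ℕ} {F : Type*} [NormedAddCommGroup F]
    (Ω : Set (EuclideanSpace ℝ (Fin n))) (α : ℝ) (u : EuclideanSpace ℝ (Fin n) → F) : ℝ≥0∞ :=
  (⨆ x ∈ Ω, ‖u x‖ₑ) + ⨆ x ∈ Ω, ⨆ y ∈ Ω, ⨆ _ : x ≠ y, ‖u x - u y‖ₑ / ‖x - y‖ₑ ^ α

/-- The Jacobian `Ju` of a `C¹` map `u` on `Ω`, tested against `ψ`:
`⟨Ju, ψ⟩ = ∫_Ω det ∇u(x) ψ(x) dx`. -/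
noncomputable def jacobianPairing {n : ℕ} (Ω : Set (EuclideanSpace ℝ (Fin n)))
    (u : EuclideanSpace ℝ (Fin n) → EuclideanSpace ℝ (Fin n))
    (ψ : EuclideanSpace ℝ (Fin n) → ℝ) : ℝ :=
  ∫ x in Ω, (fderiv ℝ u x).det * ψ x

end DistribJacobian

/-!
The estimates are trace estimates in disguise. For functions `F₁, …, Fₙ` and `Ψ` on the half-space
`ℝⁿ × (0, ∞)`, with `Ψ` compactly supported and with boundary values `f₁, …, fₙ` and `ψ`, the
Jacobian determinant of `(F, Ψ)`, of size `n + 1`, is a null Lagrangian, so that up to sign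
`∫ ψ det ∇f = ∫_{t > 0} det D(F, Ψ)` (`integral_det_fderiv_eq_zero`, `enorm_integral_mul_det_le`).
The right side is at most a constant times `∫ |DF₁| ⋯ |DFₙ| |DΨ|`, to which Hölder's inequality
applies: the functions in `W^{1-1/p,p}` are the traces of those with gradient in `L^p`, which for
`p = n` and `p = n + 1` gives the first two bounds, and extensions of functions in `C^{0,α}` have
a gradient of order `t^{α-1}`, so that the product is of order `t^{n(α-1)}`, integrable at `t = 0`
for `α > (n-1)/n`, which gives the third.

On a Lipschitz domain `Ω` the extensions may use only values in `Ω`. Near each point of the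
closure there is a window and a direction `ν` such that `Ω` contains the truncated cones with axis
`ν` and apex in the part of `Ω` in the window (`ConeChart`, `exists_coneChart`), and `F(x, t)` is a weighted average
of `f` over the points `x + t y` with `y` near `ν` (`coneAverage`). Its gradient is controlled by
`t⁻¹` times the oscillation of `f` over the same points (`exists_enorm_fderiv_coneAverage_le`),
and the `L^p` norm of that quantity by the Gagliardo seminorm on `Ω`
(`lintegral_inv_mul_coneOscillation_rpow_le`). For the bounds by `∇ψ`, the extension `Ψ` is `ψ`
times cutoffs, constant in `t` near `t = 0`, and Poincaré's inequality removes the term in which a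
cutoff is differentiated.

For the bound by a fractional norm of `ψ`, an extension by averages over the same cones would be
nonzero at points `(x, t)` with `x` outside `Ω`, where the components of `f` are not defined. The
average is therefore taken over the opposite cones, so that it vanishes at such points, as `ψ`
vanishes outside `Ω`. The price is a term where the opposite cones leave `Ω`, which is a weighted
norm `∫ |ψ|^{n+1} τ^{-n}` with `τ` comparable to the distance to the boundary. It is controlled by
the fractional Hardy inequality `exists_hardy`, available because the exponent `n` exceeds `1`.

The local estimates are summed with a partition of unity (`JacobianBound.of_coneChart`), and the
difference of two Jacobian determinants is a sum of `n` determinants in which one row is a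
difference (`jacobian_sub_jacobian`, `JacobianBound.exists_le`).
-/

namespace DistribJacobian

open Filter Topology

/-! ### Null Lagrangian property of Jacobian determinants -/

theorem fderiv_eq_zero_of_notMem_tsupport {E : Type*} [NormedAddCommGroup E] [NormedSpace ℝ E]
    {ψ : E → ℝ} {x : E} (hx : x ∉ tsupport ψ) : fderiv ℝ ψ x = 0 := by
  by_contra h0
  exact hx (support_fderiv_subset ℝ h0)

section NullLagrangian

variable {X : Type*} {ι : Type*} [Fintype ι] [DecidableEq ι]

/-- Exchanging the values of `σ` at `k` and `i` changes the sign of the summand, and nothing else.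
-/
theorem sum_sign_mul_prod_mul_eq_zero (e : ι → X) (a : ι → ι → ℝ) (H : X → X → ℝ)
    (hH : ∀ v w, H v w = H w v) {k i : ι} (hik : i ≠ k) :
    ∑ σ : Equiv.Perm ι, ((Equiv.Perm.sign σ : ℤ) : ℝ) *
      ((∏ j ∈ (Finset.univ.erase k).erase i, a j (σ j)) * H (e (σ k)) (e (σ i))) = 0 := by
  set S := ∑ σ : Equiv.Perm ι, ((Equiv.Perm.sign σ : ℤ) : ℝ) *
      ((∏ j ∈ (Finset.univ.erase k).erase i, a j (σ j)) * H (e (σ k)) (e (σ i))) with hS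
  have h : S = -S := by
    conv_lhs => rw [hS]
    rw [← Equiv.sum_comp (Equiv.mulRight (Equiv.swap k i)), hS, ← Finset.sum_neg_distrib]
    refine Finset.sum_congr rfl fun σ _ => ?_
    have hprod : ∏ j ∈ (Finset.univ.erase k).erase i, a j ((σ * Equiv.swap k i) j) =
        ∏ j ∈ (Finset.univ.erase k).erase i, a j (σ j) := by
      refine Finset.prod_congr rfl fun j hj => ?_
      simp only [Finset.mem_erase, Finset.mem_univ, and_true] at hj
      rw [Equiv.Perm.mul_apply, Equiv.swap_apply_of_ne_of_ne hj.2 hj.1]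
    simp only [Equiv.coe_mulRight]
    rw [hprod]
    simp only [Equiv.Perm.mul_apply, Equiv.swap_apply_left, Equiv.swap_apply_right]
    rw [hH, Equiv.Perm.sign_mul, Equiv.Perm.sign_swap hik.symm]
    push_cast
    ring
  linarith

variable [NormedAddCommGroup X] [NormedSpace ℝ X] [MeasurableSpace X] [BorelSpace X]
  [FiniteDimensional ℝ X] {μ : Measure X} [μ.IsAddHaarMeasure]

/-- **Null Lagrangian property of the Jacobian determinant**: the determinant of the derivatives of
functions, one of which is compactly supported, integrates to zero. It follows from expanding the
determinant into permutations and integrating by parts in the row of the compactly supported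
function: the second derivatives that come up are symmetric and cancel in pairs. -/
theorem integral_det_fderiv_eq_zero (e : ι → X) {f : ι → X → ℝ} {k : ι}
    (hk : ContDiff ℝ 1 (f k)) (hc : HasCompactSupport (f k)) {W : Set X} (hW : IsOpen W)
    (hs : tsupport (f k) ⊆ W) (hf : ∀ i, i ≠ k → ContDiffOn ℝ 2 (f i) W) :
    ∫ x, Matrix.det (Matrix.of fun i j => fderiv ℝ (f i) x (e j)) ∂μ = 0 := by
  -- `G σ` is the cofactor of the row `k` in the summand of the permutation `σ`.
  set G : Equiv.Perm ι → X → ℝ := fun σ x =>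
    ∏ i ∈ Finset.univ.erase k, fderiv ℝ (f i) x (e (σ i)) with hG
  have hdet : ∀ x, Matrix.det (Matrix.of fun i j => fderiv ℝ (f i) x (e j)) =
      ∑ σ : Equiv.Perm ι, ((Equiv.Perm.sign σ : ℤ) : ℝ) *
        (G σ x * fderiv ℝ (f k) x (e (σ k))) := by
    intro x
    rw [← Matrix.det_transpose, Matrix.det_apply']
    refine Finset.sum_congr rfl fun σ _ => ?_
    rw [hG, Finset.prod_erase_mul _ _ (Finset.mem_univ k)]
    rfl
  have hdf : ∀ i, i ≠ k → ContDiffOn ℝ 1 (fderiv ℝ (f i)) W := fun i hi =>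
    (hf i hi).fderiv_of_isOpen hW (by norm_num)
  have hGd : ∀ σ, ContDiffOn ℝ 1 (G σ) W := by
    intro σ
    refine contDiffOn_prod fun i hi => ?_
    exact (hdf i (Finset.ne_of_mem_erase hi)).clm_apply contDiffOn_const
  have hcf : Continuous (fderiv ℝ (f k)) := hk.continuous_fderiv one_ne_zero
  have hts : ∀ v, tsupport (fun x => fderiv ℝ (f k) x v) ⊆ tsupport (f k) := fun v => by
    refine closure_minimal (fun x hx => ?_) (isClosed_tsupport _)
    refine support_fderiv_subset ℝ (f := f k) ?_
    intro h0
    exact hx (by simp [h0])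
  have hcont : ∀ (a b : X → ℝ), ContinuousOn a W → Continuous b → tsupport b ⊆ tsupport (f k) →
      Integrable (fun x => a x * b x) μ := by
    intro a b ha hb hab
    have h1 : tsupport (fun x => a x * b x) ⊆ tsupport (f k) :=
      (tsupport_mul_subset_right (f := a) (g := b)).trans hab
    refine Continuous.integrable_of_hasCompactSupport ?_
      (hc.of_isClosed_subset (isClosed_tsupport _) h1)
    refine continuous_of_tsupport fun x hx => ?_
    exact ((ha.mul hb.continuousOn).continuousAt (hW.mem_nhds (hs (h1 hx))))
  have hint : ∀ σ, Integrable (fun x => G σ x * fderiv ℝ (f k) x (e (σ k))) μ := fun σ =>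
    hcont _ _ (hGd σ).continuousOn (hcf.clm_apply continuous_const) (hts _)
  have hGf : ∀ σ v, ContinuousOn (fun x => fderiv ℝ (G σ) x v) W := fun σ v =>
    ((hGd σ).continuousOn_fderiv_of_isOpen hW le_rfl).clm_apply continuousOn_const
  have hint' : ∀ σ, Integrable (fun x => fderiv ℝ (G σ) x (e (σ k)) * f k x) μ := fun σ =>
    hcont _ _ (hGf σ _) hk.continuous subset_rfl
  have hparts : ∀ σ, ∫ x, G σ x * fderiv ℝ (f k) x (e (σ k)) ∂μ =
      - ∫ x, fderiv ℝ (G σ) x (e (σ k)) * f k x ∂μ := by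
    intro σ
    refine integral_mul_fderiv_eq_neg_fderiv_mul_of_integrable (hint' σ) (hint σ)
      (hcont _ _ (hGd σ).continuousOn hk.continuous subset_rfl) ?_ ?_
    · intro x hx
      exact ((hGd σ).differentiableOn one_ne_zero).differentiableAt (hW.mem_nhds (hs hx))
    · intro x _
      exact hk.differentiable one_ne_zero x
  simp_rw [hdet]
  rw [integral_finsetSum _ fun σ _ => (hint σ).const_mul _]
  simp_rw [integral_const_mul, hparts]
  have : ∀ σ : Equiv.Perm ι, ((Equiv.Perm.sign σ : ℤ) : ℝ) *
      - ∫ x, fderiv ℝ (G σ) x (e (σ k)) * f k x ∂μ =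
      - ∫ x, ((Equiv.Perm.sign σ : ℤ) : ℝ) * (fderiv ℝ (G σ) x (e (σ k)) * f k x) ∂μ := by
    intro σ
    rw [integral_const_mul, mul_neg]
  simp_rw [this]
  rw [Finset.sum_neg_distrib, ← integral_finsetSum _ fun σ _ => (hint' σ).const_mul _, neg_eq_zero]
  refine integral_eq_zero_of_ae (Eventually.of_forall fun x => ?_)
  by_cases hx : x ∈ tsupport (f k)
  swap
  · simp [image_eq_zero_of_notMem_tsupport hx]
  have hxW := hW.mem_nhds (hs hx)
  have hder : ∀ (σ : Equiv.Perm ι) v, fderiv ℝ (G σ) x v = ∑ i ∈ Finset.univ.erase k,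
      (∏ j ∈ (Finset.univ.erase k).erase i, fderiv ℝ (f j) x (e (σ j))) *
        fderiv ℝ (fderiv ℝ (f i)) x v (e (σ i)) := by
    intro σ v
    have h1 : ∀ i ∈ Finset.univ.erase k, HasFDerivAt (fun x => fderiv ℝ (f i) x (e (σ i)))
        ((fderiv ℝ (fderiv ℝ (f i)) x).flip (e (σ i))) x := by
      intro i hi
      have h2 := (((hdf i (Finset.ne_of_mem_erase hi)).differentiableOn
        one_ne_zero).differentiableAt hxW).hasFDerivAt
      simpa using h2.clm_apply (hasFDerivAt_const (e (σ i)) x)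
    have h3 := (HasFDerivAt.finsetProd h1).fderiv
    rw [hG]
    simp only
    rw [h3]
    simp
  have hsymm : ∀ i, i ≠ k → ∀ v w, fderiv ℝ (fderiv ℝ (f i)) x v w =
      fderiv ℝ (fderiv ℝ (f i)) x w v := fun i hi v w =>
    (((hf i hi).contDiffAt hxW).isSymmSndFDerivAt (by simp)) v w
  simp only [Pi.zero_apply]
  have h4 : ∀ σ : Equiv.Perm ι, ((Equiv.Perm.sign σ : ℤ) : ℝ) *
      (fderiv ℝ (G σ) x (e (σ k)) * f k x) = (∑ i ∈ Finset.univ.erase k,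
      ((Equiv.Perm.sign σ : ℤ) : ℝ) *
      ((∏ j ∈ (Finset.univ.erase k).erase i, fderiv ℝ (f j) x (e (σ j))) *
        fderiv ℝ (fderiv ℝ (f i)) x (e (σ k)) (e (σ i)))) * f k x := by
    intro σ
    rw [hder, ← Finset.mul_sum, mul_assoc]
  simp_rw [h4]
  rw [← Finset.sum_mul, Finset.sum_comm]
  rw [Finset.sum_eq_zero, zero_mul]
  intro i hi
  exact sum_sign_mul_prod_mul_eq_zero e (fun j l => fderiv ℝ (f j) x (e l))
    (fun v w => fderiv ℝ (fderiv ℝ (f i)) x v w) (hsymm i (Finset.ne_of_mem_erase hi))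
    (Finset.ne_of_mem_erase hi)

end NullLagrangian

theorem abs_det_le_factorial_mul_prod {ι : Type*} [Fintype ι] [DecidableEq ι] (M : Matrix ι ι ℝ)
    (r : ι → ℝ) (h : ∀ i j, |M i j| ≤ r i) :
    |M.det| ≤ (Fintype.card ι).factorial * ∏ i, r i := by
  rw [← Matrix.det_transpose, Matrix.det_apply']
  refine (Finset.abs_sum_le_sum_abs _ _).trans ?_
  have : ∀ σ ∈ (Finset.univ : Finset (Equiv.Perm ι)),
      |((Equiv.Perm.sign σ : ℤ) : ℝ) * ∏ i, Matrix.transpose M (σ i) i| ≤ ∏ i, r i := by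
    intro σ _
    have h1 : |((Equiv.Perm.sign σ : ℤ) : ℝ)| = 1 := by
      rcases Int.units_eq_one_or (Equiv.Perm.sign σ) with h | h <;> simp [h]
    rw [abs_mul, h1, one_mul, Finset.abs_prod]
    exact Finset.prod_le_prod (fun i _ => abs_nonneg _) fun i _ => h i (σ i)
  refine (Finset.sum_le_sum this).trans ?_
  rw [Finset.sum_const, nsmul_eq_mul, Finset.card_univ, Fintype.card_perm]

/-! ### Jacobian determinants on the half-space -/

/-- A smooth cutoff on `ℝ` that vanishes on `(-∞, 1]` and equals `1` on `[2, ∞)`. -/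
noncomputable def unitCutoff (s : ℝ) : ℝ := Real.smoothTransition (s - 1)

theorem contDiff_unitCutoff : ContDiff ℝ 1 unitCutoff :=
  Real.smoothTransition.contDiff.comp (contDiff_id.sub contDiff_const)

theorem unitCutoff_eq_zero {s : ℝ} (hs : s ≤ 1) : unitCutoff s = 0 :=
  Real.smoothTransition.zero_of_nonpos (by linarith)

theorem unitCutoff_eq_one {s : ℝ} (hs : 2 ≤ s) : unitCutoff s = 1 :=
  Real.smoothTransition.one_of_one_le (by linarith)

theorem abs_unitCutoff_le_one (s : ℝ) : |unitCutoff s| ≤ 1 := by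
  rw [unitCutoff, abs_of_nonneg (Real.smoothTransition.nonneg _)]
  exact Real.smoothTransition.le_one _

theorem continuous_deriv_unitCutoff : Continuous (deriv unitCutoff) :=
  contDiff_unitCutoff.continuous_deriv le_rfl

theorem deriv_unitCutoff_eq_zero {s : ℝ} (hs : s ∉ Icc (1 : ℝ) 2) : deriv unitCutoff s = 0 := by
  rw [mem_Icc, not_and_or, not_le, not_le] at hs
  rcases hs with hs | hs
  · have : unitCutoff =ᶠ[𝓝 s] fun _ => 0 := by
      filter_upwards [Iio_mem_nhds hs] with x hx using unitCutoff_eq_zero (le_of_lt hx)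
    rw [this.deriv_eq, deriv_const]
  · have : unitCutoff =ᶠ[𝓝 s] fun _ => 1 := by
      filter_upwards [Ioi_mem_nhds hs] with x hx using unitCutoff_eq_one (le_of_lt hx)
    rw [this.deriv_eq, deriv_const]

theorem hasCompactSupport_deriv_unitCutoff : HasCompactSupport (deriv unitCutoff) :=
  HasCompactSupport.intro isCompact_Icc fun _ hs => deriv_unitCutoff_eq_zero hs

theorem integral_deriv_unitCutoff : ∫ s, deriv unitCutoff s = 1 := by
  have h := integral_of_hasDerivAt_of_tendsto (f := unitCutoff) (f' := deriv unitCutoff)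
    (m := 0) (n := 1) (fun x => (contDiff_unitCutoff.differentiable one_ne_zero x).hasDerivAt)
    (continuous_deriv_unitCutoff.integrable_of_hasCompactSupport hasCompactSupport_deriv_unitCutoff)
    (tendsto_const_nhds.congr' ?_) (tendsto_const_nhds.congr' ?_)
  · simpa using h
  · filter_upwards [Iic_mem_atBot (1 : ℝ)] with s hs using (unitCutoff_eq_zero hs).symm
  · filter_upwards [Ici_mem_atTop (2 : ℝ)] with s hs using (unitCutoff_eq_one hs).symm

section HalfSpace

variable {E : Type*} [NormedAddCommGroup E] [NormedSpace ℝ E]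

/-- The Jacobian matrix of a family of functions on `E × ℝ` with respect to the directions `e j`
of `E` and the unit vector of `ℝ`. -/
noncomputable def cylinderJacobian {ι : Type*} (e : ι → E) (F : ι → E × ℝ → ℝ) (Ψ : E × ℝ → ℝ)
    (q : E × ℝ) : Matrix (ι ⊕ Unit) (ι ⊕ Unit) ℝ :=
  Matrix.of fun i j => fderiv ℝ (Sum.elim F (fun _ => Ψ) i) q
    (Sum.elim (fun j => (e j, (0 : ℝ))) (fun _ => ((0 : E), (1 : ℝ))) j)

/-- The Leibniz rule in the last row; the term with `β'` has a row whose only nonzero entry is the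
last. -/
theorem det_cylinderJacobian_mul {ι : Type*} [Fintype ι] [DecidableEq ι] (e : ι → E)
    (F : ι → E × ℝ → ℝ) {Ψ : E × ℝ → ℝ} {β : ℝ → ℝ} {q : E × ℝ} (hΨ : DifferentiableAt ℝ Ψ q)
    (hβ : DifferentiableAt ℝ β q.2) :
    (cylinderJacobian e F (fun q => β q.2 * Ψ q) q).det =
      β q.2 * (cylinderJacobian e F Ψ q).det +
        Ψ q * deriv β q.2 * (Matrix.of fun i j => fderiv ℝ (F i) q (e j, 0)).det := by
  set M := cylinderJacobian e F Ψ q with hM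
  set d : ι ⊕ Unit → E × ℝ := Sum.elim (fun j => (e j, (0 : ℝ))) (fun _ => ((0 : E), (1 : ℝ)))
    with hd
  have h1 : cylinderJacobian e F (fun q => β q.2 * Ψ q) q =
      M.updateRow (Sum.inr ())
        (β q.2 • M (Sum.inr ()) + (Ψ q * deriv β q.2) • fun j => (d j).2) := by
    have hβ' : HasFDerivAt (fun q : E × ℝ => β q.2)
        (deriv β q.2 • ContinuousLinearMap.snd ℝ E ℝ) q :=
      hβ.hasDerivAt.comp_hasFDerivAt q hasFDerivAt_snd
    ext i j
    rcases i with i | i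
    · rw [Matrix.updateRow_ne (by simp)]
      rfl
    · rw [Matrix.updateRow_self]
      simp only [cylinderJacobian, Sum.elim_inr, Matrix.of_apply, hM, Pi.add_apply, Pi.smul_apply,
        smul_eq_mul]
      have h3 : fderiv ℝ (fun q : E × ℝ => β q.2 * Ψ q) q = β q.2 • fderiv ℝ Ψ q +
          Ψ q • deriv β q.2 • ContinuousLinearMap.snd ℝ E ℝ := (hβ'.mul hΨ.hasFDerivAt).fderiv
      rw [h3]
      simp only [_root_.add_apply, _root_.smul_apply, smul_eq_mul,
        ContinuousLinearMap.coe_snd']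
      rw [← hd]
      ring
  have h2 : M.updateRow (Sum.inr ()) (fun j => (d j).2) =
      Matrix.fromBlocks (Matrix.of fun i j => fderiv ℝ (F i) q (e j, 0))
        (Matrix.of fun i _ => fderiv ℝ (F i) q (0, 1)) 0 1 := by
    ext i j
    rcases i with i | i
    · rw [Matrix.updateRow_ne (by simp)]
      rcases j with j | j <;> simp [M, cylinderJacobian]
    · rw [Matrix.updateRow_self]
      rcases j with j | j <;> simp [d]
  rw [h1, Matrix.det_updateRow_add, Matrix.det_updateRow_smul, Matrix.det_updateRow_smul, h2,
    Matrix.det_fromBlocks_zero₂₁, Matrix.updateRow_eq_self]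
  simp

variable [MeasurableSpace E] [BorelSpace E] [FiniteDimensional ℝ E] {μ : Measure E}
  [μ.IsAddHaarMeasure]

/-- The derivatives of the cutoffs `t ↦ unitCutoff (t / ε)` concentrate at `t = 0` as `ε → 0`. -/
theorem tendsto_integral_mul_deriv_unitCutoff {w : E × ℝ → ℝ} (hw : Continuous w)
    (hc : HasCompactSupport w) {ε : ℕ → ℝ} (hε : ∀ k, 0 < ε k) (hε0 : Tendsto ε atTop (𝓝 0)) :
    Tendsto (fun k => ∫ q, w q * ((ε k)⁻¹ * deriv unitCutoff (q.2 / ε k)) ∂(μ.prod volume)) atTop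
      (𝓝 (∫ x, w (x, 0) ∂μ)) := by
  set g : ℝ → ℝ := fun t => ∫ x, w (x, t) ∂μ with hg
  set K : Set E := Prod.fst '' tsupport w with hK
  have hKc : IsCompact K := hc.isCompact.image continuous_fst
  have hgK : g = fun t => ∫ x in K, w (x, t) ∂μ := by
    ext t
    rw [hg, setIntegral_eq_integral_of_forall_compl_eq_zero]
    intro x hx
    by_contra h0
    exact hx ⟨(x, t), subset_tsupport _ h0, rfl⟩
  have hgc : Continuous g := by
    rw [hgK]
    exact continuous_parametric_integral_of_continuous (f := fun t x => w (x, t))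
      (hw.comp continuous_swap) hKc
  have hgb : ∃ M, ∀ t, ‖g t‖ ≤ M := by
    obtain ⟨C, hC⟩ := hc.exists_bound_of_continuous hw
    refine ⟨C * μ.real K, fun t => ?_⟩
    rw [hgK]
    exact norm_setIntegral_le_of_norm_le_const hKc.measure_lt_top fun x _ => hC _
  obtain ⟨M, hM⟩ := hgb
  have hstep : ∀ k, ∫ q, w q * ((ε k)⁻¹ * deriv unitCutoff (q.2 / ε k)) ∂(μ.prod volume) =
      ∫ s, deriv unitCutoff s * g (ε k * s) := by
    intro k
    have hi : Integrable (fun q : E × ℝ => w q * ((ε k)⁻¹ * deriv unitCutoff (q.2 / ε k)))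
        (μ.prod volume) := by
      refine Continuous.integrable_of_hasCompactSupport ?_ hc.mul_right
      exact hw.mul (continuous_const.mul
        (continuous_deriv_unitCutoff.comp (continuous_snd.div_const _)))
    rw [integral_prod_symm _ hi]
    have h1 : ∀ t, ∫ x, w (x, t) * ((ε k)⁻¹ * deriv unitCutoff (t / ε k)) ∂μ =
        (ε k)⁻¹ * (deriv unitCutoff (t / ε k) * g (ε k * (t / ε k))) := by
      intro t
      rw [integral_mul_const, mul_div_cancel₀ _ (hε k).ne']
      ring
    simp_rw [h1]
    rw [integral_const_mul, Measure.integral_comp_div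
      (fun s => deriv unitCutoff s * g (ε k * s)) (ε k), abs_of_pos (hε k), smul_eq_mul,
      inv_mul_cancel_left₀ (hε k).ne']
  simp_rw [hstep]
  have hlim : ∫ x, w (x, 0) ∂μ = ∫ s, deriv unitCutoff s * g 0 := by
    rw [integral_mul_const, integral_deriv_unitCutoff, one_mul]
  rw [hlim]
  have hint : Integrable (fun s => ‖deriv unitCutoff s‖ * M) :=
    ((continuous_deriv_unitCutoff.integrable_of_hasCompactSupport
      hasCompactSupport_deriv_unitCutoff).norm).mul_const _
  refine tendsto_integral_of_dominated_convergence _ (fun k => ?_) hint (fun k => ?_) ?_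
  · exact (continuous_deriv_unitCutoff.mul
      (hgc.comp (continuous_const.mul continuous_id))).aestronglyMeasurable
  · refine Eventually.of_forall fun s => ?_
    rw [norm_mul]
    exact mul_le_mul_of_nonneg_left (hM _) (norm_nonneg _)
  · refine Eventually.of_forall fun s => ?_
    refine Tendsto.const_mul _ ?_
    have : Tendsto (fun k => ε k * s) atTop (𝓝 0) := by simpa using hε0.mul_const s
    exact (hgc.tendsto 0).comp this

/-- The pairing of a Jacobian determinant with a test function is bounded by the integral of the
determinant of extensions of all functions to the half-space: apply the null Lagrangian property
to the extension `Ψ` times a cutoff away from the boundary `E × {0}`, and let the cutoff tend to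
`1`. -/
theorem enorm_integral_mul_det_le {ι : Type*} [Fintype ι] [DecidableEq ι] (e : ι → E)
    {F : ι → E × ℝ → ℝ} (hF : ∀ i, ContDiff ℝ 1 (F i))
    (hF2 : ∀ i, ContDiffOn ℝ 2 (F i) (univ ×ˢ Ioi 0)) {Ψ : E × ℝ → ℝ} (hΨ : ContDiff ℝ 1 Ψ)
    (hc : HasCompactSupport Ψ) :
    ‖∫ x, Ψ (x, 0) * (Matrix.of fun i j => fderiv ℝ (F i) (x, 0) (e j, 0)).det ∂μ‖ₑ ≤
      ∫⁻ q in univ ×ˢ Ioi 0, ‖(cylinderJacobian e F Ψ q).det‖ₑ ∂(μ.prod volume) := by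
  have hFd : ∀ i v, Continuous fun q => fderiv ℝ (F i) q v := fun i v =>
    ((hF i).continuous_fderiv one_ne_zero).clm_apply continuous_const
  have hΨd : ∀ v, Continuous fun q => fderiv ℝ Ψ q v := fun v =>
    (hΨ.continuous_fderiv one_ne_zero).clm_apply continuous_const
  set w : E × ℝ → ℝ := fun q => Ψ q * (Matrix.of fun i j => fderiv ℝ (F i) q (e j, 0)).det with hw
  have hwc : Continuous w := hΨ.continuous.mul (Continuous.matrix_det
    (continuous_matrix fun i j => hFd i _))
  have hws : HasCompactSupport w := hc.mul_right
  set D : E × ℝ → ℝ := fun q => (cylinderJacobian e F Ψ q).det with hD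
  have hDc : Continuous D := by
    refine Continuous.matrix_det (continuous_matrix fun i j => ?_)
    rcases i with i | i
    · exact hFd i _
    · exact hΨd _
  have hDs : HasCompactSupport D := by
    refine HasCompactSupport.intro hc.isCompact fun q hq => ?_
    refine Matrix.det_eq_zero_of_row_eq_zero (Sum.inr ()) fun j => ?_
    simp [cylinderJacobian, fderiv_eq_zero_of_notMem_tsupport hq]
  set ε : ℕ → ℝ := fun k => 1 / ((k : ℝ) + 1) with hεdef
  have hε : ∀ k, 0 < ε k := fun k => Nat.one_div_pos_of_nat
  have hε0 : Tendsto ε atTop (𝓝 0) := tendsto_one_div_add_atTop_nhds_zero_nat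
  have hlim := tendsto_integral_mul_deriv_unitCutoff (μ := μ) hwc hws hε hε0
  have hb : ∀ k, ‖∫ q, w q * ((ε k)⁻¹ * deriv unitCutoff (q.2 / ε k)) ∂(μ.prod volume)‖ₑ ≤
      ∫⁻ q in univ ×ˢ Ioi 0, ‖D q‖ₑ ∂(μ.prod volume) := by
    intro k
    set β : ℝ → ℝ := fun t => unitCutoff (t / ε k) with hβdef
    have hβ1 : ContDiff ℝ 1 β := contDiff_unitCutoff.comp (contDiff_id.div_const _)
    have hβ' : ∀ t, deriv β t = (ε k)⁻¹ * deriv unitCutoff (t / ε k) := by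
      intro t
      have h1 : HasDerivAt (fun t : ℝ => t / ε k) ((ε k)⁻¹) t := by
        simpa using (hasDerivAt_id t).div_const (ε k)
      have h2 := ((contDiff_unitCutoff.differentiable one_ne_zero (t / ε k)).hasDerivAt).comp t h1
      rw [show β = unitCutoff ∘ fun t => t / ε k from rfl, h2.deriv, mul_comm]
    have hβ0 : ∀ t, t < ε k → β t = 0 := fun t ht =>
      unitCutoff_eq_zero ((div_le_one (hε k)).2 ht.le)
    have hprod : ContDiff ℝ 1 fun q : E × ℝ => β q.2 * Ψ q := (hβ1.comp contDiff_snd).mul hΨ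
    have hnull := integral_det_fderiv_eq_zero (μ := μ.prod (volume : Measure ℝ))
      (Sum.elim (fun j => (e j, (0 : ℝ))) (fun _ : Unit => ((0 : E), (1 : ℝ))))
      (f := Sum.elim F (fun _ q => β q.2 * Ψ q)) (k := Sum.inr ()) hprod hc.mul_left
      (W := univ ×ˢ Ioi 0) (isOpen_univ.prod isOpen_Ioi) ?_ ?_
    · have hpt : ∀ q, (Matrix.of fun i j => fderiv ℝ (Sum.elim F (fun _ q => β q.2 * Ψ q) i) q
          (Sum.elim (fun j => (e j, (0 : ℝ))) (fun _ : Unit => ((0 : E), (1 : ℝ))) j)).det =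
          β q.2 * D q + w q * ((ε k)⁻¹ * deriv unitCutoff (q.2 / ε k)) := by
        intro q
        have := det_cylinderJacobian_mul e F (hΨ.differentiable one_ne_zero q)
          (hβ1.differentiable one_ne_zero q.2)
        rw [hβ'] at this
        rw [show (Matrix.of fun i j => fderiv ℝ (Sum.elim F (fun _ q => β q.2 * Ψ q) i) q
          (Sum.elim (fun j => (e j, (0 : ℝ))) (fun _ : Unit => ((0 : E), (1 : ℝ))) j)) =
          cylinderJacobian e F (fun q => β q.2 * Ψ q) q from rfl, this]
        simp only [hD, hw]
        ring
      simp_rw [hpt] at hnull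
      have hi1 : Integrable (fun q : E × ℝ => β q.2 * D q) (μ.prod volume) :=
        ((hβ1.continuous.comp continuous_snd).mul hDc).integrable_of_hasCompactSupport hDs.mul_left
      have hi2 : Integrable (fun q : E × ℝ => w q * ((ε k)⁻¹ * deriv unitCutoff (q.2 / ε k)))
          (μ.prod volume) := by
        refine Continuous.integrable_of_hasCompactSupport ?_ hws.mul_right
        exact hwc.mul (continuous_const.mul
          (continuous_deriv_unitCutoff.comp (continuous_snd.div_const _)))
      rw [integral_add hi1 hi2] at hnull
      rw [← neg_eq_iff_add_eq_zero.2 hnull, enorm_neg]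
      refine (enorm_integral_le_lintegral_enorm _).trans ?_
      rw [← lintegral_indicator (MeasurableSet.univ.prod measurableSet_Ioi)]
      refine lintegral_mono fun q => ?_
      by_cases hq : 0 < q.2
      · rw [indicator_of_mem (by simpa using hq), enorm_mul]
        calc ‖β q.2‖ₑ * ‖D q‖ₑ ≤ 1 * ‖D q‖ₑ := by
              gcongr
              rw [Real.enorm_eq_ofReal_abs]
              exact ENNReal.ofReal_le_one.2 (abs_unitCutoff_le_one _)
          _ = _ := one_mul _
      · rw [hβ0 q.2 (lt_of_le_of_lt (not_lt.1 hq) (hε k))]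
        simp
    · simp only [Sum.elim_inr]
      have hsub : tsupport (fun q : E × ℝ => β q.2 * Ψ q) ⊆ {q | ε k ≤ q.2} := by
        refine closure_minimal (fun q hq => ?_) (isClosed_le continuous_const continuous_snd)
        by_contra h0
        exact hq (by simp [hβ0 q.2 (not_le.1 h0)])
      intro q hq
      exact ⟨mem_univ _, lt_of_lt_of_le (hε k) (hsub hq)⟩
    · rintro (i | i) hi
      · exact hF2 i
      · exact absurd rfl hi
  exact le_of_tendsto (hlim.enorm) (Eventually.of_forall hb)

end HalfSpace

/-! ### Averages over cones -/

section Mollify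

variable {E : Type*} [NormedAddCommGroup E] [NormedSpace ℝ E]

theorem contDiff_weight_mul {η f : E → ℝ} (hη : ContDiff ℝ 1 η) (hf : ContDiff ℝ 1 f) :
    ContDiff ℝ 1 fun p : (E × ℝ) × E => η p.2 * f (p.1.1 + p.1.2 • p.2) := by
  fun_prop

variable [MeasurableSpace E] {μ : Measure E}

/-- The average of `f` over the points `x + t y`, weighted by `η y`, as a function of `(x, t)`. When
`η` is supported in a ball that does not contain `0`, only points of a cone with apex `x`, truncated
at height comparable to `t`, contribute. -/
noncomputable def coneAverage (μ : Measure E) (η f : E → ℝ) (q : E × ℝ) : ℝ :=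
  ∫ y, η y * f (q.1 + q.2 • y) ∂μ

theorem coneAverage_eq_setIntegral (η f : E → ℝ) (q : E × ℝ) :
    coneAverage μ η f q = ∫ y in tsupport η, η y * f (q.1 + q.2 • y) ∂μ := by
  rw [coneAverage, setIntegral_eq_integral_of_forall_compl_eq_zero]
  intro y hy
  rw [image_eq_zero_of_notMem_tsupport hy, zero_mul]

theorem coneAverage_zero (η f : E → ℝ) (x : E) (hη : ∫ y, η y ∂μ = 1) :
    coneAverage μ η f (x, 0) = f x := by
  simp [coneAverage, integral_mul_const, hη]

variable [BorelSpace E] [μ.IsAddHaarMeasure]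

theorem hasFDerivAt_setIntegral_of_contDiff {H : Type*} [NormedAddCommGroup H] [NormedSpace ℝ H]
    [FiniteDimensional ℝ H] {G : H × E → ℝ} (hG : ContDiff ℝ 1 G) {K : Set E} (hK : IsCompact K)
    (q : H) :
    HasFDerivAt (fun q => ∫ y in K, G (q, y) ∂μ)
      (∫ y in K, (fderiv ℝ G (q, y)).comp (ContinuousLinearMap.inl ℝ H E) ∂μ) q := by
  have hd : Continuous fun p : H × E => (fderiv ℝ G p).comp (ContinuousLinearMap.inl ℝ H E) :=
    (hG.continuous_fderiv one_ne_zero).clm_comp continuous_const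
  obtain ⟨M, hM⟩ := (((isCompact_closedBall q 1).prod hK).image hd).isBounded.exists_norm_le
  have hKf : IsFiniteMeasure (μ.restrict K) := ⟨by simpa using hK.measure_lt_top⟩
  refine hasFDerivAt_integral_of_dominated_of_fderiv_le (Metric.closedBall_mem_nhds q one_pos)
    (bound := fun _ => M)
    (F' := fun q y => (fderiv ℝ G (q, y)).comp (ContinuousLinearMap.inl ℝ H E))
    ?_ ?_ ?_ ?_ (integrable_const _) ?_
  · exact Eventually.of_forall fun p =>
      (hG.continuous.comp (Continuous.prodMk_right p)).aestronglyMeasurable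
  · exact (hG.continuous.comp (Continuous.prodMk_right q)).continuousOn.integrableOn_compact hK
  · exact (hd.comp (Continuous.prodMk_right q)).aestronglyMeasurable
  · refine ae_restrict_of_forall_mem hK.measurableSet fun y hy p hp => ?_
    exact hM _ ⟨(p, y), ⟨hp, hy⟩, rfl⟩
  · refine Eventually.of_forall fun y p _ => ?_
    have h1 := (hG.differentiable one_ne_zero (p, y)).hasFDerivAt
    have h2 : HasFDerivAt (fun p : H => (p, y)) (ContinuousLinearMap.inl ℝ H E) p :=
      hasFDerivAt_prodMk_left p y
    exact h1.comp p h2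

variable [FiniteDimensional ℝ E]

theorem contDiff_setIntegral_of_contDiff {H : Type*} [NormedAddCommGroup H] [NormedSpace ℝ H]
    [FiniteDimensional ℝ H] {G : H × E → ℝ} (hG : ContDiff ℝ 1 G) {K : Set E} (hK : IsCompact K) :
    ContDiff ℝ 1 (fun q => ∫ y in K, G (q, y) ∂μ) := by
  refine contDiff_one_iff_hasFDerivAt.2 ⟨_, ?_, hasFDerivAt_setIntegral_of_contDiff hG hK⟩
  have hd : Continuous fun p : H × E => (fderiv ℝ G p).comp (ContinuousLinearMap.inl ℝ H E) :=
    (hG.continuous_fderiv one_ne_zero).clm_comp continuous_const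
  exact continuous_parametric_integral_of_continuous
    (f := fun q y => (fderiv ℝ G (q, y)).comp (ContinuousLinearMap.inl ℝ H E)) hd hK

theorem contDiff_coneAverage {η f : E → ℝ} (hη : ContDiff ℝ 1 η) (hηc : HasCompactSupport η)
    (hf : ContDiff ℝ 1 f) : ContDiff ℝ 1 (coneAverage μ η f) := by
  have := contDiff_setIntegral_of_contDiff (μ := μ) (contDiff_weight_mul hη hf) hηc.isCompact
  rwa [show coneAverage μ η f = _ from funext (coneAverage_eq_setIntegral η f)]

theorem fderiv_coneAverage_apply {η f : E → ℝ} (hη : ContDiff ℝ 1 η) (hηc : HasCompactSupport η)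
    (hf : ContDiff ℝ 1 f) (q v : E × ℝ) :
    fderiv ℝ (coneAverage μ η f) q v =
      ∫ y, η y * fderiv ℝ f (q.1 + q.2 • y) (v.1 + v.2 • y) ∂μ := by
  set G : (E × ℝ) × E → ℝ := fun p => η p.2 * f (p.1.1 + p.1.2 • p.2) with hG
  have hG1 : ContDiff ℝ 1 G := contDiff_weight_mul hη hf
  have h := hasFDerivAt_setIntegral_of_contDiff (μ := μ) hG1 hηc.isCompact q
  have hd : Continuous fun y : E => (fderiv ℝ G (q, y)).comp
      (ContinuousLinearMap.inl ℝ (E × ℝ) E) :=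
    ((hG1.continuous_fderiv one_ne_zero).comp (Continuous.prodMk_right q)).clm_comp
      continuous_const
  have hco : coneAverage μ η f = fun q => ∫ y in tsupport η, G (q, y) ∂μ :=
    funext fun q => coneAverage_eq_setIntegral η f q
  rw [hco, h.fderiv, ContinuousLinearMap.integral_apply
    (hd.continuousOn.integrableOn_compact hηc.isCompact)]
  have hpt : ∀ y, ((fderiv ℝ G (q, y)).comp (ContinuousLinearMap.inl ℝ (E × ℝ) E)) v =
      η y * fderiv ℝ f (q.1 + q.2 • y) (v.1 + v.2 • y) := by
    intro y
    have h1 : HasFDerivAt (fun p : E × ℝ => G (p, y))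
        ((fderiv ℝ G (q, y)).comp (ContinuousLinearMap.inl ℝ (E × ℝ) E)) q :=
      HasFDerivAt.comp (g := G) (f := fun p : E × ℝ => (p, y)) q
        (hG1.differentiable one_ne_zero (q, y)).hasFDerivAt (hasFDerivAt_prodMk_left q y)
    have h2 : HasFDerivAt (fun p : E × ℝ => p.1 + p.2 • y)
        (ContinuousLinearMap.fst ℝ E ℝ + (ContinuousLinearMap.snd ℝ E ℝ).smulRight y) q :=
      hasFDerivAt_fst.add (hasFDerivAt_snd.smul_const y)
    have h3 := ((hf.differentiable one_ne_zero (q.1 + q.2 • y)).hasFDerivAt.comp q h2).const_mul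
      (η y)
    rw [h1.unique h3]
    simp
    ring
  simp_rw [hpt]
  refine setIntegral_eq_integral_of_forall_compl_eq_zero fun y hy => ?_
  rw [image_eq_zero_of_notMem_tsupport hy, zero_mul]

/-- Integration by parts in the averaging variable removes the derivative of `f`; as the weights
that come up integrate to zero, only differences of `f` enter. -/
theorem exists_enorm_fderiv_coneAverage_le {η : E → ℝ} (hη : ContDiff ℝ 2 η)
    (hηc : HasCompactSupport η) :
    ∃ C : ℝ≥0, ∀ f : E → ℝ, ContDiff ℝ 1 f → ∀ q : E × ℝ, 0 < q.2 →
      ‖fderiv ℝ (coneAverage μ η f) q‖ₑ ≤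
        C * (ENNReal.ofReal q.2)⁻¹ * ∫⁻ y in tsupport η, ‖f (q.1 + q.2 • y) - f q.1‖ₑ ∂μ := by
  have hη1 : ContDiff ℝ 1 η := hη.of_le (by norm_num)
  -- In coordinates, with `g y = f (x + t y) - f x`, the derivative in the direction `v` is `t⁻¹`
  -- times the integral of `V · ∇g` for the field `V y = η y (v.1 + v.2 y)`, and `m y` bounds the
  -- divergence of `V` at `y` if `‖v‖ ≤ 1`.
  set b := Module.finBasis ℝ E with hb
  set c : Fin (Module.finrank ℝ E) → E →L[ℝ] ℝ := fun j =>
    LinearMap.toContinuousLinearMap (b.coord j) with hc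
  set m : E → ℝ := fun y => ∑ j, (|fderiv ℝ η y (b j)| * (‖c j‖ * (1 + ‖y‖)) + |η y|) with hm
  have hηd : ∀ v, Continuous fun y => fderiv ℝ η y v := fun v =>
    (hη1.continuous_fderiv one_ne_zero).clm_apply continuous_const
  have hmc : Continuous m := by
    refine continuous_finsetSum _ fun j _ => ?_
    exact ((hηd (b j)).abs.mul (continuous_const.mul (continuous_const.add continuous_norm))).add
      hη1.continuous.abs
  obtain ⟨C, hC⟩ := (hηc.isCompact.image hmc).isBounded.exists_norm_le
  refine ⟨C.toNNReal, fun f hf q hq => ?_⟩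
  obtain ⟨x, t⟩ := q
  simp only at hq ⊢
  set g : E → ℝ := fun y => f (x + t • y) - f x with hg
  have hg1 : ContDiff ℝ 1 g := by fun_prop
  have hgd : ∀ y v, fderiv ℝ g y v = t * fderiv ℝ f (x + t • y) v := by
    intro y v
    have h2 : HasFDerivAt (fun y : E => x + t • y) (t • ContinuousLinearMap.id ℝ E) y :=
      ((hasFDerivAt_id y).const_smul t).const_add x
    have h3 := ((hf.differentiable one_ne_zero (x + t • y)).hasFDerivAt.comp y h2).sub_const (f x)
    have h4 : fderiv ℝ g y = (fderiv ℝ f (x + t • y)).comp (t • ContinuousLinearMap.id ℝ E) :=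
      h3.fderiv
    rw [h4]
    simp
  by_cases hfin : ∫⁻ y in tsupport η, ‖g y‖ₑ ∂μ = ⊤
  · exact absurd hfin (hg1.continuous.continuousOn.integrableOn_compact hηc.isCompact).2.ne
  set I : ℝ := ∫ y in tsupport η, ‖g y‖ ∂μ with hI
  have hIe : ENNReal.ofReal I = ∫⁻ y in tsupport η, ‖g y‖ₑ ∂μ :=
    ofReal_integral_norm_eq_lintegral_enorm
      (hg1.continuous.continuousOn.integrableOn_compact hηc.isCompact)
  have hC0 : 0 ≤ max C 0 := le_max_right _ _
  have hI0 : 0 ≤ I := integral_nonneg fun _ => norm_nonneg _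
  have key : ‖fderiv ℝ (coneAverage μ η f) (x, t)‖ ≤ max C 0 * t⁻¹ * I := by
    refine ContinuousLinearMap.opNorm_le_bound _ (by positivity) fun v => ?_
    rw [fderiv_coneAverage_apply hη1 hηc hf]
    simp only
    set V : Fin (Module.finrank ℝ E) → E → ℝ := fun j y => η y * c j (v.1 + v.2 • y) with hV
    have hV1 : ∀ j, ContDiff ℝ 1 (V j) := fun j => by fun_prop
    have hVs : ∀ j, HasCompactSupport (V j) := fun j => hηc.mul_right
    have hsum : ∀ y, η y * fderiv ℝ f (x + t • y) (v.1 + v.2 • y) =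
        t⁻¹ * ∑ j, V j y * fderiv ℝ g y (b j) := by
      intro y
      have h5 : v.1 + v.2 • y = ∑ j, c j (v.1 + v.2 • y) • b j := (b.sum_repr _).symm
      conv_lhs => rw [h5]
      simp only [map_sum, map_smul, hgd, smul_eq_mul, Finset.mul_sum, hV]
      refine Finset.sum_congr rfl fun j _ => ?_
      field_simp
    simp_rw [hsum]
    have hgc : ∀ w, Continuous fun y => fderiv ℝ g y w := fun w =>
      (hg1.continuous_fderiv one_ne_zero).clm_apply continuous_const
    have hVc : ∀ j w, Continuous fun y => fderiv ℝ (V j) y w := fun j w =>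
      ((hV1 j).continuous_fderiv one_ne_zero).clm_apply continuous_const
    have hVd : ∀ j w, HasCompactSupport fun y => fderiv ℝ (V j) y w := fun j w =>
      (hVs j).fderiv_apply (𝕜 := ℝ) w
    have hi1 : ∀ j, Integrable (fun y => V j y * fderiv ℝ g y (b j)) μ := fun j =>
      ((hV1 j).continuous.mul (hgc _)).integrable_of_hasCompactSupport (hVs j).mul_right
    have hi2 : ∀ j, Integrable (fun y => fderiv ℝ (V j) y (b j) * g y) μ := fun j =>
      ((hVc j _).mul hg1.continuous).integrable_of_hasCompactSupport (hVd j _).mul_right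
    have hparts : ∀ j, ∫ y, V j y * fderiv ℝ g y (b j) ∂μ =
        - ∫ y, fderiv ℝ (V j) y (b j) * g y ∂μ := fun j =>
      integral_mul_fderiv_eq_neg_fderiv_mul_of_integrable (hi2 j) (hi1 j)
        (((hV1 j).continuous.mul hg1.continuous).integrable_of_hasCompactSupport (hVs j).mul_right)
        (fun y _ => (hV1 j).differentiable one_ne_zero y)
        (fun y _ => hg1.differentiable one_ne_zero y)
    rw [integral_const_mul, integral_finsetSum _ fun j _ => hi1 j]
    simp_rw [hparts]
    rw [Finset.sum_neg_distrib, ← integral_finsetSum _ fun j _ => hi2 j, norm_mul, norm_neg,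
      norm_inv, Real.norm_of_nonneg hq.le]
    have hder : ∀ j y, |fderiv ℝ (V j) y (b j)| ≤
        (|fderiv ℝ η y (b j)| * (‖c j‖ * (1 + ‖y‖)) + |η y|) * ‖v‖ := by
      intro j y
      have h6 : HasFDerivAt (fun y : E => c j (v.1 + v.2 • y)) (v.2 • c j) y := by
        have h7 : HasFDerivAt (fun y : E => v.1 + v.2 • y) (v.2 • ContinuousLinearMap.id ℝ E) y :=
          ((hasFDerivAt_id y).const_smul v.2).const_add v.1
        convert! (c j).hasFDerivAt.comp y h7 using 1
        ext w
        simp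
      have h8 : fderiv ℝ (V j) y = η y • (v.2 • c j) + c j (v.1 + v.2 • y) • fderiv ℝ η y :=
        ((hη1.differentiable one_ne_zero y).hasFDerivAt.mul h6).fderiv
      have h9 : c j (b j) = 1 := by simp [hc]
      rw [h8]
      simp only [_root_.add_apply, _root_.smul_apply, smul_eq_mul, h9, mul_one]
      have hv1 : ‖v.1‖ ≤ ‖v‖ := norm_fst_le v
      have hv2 : |v.2| ≤ ‖v‖ := norm_snd_le v
      have h10 : |c j (v.1 + v.2 • y)| ≤ ‖c j‖ * (1 + ‖y‖) * ‖v‖ := by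
        calc |c j (v.1 + v.2 • y)| ≤ ‖c j‖ * ‖v.1 + v.2 • y‖ := (c j).le_opNorm _
          _ ≤ ‖c j‖ * (‖v.1‖ + |v.2| * ‖y‖) := by
              gcongr
              refine (norm_add_le _ _).trans ?_
              rw [norm_smul, Real.norm_eq_abs]
          _ ≤ ‖c j‖ * (‖v‖ + ‖v‖ * ‖y‖) := by gcongr
          _ = _ := by ring
      calc |η y * v.2 + c j (v.1 + v.2 • y) * fderiv ℝ η y (b j)|
          ≤ |η y| * |v.2| + |c j (v.1 + v.2 • y)| * |fderiv ℝ η y (b j)| := by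
            refine (abs_add_le _ _).trans ?_
            rw [abs_mul, abs_mul]
        _ ≤ |η y| * ‖v‖ + (‖c j‖ * (1 + ‖y‖) * ‖v‖) * |fderiv ℝ η y (b j)| := by gcongr
        _ = _ := by ring
    have hbound : ‖∫ y, ∑ j, fderiv ℝ (V j) y (b j) * g y ∂μ‖ ≤ max C 0 * ‖v‖ * I := by
      rw [hI, ← integral_const_mul]
      have hz : ∀ y, y ∉ tsupport η → ∑ j, fderiv ℝ (V j) y (b j) * g y = 0 := by
        intro y hy
        refine Finset.sum_eq_zero fun j _ => ?_
        have h11 : fderiv ℝ (V j) y = 0 := by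
          by_contra h0
          exact hy (closure_mono (Function.support_mul_subset_left η _)
            (support_fderiv_subset ℝ (f := V j) h0))
        simp [h11]
      rw [← setIntegral_eq_integral_of_forall_compl_eq_zero hz]
      refine norm_integral_le_of_norm_le
        (((hg1.continuous.norm).const_mul _).continuousOn.integrableOn_compact hηc.isCompact) ?_
      refine ae_restrict_of_forall_mem hηc.isCompact.measurableSet fun y hy => ?_
      rw [← Finset.sum_mul, norm_mul]
      refine mul_le_mul_of_nonneg_right ?_ (norm_nonneg _)
      calc ‖∑ j, fderiv ℝ (V j) y (b j)‖ ≤ ∑ j, |fderiv ℝ (V j) y (b j)| := norm_sum_le _ _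
        _ ≤ ∑ j, (|fderiv ℝ η y (b j)| * (‖c j‖ * (1 + ‖y‖)) + |η y|) * ‖v‖ :=
            Finset.sum_le_sum fun j _ => hder j y
        _ = m y * ‖v‖ := by rw [hm, Finset.sum_mul]
        _ ≤ max C 0 * ‖v‖ := by
            gcongr
            exact (le_abs_self _).trans ((hC _ ⟨y, hy, rfl⟩).trans (le_max_left _ _))
    calc t⁻¹ * ‖∫ y, ∑ j, fderiv ℝ (V j) y (b j) * g y ∂μ‖ ≤ t⁻¹ * (max C 0 * ‖v‖ * I) := by
          gcongr
      _ = _ := by ring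
  calc ‖fderiv ℝ (coneAverage μ η f) (x, t)‖ₑ
      = ENNReal.ofReal ‖fderiv ℝ (coneAverage μ η f) (x, t)‖ := (ofReal_norm _).symm
    _ ≤ ENNReal.ofReal (max C 0 * t⁻¹ * I) := ENNReal.ofReal_le_ofReal key
    _ = _ := by
        rw [ENNReal.ofReal_mul (by positivity), ENNReal.ofReal_mul hC0, hIe,
          ENNReal.ofReal_inv_of_pos hq]
        congr 2
        simp [ENNReal.ofReal, Real.toNNReal]

/-- For `t > 0` the average is a convolution of `f` with a kernel that depends smoothly on `t`. -/
theorem coneAverage_eq_convolution (η f : E → ℝ) {q : E × ℝ} (hq : 0 < q.2) :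
    coneAverage μ η f q =
      convolution f (fun z => (q.2 ^ Module.finrank ℝ E)⁻¹ * η (-(q.2⁻¹ • z)))
        (ContinuousLinearMap.mul ℝ ℝ) μ q.1 := by
  obtain ⟨x, t⟩ := q
  simp only at hq ⊢
  have h1 : coneAverage μ η f (x, t) = ∫ y, (fun z => η (t⁻¹ • z) * f (x + z)) (t • y) ∂μ := by
    simp [coneAverage, smul_smul, inv_mul_cancel₀ hq.ne']
  rw [h1, Measure.integral_comp_smul μ (fun z => η (t⁻¹ • z) * f (x + z)) t, convolution,
    ← integral_add_left_eq_self
      (fun z => ContinuousLinearMap.mul ℝ ℝ (f z) _) x, smul_eq_mul, ← integral_const_mul]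
  refine integral_congr_ae (Eventually.of_forall fun z => ?_)
  simp only [ContinuousLinearMap.mul_apply', sub_add_cancel_left, smul_neg, neg_neg]
  rw [abs_of_pos (by positivity)]
  ring

/-- All derivatives fall on the kernel, so that no regularity of `f` is needed away from `t = 0`. -/
theorem contDiffOn_coneAverage {η f : E → ℝ} (hη : ContDiff ℝ 2 η) (hηc : HasCompactSupport η)
    (hf : Continuous f) : ContDiffOn ℝ 2 (coneAverage μ η f) (univ ×ˢ Ioi 0) := by
  rintro ⟨x, t⟩ ⟨-, ht⟩
  refine ContDiffAt.contDiffWithinAt ?_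
  have ht0 : (0 : ℝ) < t := ht
  obtain ⟨R, hR⟩ := hηc.isCompact.isBounded.exists_norm_le
  -- On a bounded range of parameters the kernels have a common compact support.
  set s : Set ℝ := Ioo 0 (t + 1) with hs
  have hconv := contDiffOn_convolution_right_with_param (μ := μ) (n := 2) (f := f) (k :=
    Metric.closedBall (0 : E) ((t + 1) * |R|)) (s := s)
    (g := fun t z => (t ^ Module.finrank ℝ E)⁻¹ * η (-(t⁻¹ • z))) (ContinuousLinearMap.mul ℝ ℝ)
    isOpen_Ioo (isCompact_closedBall _ _) ?_ hf.locallyIntegrable ?_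
  · have h2 : ContDiffOn ℝ 2 (fun q : E × ℝ => convolution f
        (fun z => (q.2 ^ Module.finrank ℝ E)⁻¹ * η (-(q.2⁻¹ • z)))
        (ContinuousLinearMap.mul ℝ ℝ) μ q.1) (univ ×ˢ s) :=
      hconv.comp (g := fun q : ℝ × E => convolution f
        (fun z => (q.1 ^ Module.finrank ℝ E)⁻¹ * η (-(q.1⁻¹ • z)))
        (ContinuousLinearMap.mul ℝ ℝ) μ q.2) (contDiff_snd.prodMk contDiff_fst).contDiffOn
        (fun q hq => ⟨hq.2, mem_univ _⟩)
    have h3 : univ ×ˢ s ∈ 𝓝 (x, t) :=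
      (isOpen_univ.prod isOpen_Ioo).mem_nhds ⟨mem_univ _, ht0, by linarith⟩
    refine (h2.contDiffAt h3).congr_of_eventuallyEq ?_
    filter_upwards [h3] with q hq using coneAverage_eq_convolution η f hq.2.1
  · intro p z hp hz
    have hp0 : 0 < p := hp.1
    have : -(p⁻¹ • z) ∉ tsupport η := by
      intro hmem
      have h4 := hR _ hmem
      rw [norm_neg, norm_smul, norm_inv, Real.norm_of_nonneg hp0.le, inv_mul_le_iff₀ hp0] at h4
      refine hz (mem_closedBall_zero_iff.2 (h4.trans ?_))
      exact mul_le_mul hp.2.le (le_abs_self R) ((norm_nonneg _).trans (hR _ hmem)) (by linarith)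
    rw [image_eq_zero_of_notMem_tsupport this, mul_zero]
  · have h5 : ContDiffOn ℝ 2 (fun p : ℝ × E => (p.1)⁻¹) (s ×ˢ univ) :=
      contDiff_fst.contDiffOn.inv fun p hp => (hp.1.1 : (0 : ℝ) < p.1).ne'
    have h6 : ContDiffOn ℝ 2 (fun p : ℝ × E => η (-(p.1⁻¹ • p.2))) (s ×ˢ univ) :=
      hη.comp_contDiffOn (h5.smul contDiff_snd.contDiffOn).neg
    refine ContDiffOn.mul ?_ h6
    exact (contDiff_fst.contDiffOn.pow _).inv fun p hp =>
      pow_ne_zero _ (hp.1.1 : (0 : ℝ) < p.1).ne'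

end Mollify

/-! ### Trace estimates for oscillations over cones -/

/-- Jensen's inequality for the power `p ≥ 1`, on a set of arbitrary measure. -/
theorem rpow_lintegral_le {α : Type*} [MeasurableSpace α] (μ : Measure α) {f : α → ℝ≥0∞}
    (hf : AEMeasurable f μ) {p : ℝ} (hp : 1 ≤ p) :
    (∫⁻ a, f a ∂μ) ^ p ≤ μ univ ^ (p - 1) * ∫⁻ a, f a ^ p ∂μ := by
  have hp0 : 0 < p := by linarith
  have h := ENNReal.lintegral_mul_norm_pow_le (μ := μ) (f := fun a => f a ^ p) (g := fun _ => 1)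
    (hf.pow_const p) aemeasurable_const (p := 1 / p) (q := 1 - 1 / p) (by positivity)
    (by rw [sub_nonneg, div_le_one hp0]; exact hp) (by ring)
  simp only [← ENNReal.rpow_mul, mul_one_div_cancel hp0.ne', ENNReal.rpow_one, ENNReal.one_rpow,
    mul_one, lintegral_const, one_mul] at h
  calc (∫⁻ a, f a ∂μ) ^ p ≤ ((∫⁻ a, f a ^ p ∂μ) ^ (1 / p) * μ univ ^ (1 - 1 / p)) ^ p := by gcongr
    _ = _ := by
      rw [ENNReal.mul_rpow_of_nonneg _ _ hp0.le, ← ENNReal.rpow_mul, ← ENNReal.rpow_mul,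
        one_div_mul_cancel hp0.ne', ENNReal.rpow_one, mul_comm]
      congr 2
      field_simp

/-- The tail of an integral of a power, in `[0, ∞]`. -/
theorem lintegral_Ioi_inv_rpow_le {r a : ℝ} (hr : 1 < r) (ha : 0 < a) :
    ∫⁻ t in Ioi a, (ENNReal.ofReal t)⁻¹ ^ r =
      ENNReal.ofReal (1 / (r - 1)) * (ENNReal.ofReal a)⁻¹ ^ (r - 1) := by
  have h1 : ∀ t ∈ Ioi a, (ENNReal.ofReal t)⁻¹ ^ r = ENNReal.ofReal (t ^ (-r)) := by
    intro t ht
    have ht0 : 0 < t := ha.trans ht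
    rw [← ENNReal.ofReal_inv_of_pos ht0, ENNReal.ofReal_rpow_of_pos (inv_pos.2 ht0),
      Real.inv_rpow ht0.le, Real.rpow_neg ht0.le]
  rw [setLIntegral_congr_fun measurableSet_Ioi h1, ← ofReal_integral_eq_lintegral_ofReal
    (integrableOn_Ioi_rpow_of_lt (by linarith) ha), integral_Ioi_rpow_of_lt (by linarith) ha]
  · rw [← ENNReal.ofReal_inv_of_pos ha, ENNReal.ofReal_rpow_of_pos (inv_pos.2 ha),
      Real.inv_rpow ha.le, ← Real.rpow_neg ha.le,
      ← ENNReal.ofReal_mul (by rw [one_div_nonneg]; linarith)]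
    congr 1
    rw [show -r + 1 = -(r - 1) by ring]
    have : r - 1 ≠ 0 := by linarith
    field_simp
  · refine ae_restrict_of_forall_mem measurableSet_Ioi fun t ht => ?_
    exact Real.rpow_nonneg (ha.trans ht).le _

variable {n : ℕ}

local notation "𝔼" => EuclideanSpace ℝ (Fin n)

theorem lintegral_comp_add_smul (G : 𝔼 → ℝ≥0∞) (hG : Measurable G) (x : 𝔼) {t : ℝ} (ht : 0 < t) :
    ∫⁻ y, G (x + t • y) = (ENNReal.ofReal t)⁻¹ ^ (n : ℝ) * ∫⁻ w, G w := by
  have h1 : ∫⁻ y, G (x + t • y) = ∫⁻ z, G (x + z) ∂(Measure.map (fun y : 𝔼 => t • y) volume) := by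
    rw [lintegral_map (f := fun z => G (x + z)) (hG.comp (measurable_const_add x))
      (measurable_const_smul t)]
  rw [h1, Measure.map_addHaar_smul _ ht.ne', lintegral_smul_measure,
    lintegral_add_left_eq_self (fun z => G z), finrank_euclideanSpace_fin, smul_eq_mul,
    abs_of_pos (by positivity), ← inv_pow, ENNReal.ofReal_pow (by positivity),
    ENNReal.ofReal_inv_of_pos ht, ENNReal.rpow_natCast]

/-- The double integral that defines the `p`-th power of the Gagliardo seminorm of smoothness
`1 - 1/p` on a set `K`. -/
noncomputable def traceEnergy (K : Set (EuclideanSpace ℝ (Fin n))) (p : ℝ)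
    (g : EuclideanSpace ℝ (Fin n) → ℝ) : ℝ≥0∞ :=
  ∫⁻ z in K ×ˢ K, ‖g z.1 - g z.2‖ₑ ^ p / ‖z.1 - z.2‖ₑ ^ ((n : ℝ) + p - 1)

theorem traceEnergy_mono {K L : Set 𝔼} (h : K ⊆ L) (p : ℝ) (g : 𝔼 → ℝ) :
    traceEnergy K p g ≤ traceEnergy L p g :=
  lintegral_mono_set (prod_mono h h)

theorem traceEnergy_congr {K : Set 𝔼} (hK : MeasurableSet K) (p : ℝ) {f g : 𝔼 → ℝ}
    (h : EqOn f g K) : traceEnergy K p f = traceEnergy K p g := by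
  refine setLIntegral_congr_fun (hK.prod hK) fun z hz => ?_
  simp only [h hz.1, h hz.2]

theorem traceEnergy_eq_lintegral_indicator {K : Set 𝔼} (hK : MeasurableSet K) {p : ℝ} (hp : 0 < p)
    (g : 𝔼 → ℝ) :
    ∫⁻ z, ((K ×ˢ K).indicator (fun z : 𝔼 × 𝔼 => ‖g z.1 - g z.2‖ₑ) z) ^ p /
      ‖z.1 - z.2‖ₑ ^ ((n : ℝ) + p - 1) = traceEnergy K p g := by
  rw [traceEnergy, ← lintegral_indicator (hK.prod hK)]
  refine lintegral_congr fun z => ?_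
  by_cases hz : z ∈ K ×ˢ K
  · rw [indicator_of_mem hz, indicator_of_mem hz]
  · rw [indicator_of_notMem hz, indicator_of_notMem hz, ENNReal.zero_rpow_of_pos hp,
      ENNReal.zero_div]

/-- The oscillation of `g` around `x` at scale `t`, integrated (without normalization) over directions
in `B`. -/
noncomputable def coneOscillation (B : Set (EuclideanSpace ℝ (Fin n)))
    (g : EuclideanSpace ℝ (Fin n) → ℝ) (q : EuclideanSpace ℝ (Fin n) × ℝ) : ℝ≥0∞ :=
  ∫⁻ y in B, ‖g (q.1 + q.2 • y) - g q.1‖ₑ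

theorem measurable_coneOscillation (B : Set 𝔼) {g : 𝔼 → ℝ} (hg : Measurable g) :
    Measurable (coneOscillation B g) := by
  refine Measurable.lintegral_prod_right' (f := fun p : (𝔼 × ℝ) × 𝔼 =>
    ‖g (p.1.1 + p.1.2 • p.2) - g p.1.1‖ₑ) ?_
  fun_prop

/-- The constant in the trace estimate, for directions in a set `B` within the ball of radius `R`. -/
noncomputable def traceConst (B : Set (EuclideanSpace ℝ (Fin n))) (R p : ℝ) : ℝ≥0∞ :=
  volume B ^ (p - 1) * (ENNReal.ofReal (1 / (n + p - 1)) * ENNReal.ofReal R ^ ((n : ℝ) + p - 1))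

theorem traceConst_ne_top {B : Set 𝔼} (hB : volume B ≠ ∞) (R : ℝ) {p : ℝ} (hp : 1 ≤ p) :
    traceConst B R p ≠ ∞ := by
  have hn : (0 : ℝ) ≤ n := Nat.cast_nonneg n
  refine ENNReal.mul_ne_top (ENNReal.rpow_ne_top_of_nonneg (by linarith) hB) ?_
  exact ENNReal.mul_ne_top ENNReal.ofReal_ne_top
    (ENNReal.rpow_ne_top_of_nonneg (by linarith) ENNReal.ofReal_ne_top)

/-- Integral form of the trace estimate: means of a function `d (x, w)` vanishing on the diagonal
over the points `w = x + t y` at distance comparable to `t` from `x`, divided by `t`, are controlled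
in `L^p` of the half-space by an integral with a Gagliardo kernel of smoothness `1 - 1/p`. Up to
Jensen's inequality this is the substitution `w = x + t y` and integration in `t`. -/
theorem lintegral_inv_mul_lintegral_rpow_le {B : Set 𝔼} (hB : MeasurableSet B) {R : ℝ}
    (hR : 0 < R) (hBR : ∀ y ∈ B, ‖y‖ < R) {p : ℝ} (hp : 1 ≤ p) (hnp : 1 < n + p)
    {d : 𝔼 × 𝔼 → ℝ≥0∞} (hd : Measurable d) (hd0 : ∀ x, d (x, x) = 0) :
    ∫⁻ q in univ ×ˢ Ioi (0 : ℝ), ((ENNReal.ofReal q.2)⁻¹ *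
        ∫⁻ y in B, d (q.1, q.1 + q.2 • y)) ^ p ≤
      traceConst B R p * ∫⁻ z, d z ^ p / ‖z.1 - z.2‖ₑ ^ ((n : ℝ) + p - 1) := by
  rw [traceConst]
  have hp0 : 0 < p := by linarith
  set Φ : 𝔼 × ℝ → 𝔼 → ℝ≥0∞ := fun q w =>
    {w : 𝔼 | ‖q.1 - w‖ < R * q.2}.indicator (fun w => (ENNReal.ofReal q.2)⁻¹ ^ ((n : ℝ) + p) *
      d (q.1, w) ^ p) w with hΦ
  have hΦm : Measurable (Function.uncurry Φ) := by
    have hs : MeasurableSet {z : (𝔼 × ℝ) × 𝔼 | ‖z.1.1 - z.2‖ < R * z.1.2} :=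
      measurableSet_lt (by fun_prop) (by fun_prop)
    have hm : Measurable fun z : (𝔼 × ℝ) × 𝔼 =>
        (ENNReal.ofReal z.1.2)⁻¹ ^ ((n : ℝ) + p) * d (z.1.1, z.2) ^ p := by
      fun_prop
    exact hm.indicator hs
  have step : ∀ q ∈ univ ×ˢ Ioi (0 : ℝ), ((ENNReal.ofReal q.2)⁻¹ *
      ∫⁻ y in B, d (q.1, q.1 + q.2 • y)) ^ p ≤ volume B ^ (p - 1) * ∫⁻ w, Φ q w := by
    rintro ⟨x, t⟩ hq
    have ht : 0 < t := hq.2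
    have hJ : (∫⁻ y in B, d (x, x + t • y)) ^ p ≤
        volume B ^ (p - 1) * ∫⁻ y in B, d (x, x + t • y) ^ p := by
      have := rpow_lintegral_le (volume.restrict B) (f := fun y => d (x, x + t • y))
        (Measurable.aemeasurable (by fun_prop)) hp
      rwa [Measure.restrict_apply_univ] at this
    have hsub : ∫⁻ y in B, d (x, x + t • y) ^ p ≤
        (ENNReal.ofReal t)⁻¹ ^ (n : ℝ) *
          ∫⁻ w, {w : 𝔼 | ‖x - w‖ < R * t}.indicator (fun w => d (x, w) ^ p) w := by
      have hGm : Measurable ({w : 𝔼 | ‖x - w‖ < R * t}.indicator fun w => d (x, w) ^ p) :=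
        Measurable.indicator (by fun_prop) (measurableSet_lt (by fun_prop) (by fun_prop))
      rw [← lintegral_comp_add_smul _ hGm x ht, ← lintegral_indicator hB]
      refine lintegral_mono fun y => ?_
      by_cases hy : y ∈ B
      · rw [indicator_of_mem hy, indicator_of_mem]
        simp only [mem_ofPred_eq, sub_add_cancel_left, norm_neg, norm_smul,
          Real.norm_of_nonneg ht.le]
        rw [mul_comm]
        exact mul_lt_mul_of_pos_right (hBR y hy) ht
      · rw [indicator_of_notMem hy]
        exact zero_le
    have hΦe : ∫⁻ w, Φ (x, t) w = (ENNReal.ofReal t)⁻¹ ^ ((n : ℝ) + p) *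
        ∫⁻ w, {w : 𝔼 | ‖x - w‖ < R * t}.indicator (fun w => d (x, w) ^ p) w := by
      rw [← lintegral_const_mul']
      · refine lintegral_congr fun w => ?_
        simp only [hΦ]
        by_cases hw : w ∈ {w : 𝔼 | ‖x - w‖ < R * t}
        · rw [indicator_of_mem hw, indicator_of_mem hw]
        · rw [indicator_of_notMem hw, indicator_of_notMem hw, mul_zero]
      · refine ENNReal.rpow_ne_top_of_nonneg (by positivity) ?_
        simpa using ht
    rw [ENNReal.mul_rpow_of_nonneg _ _ hp0.le, hΦe]
    calc (ENNReal.ofReal t)⁻¹ ^ p * (∫⁻ y in B, d (x, x + t • y)) ^ p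
        ≤ (ENNReal.ofReal t)⁻¹ ^ p * (volume B ^ (p - 1) * ((ENNReal.ofReal t)⁻¹ ^ (n : ℝ) *
          ∫⁻ w, {w : 𝔼 | ‖x - w‖ < R * t}.indicator (fun w => d (x, w) ^ p) w)) := by
          gcongr
          exact hJ.trans (by gcongr)
      _ = _ := by
          rw [ENNReal.rpow_add_of_nonneg _ _ (Nat.cast_nonneg n) hp0.le]
          ring
  have hΦm1 : Measurable fun q => ∫⁻ w, Φ q w := hΦm.lintegral_prod_right
  have hQ : MeasurableSet (univ ×ˢ Ioi 0 : Set (𝔼 × ℝ)) := MeasurableSet.univ.prod measurableSet_Ioi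
  calc ∫⁻ q in univ ×ˢ Ioi (0 : ℝ), ((ENNReal.ofReal q.2)⁻¹ *
        ∫⁻ y in B, d (q.1, q.1 + q.2 • y)) ^ p
      ≤ ∫⁻ q in univ ×ˢ Ioi (0 : ℝ), volume B ^ (p - 1) * ∫⁻ w, Φ q w := setLIntegral_mono' hQ step
    _ = volume B ^ (p - 1) * ∫⁻ q in univ ×ˢ Ioi (0 : ℝ), ∫⁻ w, Φ q w :=
        lintegral_const_mul _ hΦm1
    _ ≤ volume B ^ (p - 1) * ((ENNReal.ofReal (1 / (n + p - 1)) *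
          ENNReal.ofReal R ^ ((n : ℝ) + p - 1)) *
            ∫⁻ z, d z ^ p / ‖z.1 - z.2‖ₑ ^ ((n : ℝ) + p - 1)) := by
        gcongr
        calc ∫⁻ q in univ ×ˢ Ioi (0 : ℝ), ∫⁻ w, Φ q w
            = ∫⁻ x, ∫⁻ t in Ioi (0 : ℝ), ∫⁻ w, Φ (x, t) w := by
              rw [Measure.volume_eq_prod, setLIntegral_prod _ hΦm1.aemeasurable,
                Measure.restrict_univ]
          _ = ∫⁻ x, ∫⁻ w, ∫⁻ t in Ioi (0 : ℝ), Φ (x, t) w := by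
              refine lintegral_congr fun x => ?_
              have hΦx : Measurable (Function.uncurry fun t w => Φ (x, t) w) := by
                have h := hΦm.comp (g := Function.uncurry Φ)
                  (f := fun z : ℝ × 𝔼 => ((x, z.1), z.2)) (by fun_prop)
                exact h
              exact lintegral_lintegral_swap (f := fun t w => Φ (x, t) w) hΦx.aemeasurable
          _ ≤ ∫⁻ x, ∫⁻ w, (ENNReal.ofReal (1 / (n + p - 1)) *
                ENNReal.ofReal R ^ ((n : ℝ) + p - 1)) *
                  (d (x, w) ^ p / ‖x - w‖ₑ ^ ((n : ℝ) + p - 1)) := by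
              refine lintegral_mono fun x => lintegral_mono fun w => ?_
              rcases eq_or_ne x w with rfl | hne
              · have : ∀ t, Φ (x, t) x = 0 := by
                  intro t
                  simp [hΦ, hd0, ENNReal.zero_rpow_of_pos hp0]
                simp [this]
              have hpos : 0 < ‖x - w‖ := norm_pos_iff.2 (sub_ne_zero.2 hne)
              have ha : 0 < ‖x - w‖ / R := div_pos hpos hR
              have h1 : ∫⁻ t in Ioi (0 : ℝ), Φ (x, t) w ≤
                  ∫⁻ t in Ioi (‖x - w‖ / R), (ENNReal.ofReal t)⁻¹ ^ ((n : ℝ) + p) *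
                    d (x, w) ^ p := by
                rw [← lintegral_indicator measurableSet_Ioi,
                  ← lintegral_indicator measurableSet_Ioi]
                refine lintegral_mono fun t => ?_
                by_cases ht : ‖x - w‖ / R < t
                · rw [indicator_of_mem (show t ∈ Ioi (0 : ℝ) from ha.trans ht),
                    indicator_of_mem (show t ∈ Ioi (‖x - w‖ / R) from ht)]
                  exact indicator_le_self _ _ _
                · have h2 : w ∉ {w : 𝔼 | ‖x - w‖ < R * t} := by
                    simp only [mem_ofPred_eq]
                    rwa [div_lt_iff₀' hR] at ht
                  have h3 : Φ (x, t) w = 0 := indicator_of_notMem h2 _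
                  have h4 : (Ioi (0 : ℝ)).indicator (fun t => Φ (x, t) w) t = 0 :=
                    indicator_apply_eq_zero.2 fun _ => h3
                  rw [h4]
                  exact zero_le
              refine h1.trans ?_
              rw [lintegral_mul_const _ (by fun_prop), lintegral_Ioi_inv_rpow_le hnp ha,
                ENNReal.ofReal_div_of_pos hR, ENNReal.inv_div (by simp) (by simp [hR]),
                ofReal_norm, ENNReal.div_rpow_of_nonneg _ _ (by linarith)]
              simp only [div_eq_mul_inv]
              exact le_of_eq (by ring)
          _ = _ := by
              have hm : Measurable fun z : 𝔼 × 𝔼 => d z ^ p / ‖z.1 - z.2‖ₑ ^ ((n : ℝ) + p - 1) := by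
                fun_prop
              rw [Measure.volume_eq_prod, lintegral_prod _ hm.aemeasurable, ← lintegral_const_mul']
              · refine lintegral_congr fun x => ?_
                rw [lintegral_const_mul']
                exact ENNReal.mul_ne_top ENNReal.ofReal_ne_top
                  (ENNReal.rpow_ne_top_of_nonneg (by linarith) ENNReal.ofReal_ne_top)
              · exact ENNReal.mul_ne_top ENNReal.ofReal_ne_top
                  (ENNReal.rpow_ne_top_of_nonneg (by linarith) ENNReal.ofReal_ne_top)
    _ = _ := by ring

/-- The trace estimate for the oscillations of a function, on a set `Q` of points `(x, t)` for which
the points `x + t y` involved stay in `K`. -/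
theorem lintegral_inv_mul_coneOscillation_rpow_le {B : Set 𝔼} (hB : MeasurableSet B) {R : ℝ}
    (hR : 0 < R) (hBR : ∀ y ∈ B, ‖y‖ < R) {p : ℝ} (hp : 1 ≤ p) (hnp : 1 < n + p) {g : 𝔼 → ℝ}
    (hg : Measurable g) {K : Set 𝔼} (hK : MeasurableSet K) {Q : Set (𝔼 × ℝ)}
    (hQ : MeasurableSet Q) (hQ0 : ∀ q ∈ Q, 0 < q.2) (hQK : ∀ q ∈ Q, q.1 ∈ K)
    (hQB : ∀ q ∈ Q, ∀ y ∈ B, q.1 + q.2 • y ∈ K) :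
    ∫⁻ q in Q, ((ENNReal.ofReal q.2)⁻¹ * coneOscillation B g q) ^ p ≤
      traceConst B R p * traceEnergy K p g := by
  have hp0 : 0 < p := by linarith
  set d : 𝔼 × 𝔼 → ℝ≥0∞ := (K ×ˢ K).indicator fun z => ‖g z.1 - g z.2‖ₑ with hd
  have hdm : Measurable d := Measurable.indicator (by fun_prop) (hK.prod hK)
  have hd0 : ∀ x, d (x, x) = 0 := fun x => indicator_apply_eq_zero.2 fun _ => by simp
  rw [← traceEnergy_eq_lintegral_indicator hK hp0 g]
  refine le_trans ?_ (lintegral_inv_mul_lintegral_rpow_le hB hR hBR hp hnp hdm hd0)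
  calc ∫⁻ q in Q, ((ENNReal.ofReal q.2)⁻¹ * coneOscillation B g q) ^ p
      = ∫⁻ q in Q, ((ENNReal.ofReal q.2)⁻¹ * ∫⁻ y in B, d (q.1, q.1 + q.2 • y)) ^ p := by
        refine setLIntegral_congr_fun hQ fun q hq => ?_
        have : coneOscillation B g q = ∫⁻ y in B, d (q.1, q.1 + q.2 • y) := by
          refine setLIntegral_congr_fun hB fun y hy => ?_
          simp only [hd]
          rw [indicator_of_mem (show (q.1, q.1 + q.2 • y) ∈ K ×ˢ K from ⟨hQK q hq, hQB q hq y hy⟩),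
            ← enorm_neg, neg_sub]
        simp only [this]
    _ ≤ _ := lintegral_mono_set fun q hq => (⟨mem_univ _, hQ0 q hq⟩ : q ∈ univ ×ˢ Ioi (0 : ℝ))

/-! ### Inequalities of Hölder and Poincaré -/

theorem lintegral_prod_le_prod_rpow {α : Type*} [MeasurableSpace α] (ν : Measure α)
    (hn : n ≠ 0) {F : Fin n → α → ℝ≥0∞} (hF : ∀ i, Measurable (F i)) :
    ∫⁻ a, ∏ i, F i a ∂ν ≤ ∏ i, (∫⁻ a, F i a ^ (n : ℝ) ∂ν) ^ (1 / (n : ℝ)) := by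
  have hn' : (n : ℝ) ≠ 0 := Nat.cast_ne_zero.2 hn
  have h := ENNReal.lintegral_prod_norm_pow_le (μ := ν) Finset.univ
    (f := fun i a => F i a ^ (n : ℝ)) (fun i _ => ((hF i).pow_const _).aemeasurable)
    (p := fun _ => 1 / (n : ℝ)) (by simp [hn']) (fun _ _ => by positivity)
  simpa only [← ENNReal.rpow_mul, mul_one_div_cancel hn', ENNReal.rpow_one] using h

theorem lintegral_mul_prod_le_mul_prod_rpow {α : Type*} [MeasurableSpace α] (ν : Measure α)
    {F : Fin n → α → ℝ≥0∞} (hF : ∀ i, Measurable (F i)) {G : α → ℝ≥0∞} (hG : Measurable G) :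
    ∫⁻ a, G a * ∏ i, F i a ∂ν ≤ (∫⁻ a, G a ^ ((n : ℝ) + 1) ∂ν) ^ (1 / ((n : ℝ) + 1)) *
      ∏ i, (∫⁻ a, F i a ^ ((n : ℝ) + 1) ∂ν) ^ (1 / ((n : ℝ) + 1)) := by
  have hn' : (n : ℝ) + 1 ≠ 0 := by positivity
  have h := ENNReal.lintegral_mul_prod_norm_pow_le (μ := ν) Finset.univ
    (g := fun a => G a ^ ((n : ℝ) + 1)) (hG.pow_const _).aemeasurable
    (f := fun i a => F i a ^ ((n : ℝ) + 1)) (fun i _ => ((hF i).pow_const _).aemeasurable)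
    (1 / ((n : ℝ) + 1)) (p := fun _ => 1 / ((n : ℝ) + 1)) (by simp; field_simp; ring)
    (by positivity)
    (fun _ _ => by positivity)
  simpa only [← ENNReal.rpow_mul, mul_one_div_cancel hn', ENNReal.rpow_one] using h

theorem enorm_gradient (ψ : 𝔼 → ℝ) (x : 𝔼) : ‖gradient ψ x‖ₑ = ‖fderiv ℝ ψ x‖ₑ := by
  rw [gradient, LinearIsometryEquiv.enorm_map]

theorem eLpNorm_gradient (ψ : 𝔼 → ℝ) (p : ℝ≥0∞) (μ : Measure 𝔼) :
    eLpNorm (gradient ψ) p μ = eLpNorm (fderiv ℝ ψ) p μ :=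
  eLpNorm_congr_enorm_ae (Eventually.of_forall fun x => enorm_gradient ψ x)

/-- For a continuous derivative the essential supremum over an open set is a supremum. -/
theorem enorm_fderiv_le_eLpNorm_top {Ω : Set 𝔼} (hΩ : IsOpen Ω) {ψ : 𝔼 → ℝ}
    (hψ : ContDiff ℝ 1 ψ) (hs : tsupport ψ ⊆ Ω) (x : 𝔼) :
    ‖fderiv ℝ ψ x‖ₑ ≤ eLpNorm (gradient ψ) ∞ (volume.restrict Ω) := by
  rw [eLpNorm_gradient, eLpNorm_exponent_top]
  set M := eLpNormEssSup (fderiv ℝ ψ) (volume.restrict Ω) with hM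
  by_contra! hlt
  have hxΩ : x ∈ Ω := by
    by_contra hx
    rw [← ofReal_norm, fderiv_eq_zero_of_notMem_tsupport fun h => hx (hs h), norm_zero,
      ENNReal.ofReal_zero] at hlt
    exact not_lt_zero hlt
  set U : Set 𝔼 := {x | M < ‖fderiv ℝ ψ x‖ₑ} ∩ Ω with hU
  have hUo : IsOpen U := by
    refine IsOpen.inter ?_ hΩ
    exact isOpen_lt continuous_const (hψ.continuous_fderiv one_ne_zero).enorm
  have h0 : volume U = 0 := by
    have h1 : volume.restrict Ω {x | M < ‖fderiv ℝ ψ x‖ₑ} = 0 := meas_eLpNormEssSup_lt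
    rwa [Measure.restrict_apply' hΩ.measurableSet] at h1
  rw [hUo.measure_eq_zero_iff volume] at h0
  exact (h0 ▸ (⟨hlt, hxΩ⟩ : x ∈ U) : x ∈ (∅ : Set 𝔼))

/-- Poincaré's inequality in `L^∞`, from the mean value inequality. -/
theorem exists_enorm_le_eLpNorm_top_gradient (hn : n ≠ 0) {Ω : Set 𝔼} (hΩ : IsOpen Ω)
    (hb : Bornology.IsBounded Ω) :
    ∃ C : ℝ≥0, ∀ ψ : 𝔼 → ℝ, ContDiff ℝ 1 ψ → tsupport ψ ⊆ Ω → ∀ x,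
      ‖ψ x‖ₑ ≤ C * eLpNorm (gradient ψ) ∞ (volume.restrict Ω) := by
  obtain ⟨R, hR⟩ := hb.exists_norm_le
  have : Nonempty (Fin n) := ⟨⟨0, Nat.pos_of_ne_zero hn⟩⟩
  have : Nontrivial 𝔼 := inferInstance
  -- Test functions vanish at `z`, which lies outside `Ω`.
  obtain ⟨z, hz⟩ := NormedSpace.exists_lt_norm ℝ 𝔼 R
  refine ⟨(|R| + ‖z‖ + 1).toNNReal, fun ψ hψ hs x => ?_⟩
  by_cases hx : x ∈ tsupport ψ
  swap
  · simp [image_eq_zero_of_notMem_tsupport hx]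
  have hz0 : ψ z = 0 := image_eq_zero_of_notMem_tsupport fun h => (hR z (hs h)).not_gt hz
  set M := eLpNorm (gradient ψ) ∞ (volume.restrict Ω) with hM
  have hbd : ∀ x, ‖fderiv ℝ ψ x‖ₑ ≤ M := enorm_fderiv_le_eLpNorm_top hΩ hψ hs
  by_cases hMt : M = ∞
  · rw [hMt, ENNReal.mul_top]
    · exact le_top
    · have : 0 < |R| + ‖z‖ + 1 := by positivity
      rw [ENNReal.coe_ne_zero]
      exact (Real.toNNReal_pos.2 this).ne'
  have hmv := (convex_univ (𝕜 := ℝ) (E := 𝔼)).norm_image_sub_le_of_norm_fderiv_le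
    (f := ψ) (C := M.toReal) (x := z) (y := x) (fun y _ => hψ.differentiable one_ne_zero y)
    (fun y _ => ?_) (mem_univ _) (mem_univ _)
  · rw [hz0, sub_zero] at hmv
    have h2 : ‖x - z‖ ≤ |R| + ‖z‖ + 1 := by
      linarith [norm_sub_le x z, hR x (hs hx), le_abs_self R]
    have h3 : ‖ψ x‖ ≤ (|R| + ‖z‖ + 1) * M.toReal := by
      refine hmv.trans ?_
      rw [mul_comm]
      gcongr
    rw [← ofReal_norm]
    refine (ENNReal.ofReal_le_ofReal h3).trans ?_
    rw [ENNReal.ofReal_mul (by positivity), ENNReal.ofReal_toReal hMt]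
    rfl
  · rw [← toReal_enorm]
    exact ENNReal.toReal_mono hMt (hbd y)

/-- Poincaré's inequality in `L^1`, as a case of the Gagliardo–Nirenberg–Sobolev inequality. -/
theorem exists_lintegral_le_eLpNorm_one_gradient (hn : 2 ≤ n) {Ω : Set 𝔼}
    (hb : Bornology.IsBounded Ω) :
    ∃ C : ℝ≥0, ∀ ψ : 𝔼 → ℝ, ContDiff ℝ 1 ψ → tsupport ψ ⊆ Ω →
      ∫⁻ x, ‖ψ x‖ₑ ≤ C * eLpNorm (gradient ψ) 1 (volume.restrict Ω) := by
  refine ⟨eLpNormLESNormFDerivOfLeConst ℝ (volume : Measure 𝔼) Ω 1 1, fun ψ hψ hs => ?_⟩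
  have h := eLpNorm_le_eLpNorm_fderiv (F := ℝ) (volume : Measure 𝔼) hψ
    ((subset_tsupport ψ).trans hs) (p := 1) le_rfl
    (by rw [finrank_euclideanSpace_fin]; exact_mod_cast (by omega : 1 < n)) hb
  rw [eLpNorm_gradient, eLpNorm_restrict_eq_of_support_subset (f := fderiv ℝ ψ)
    ((support_fderiv_subset ℝ).trans hs), ← eLpNorm_one_eq_lintegral_enorm]
  exact_mod_cast h

theorem exists_lintegral_coneAverage_rpow_le {η : 𝔼 → ℝ} (hη : Continuous η)
    (hηc : HasCompactSupport η) {p : ℝ} (hp : 1 ≤ p) (t₀ : ℝ) :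
    ∃ C : ℝ≥0, ∀ ψ : 𝔼 → ℝ, Continuous ψ →
      ∫⁻ q in univ ×ˢ Ioc 0 t₀, ‖coneAverage volume η ψ q‖ₑ ^ p ≤ C * ∫⁻ x, ‖ψ x‖ₑ ^ p := by
  have hp0 : 0 < p := by linarith
  obtain ⟨M, hM⟩ := hηc.exists_bound_of_continuous hη
  set B := tsupport η with hB
  have hBf : volume B ≠ ∞ := hηc.isCompact.measure_lt_top.ne
  set A : ℝ≥0∞ := ENNReal.ofReal M ^ p * volume B ^ (p - 1) with hA
  have hAt : A ≠ ∞ := ENNReal.mul_ne_top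
    (ENNReal.rpow_ne_top_of_nonneg hp0.le ENNReal.ofReal_ne_top)
    (ENNReal.rpow_ne_top_of_nonneg (by linarith) hBf)
  have hCt : A * (volume B * ENNReal.ofReal t₀) ≠ ∞ :=
    ENNReal.mul_ne_top hAt (ENNReal.mul_ne_top hBf ENNReal.ofReal_ne_top)
  refine ⟨(A * (volume B * ENNReal.ofReal t₀)).toNNReal, fun ψ hψ => ?_⟩
  rw [ENNReal.coe_toNNReal hCt]
  have hpt : ∀ q, ‖coneAverage volume η ψ q‖ₑ ^ p ≤
      A * ∫⁻ y in B, ‖ψ (q.1 + q.2 • y)‖ₑ ^ p := by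
    intro q
    have h1 : ‖coneAverage volume η ψ q‖ₑ ≤
        ENNReal.ofReal M * ∫⁻ y in B, ‖ψ (q.1 + q.2 • y)‖ₑ := by
      rw [coneAverage_eq_setIntegral]
      refine (enorm_integral_le_lintegral_enorm _).trans ?_
      rw [← lintegral_const_mul' _ _ ENNReal.ofReal_ne_top]
      refine lintegral_mono fun y => ?_
      simp only [enorm_mul]
      gcongr
      rw [← ofReal_norm]
      exact ENNReal.ofReal_le_ofReal (hM y)
    have h2 := rpow_lintegral_le (volume.restrict B) (f := fun y => ‖ψ (q.1 + q.2 • y)‖ₑ)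
      (Continuous.measurable (by fun_prop)).aemeasurable hp
    rw [Measure.restrict_apply_univ] at h2
    calc ‖coneAverage volume η ψ q‖ₑ ^ p
        ≤ (ENNReal.ofReal M * ∫⁻ y in B, ‖ψ (q.1 + q.2 • y)‖ₑ) ^ p := by gcongr
      _ ≤ ENNReal.ofReal M ^ p * (volume B ^ (p - 1) * ∫⁻ y in B, ‖ψ (q.1 + q.2 • y)‖ₑ ^ p) := by
          rw [ENNReal.mul_rpow_of_nonneg _ _ hp0.le]
          gcongr
      _ = _ := by rw [hA, mul_assoc]
  have hm : Measurable fun z : (𝔼 × ℝ) × 𝔼 => ‖ψ (z.1.1 + z.1.2 • z.2)‖ₑ ^ p :=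
    (Continuous.measurable (by fun_prop)).pow_const _
  have hm1 : Measurable fun q : 𝔼 × ℝ => ∫⁻ y in B, ‖ψ (q.1 + q.2 • y)‖ₑ ^ p :=
    Measurable.lintegral_prod_right' (f := fun z : (𝔼 × ℝ) × 𝔼 =>
      ‖ψ (z.1.1 + z.1.2 • z.2)‖ₑ ^ p) hm
  calc ∫⁻ q in univ ×ˢ Ioc 0 t₀, ‖coneAverage volume η ψ q‖ₑ ^ p
      ≤ ∫⁻ q in univ ×ˢ Ioc 0 t₀, A * ∫⁻ y in B, ‖ψ (q.1 + q.2 • y)‖ₑ ^ p :=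
        lintegral_mono hpt
    _ = A * ∫⁻ q in univ ×ˢ Ioc 0 t₀, ∫⁻ y in B, ‖ψ (q.1 + q.2 • y)‖ₑ ^ p :=
        lintegral_const_mul' _ _ hAt
    _ = A * ∫⁻ t in Ioc 0 t₀, ∫⁻ x, ∫⁻ y in B, ‖ψ (x + t • y)‖ₑ ^ p := by
        rw [Measure.volume_eq_prod, ← Measure.prod_restrict, lintegral_prod_symm _
          hm1.aemeasurable, Measure.restrict_univ]
    _ = A * ∫⁻ t in Ioc 0 t₀, volume B * ∫⁻ x, ‖ψ x‖ₑ ^ p := by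
        congr 1
        refine lintegral_congr fun t => ?_
        rw [lintegral_lintegral_swap (Measurable.aemeasurable (by
          exact hm.comp (g := fun z : (𝔼 × ℝ) × 𝔼 => ‖ψ (z.1.1 + z.1.2 • z.2)‖ₑ ^ p)
            (f := fun z : 𝔼 × 𝔼 => ((z.1, t), z.2)) (by fun_prop)))]
        simp_rw [lintegral_add_right_eq_self (fun x => ‖ψ x‖ₑ ^ p)]
        rw [lintegral_const, Measure.restrict_apply_univ, mul_comm]
    _ = _ := by
        rw [lintegral_const, Measure.restrict_apply_univ, Real.volume_Ioc, sub_zero]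
        ring

/-! ### Heights above a graph -/

section Height

/-- The orthogonal projection onto the hyperplane orthogonal to `ν`. -/
noncomputable abbrev hyperplaneProj (ν : EuclideanSpace ℝ (Fin n)) :
    EuclideanSpace ℝ (Fin n) →L[ℝ] (Submodule.span ℝ {ν})ᗮ :=
  (Submodule.span ℝ {ν})ᗮ.orthogonalProjectionOnto

/-- The height of `x` above the graph of `γ`, measured in the direction `ν`. -/
noncomputable def graphHeight (ν : EuclideanSpace ℝ (Fin n)) (γ : (Submodule.span ℝ {ν})ᗮ → ℝ)
    (x : EuclideanSpace ℝ (Fin n)) : ℝ :=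
  inner ℝ x ν - γ (hyperplaneProj ν x)

variable {ν : EuclideanSpace ℝ (Fin n)} {γ : (Submodule.span ℝ {ν})ᗮ → ℝ}

theorem hyperplaneProj_self : hyperplaneProj ν ν = 0 :=
  Submodule.orthogonalProjectionOnto_orthogonalComplement_singleton_eq_zero ν

theorem hyperplaneProj_add_smul (x : 𝔼) (a : ℝ) :
    hyperplaneProj ν (x + a • ν) = hyperplaneProj ν x := by
  rw [map_add, map_smul, hyperplaneProj_self, smul_zero, add_zero]

theorem coe_hyperplaneProj_add_inner_smul (hν : ‖ν‖ = 1) (x : 𝔼) :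
    (hyperplaneProj ν x : 𝔼) + inner ℝ x ν • ν = x := by
  have h1 := Submodule.starProjection_add_starProjection_orthogonal (K := Submodule.span ℝ {ν}) x
  rw [Submodule.starProjection_unit_singleton ℝ hν] at h1
  rw [real_inner_comm ν x, add_comm]
  exact h1

theorem inner_coe_orthogonal (w : (Submodule.span ℝ {ν})ᗮ) : inner ℝ (w : 𝔼) ν = 0 :=
  (Submodule.mem_orthogonal' _ _).1 w.2 ν (Submodule.mem_span_singleton_self ν)

theorem inner_self_of_norm_eq_one (hν : ‖ν‖ = 1) : inner ℝ ν ν = 1 := by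
  rw [real_inner_self_eq_norm_sq, hν, one_pow]

theorem graphHeight_add_smul (hν : ‖ν‖ = 1) (x : 𝔼) (a : ℝ) :
    graphHeight ν γ (x + a • ν) = graphHeight ν γ x + a := by
  rw [graphHeight, graphHeight, hyperplaneProj_add_smul, inner_add_left, inner_smul_left,
    inner_self_of_norm_eq_one hν]
  simp
  ring

theorem continuous_graphHeight {L : ℝ≥0} (hγ : LipschitzWith L γ) :
    Continuous (graphHeight ν γ) :=
  (continuous_id.inner continuous_const).sub (hγ.continuous.comp (hyperplaneProj ν).continuous)

theorem le_graphHeight_add {L : ℝ≥0} (hγ : LipschitzWith L γ) (x v : 𝔼) :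
    graphHeight ν γ x + (inner ℝ v ν - L * ‖hyperplaneProj ν v‖) ≤ graphHeight ν γ (x + v) := by
  have h := hγ.dist_le_mul (hyperplaneProj ν (x + v)) (hyperplaneProj ν x)
  rw [dist_eq_norm, dist_eq_norm, map_add, add_sub_cancel_left] at h
  have h2 := le_of_abs_le h
  simp only [graphHeight, inner_add_left, map_add]
  linarith

theorem graphHeight_add_le (hν : ‖ν‖ = 1) {L : ℝ≥0} (hγ : LipschitzWith L γ) (x v : 𝔼) :
    graphHeight ν γ x ≤ graphHeight ν γ (x + v) + (1 + L) * ‖v‖ := by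
  have h := le_graphHeight_add hγ x v
  have h1 : |inner ℝ v ν| ≤ ‖v‖ := by simpa [hν] using abs_real_inner_le_norm v ν
  have h2 : ‖hyperplaneProj ν v‖ ≤ ‖v‖ := Submodule.norm_orthogonalProjectionOnto_apply_le _ v
  have h3 : (L : ℝ) * ‖hyperplaneProj ν v‖ ≤ L * ‖v‖ := by gcongr
  linarith [neg_le_of_abs_le h1]

theorem norm_le_norm_hyperplaneProj_add (hν : ‖ν‖ = 1) (v : 𝔼) :
    ‖v‖ ≤ ‖hyperplaneProj ν v‖ + |inner ℝ v ν| := by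
  conv_lhs => rw [← coe_hyperplaneProj_add_inner_smul hν v]
  refine (norm_add_le _ _).trans ?_
  rw [norm_smul, hν, mul_one]
  rfl

/-- The map that halves the height above the graph of `γ`. -/
noncomputable def halveHeight (ν : EuclideanSpace ℝ (Fin n)) (γ : (Submodule.span ℝ {ν})ᗮ → ℝ)
    (x : EuclideanSpace ℝ (Fin n)) : EuclideanSpace ℝ (Fin n) :=
  x + (-(graphHeight ν γ x / 2)) • ν

theorem graphHeight_halveHeight (hν : ‖ν‖ = 1) (x : 𝔼) :
    graphHeight ν γ (halveHeight ν γ x) = graphHeight ν γ x / 2 := by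
  rw [halveHeight, graphHeight_add_smul hν]
  ring

theorem lintegral_comp_midpoint (H : ℝ → ℝ≥0∞) (hH : Measurable H) (c : ℝ) :
    ∫⁻ s, H ((s + c) / 2) = 2 * ∫⁻ s, H s := by
  have h1 : ∫⁻ s, H ((s + c) / 2) = ∫⁻ s, H (s / 2) :=
    lintegral_add_right_eq_self (fun s => H (s / 2)) c
  have h2 : ∫⁻ s, H (s / 2) = ∫⁻ s, H s ∂(Measure.map (fun s : ℝ => 2⁻¹ * s) volume) := by
    rw [lintegral_map hH (measurable_const_mul _)]
    refine lintegral_congr fun s => ?_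
    rw [div_eq_inv_mul]
  rw [h1, h2, Real.map_volume_mul_left (by norm_num), lintegral_smul_measure]
  norm_num

/-- Coordinates along a hyperplane and its unit normal. -/
noncomputable def normalCoordinates (hν : ‖ν‖ = 1) :
    ((Submodule.span ℝ {ν})ᗮ × ℝ) ≃L[ℝ] 𝔼 :=
  LinearEquiv.toContinuousLinearEquiv
    { toFun := fun z => (z.1 : 𝔼) + z.2 • ν
      invFun := fun x => (hyperplaneProj ν x, inner ℝ x ν)
      map_add' := fun z w => by
        simp only [Prod.fst_add, Prod.snd_add, Submodule.coe_add, add_smul]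
        abel
      map_smul' := fun a z => by simp [smul_smul]
      left_inv := fun z => by
        refine Prod.ext ?_ ?_
        · simp only
          rw [hyperplaneProj_add_smul]
          exact Submodule.orthogonalProjectionOnto_mem_subspace_eq_self z.1
        · simp only
          rw [inner_add_left, inner_smul_left, inner_coe_orthogonal, inner_self_of_norm_eq_one hν]
          simp
      right_inv := fun x => coe_hyperplaneProj_add_inner_smul hν x }

/-- Halving the height above a graph halves Lebesgue measure; no regularity of the graph is needed,
as each line in the direction `ν` is mapped to itself. -/
theorem lintegral_comp_halveHeight (hν : ‖ν‖ = 1) (hγ : Measurable γ) {G : 𝔼 → ℝ≥0∞}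
    (hG : Measurable G) : ∫⁻ x, G (halveHeight ν γ x) = 2 * ∫⁻ x, G x := by
  set e := normalCoordinates hν with he
  set m : Measure 𝔼 := Measure.map e (volume.prod volume) with hm
  have hmH : m.IsAddHaarMeasure := e.isAddHaarMeasure_map _
  have hvol := Measure.isAddLeftInvariant_eq_smul (volume : Measure 𝔼) m
  set c := Measure.addHaarScalarFactor (volume : Measure 𝔼) m with hc
  have hheight : Measurable (graphHeight ν γ) :=
    Measurable.sub (continuous_id.inner continuous_const).measurable
      (hγ.comp (hyperplaneProj ν).continuous.measurable)
  have hT : Measurable (halveHeight ν γ) := by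
    unfold halveHeight
    fun_prop
  have hint : ∀ F : 𝔼 → ℝ≥0∞, Measurable F → ∫⁻ x, F x =
      c * ∫⁻ w : (Submodule.span ℝ {ν})ᗮ, ∫⁻ s : ℝ, F ((w : 𝔼) + s • ν) := by
    intro F hF
    have hFe : Measurable fun z => F (e z) := hF.comp e.continuous.measurable
    rw [hvol, lintegral_smul_measure, hm, lintegral_map hF e.continuous.measurable,
      lintegral_prod _ hFe.aemeasurable]
    rfl
  rw [hint (fun x => G (halveHeight ν γ x)) (hG.comp hT), hint _ hG, ← mul_assoc, mul_comm 2,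
    mul_assoc, ← lintegral_const_mul' 2 _ (by norm_num)]
  congr 1
  refine lintegral_congr fun w => ?_
  have hpt : ∀ s : ℝ, halveHeight ν γ ((w : 𝔼) + s • ν) = (w : 𝔼) + ((s + γ w) / 2) • ν := by
    intro s
    have h1 : graphHeight ν γ ((w : 𝔼) + s • ν) = s - γ w := by
      rw [graphHeight_add_smul hν, graphHeight, inner_coe_orthogonal,
        Submodule.orthogonalProjectionOnto_mem_subspace_eq_self]
      ring
    rw [halveHeight, h1, add_assoc, ← add_smul]
    congr 2
    ring
  simp_rw [hpt]
  exact lintegral_comp_midpoint (fun s => G ((w : 𝔼) + s • ν)) (by fun_prop) (γ w)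

end Height

/-! ### A fractional Hardy inequality -/

theorem measurable_inv_ofReal_rpow {τ : 𝔼 → ℝ} (hτ : Measurable τ) (r : ℝ) :
    Measurable fun x => (ENNReal.ofReal (τ x))⁻¹ ^ r :=
  hτ.ennreal_ofReal.inv.pow_const r

/-- Averages of `ψ x - ψ w` over points `w = x + τ(x) y` at distance at most `R τ(x)` from `x` are
controlled by the Gagliardo seminorm. -/
theorem lintegral_inv_rpow_mul_oscillation_le {S Ω B : Set 𝔼} (hS : MeasurableSet S)
    (hΩ : MeasurableSet Ω) (hB : MeasurableSet B) {τ : 𝔼 → ℝ} (hτS : ∀ x ∈ S, 0 < τ x)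
    (hSΩ : S ⊆ Ω) {R : ℝ} (hBR : ∀ y ∈ B, ‖y‖ ≤ R)
    (hBΩ : ∀ x ∈ S, ∀ y ∈ B, x + τ x • y ∈ Ω) {ψ : 𝔼 → ℝ} (hψ : Measurable ψ) :
    ∫⁻ x in S, (ENNReal.ofReal (τ x))⁻¹ ^ (n : ℝ) *
        ∫⁻ y in B, ‖ψ x - ψ (x + τ x • y)‖ₑ ^ ((n : ℝ) + 1) ≤
      ENNReal.ofReal R ^ (2 * (n : ℝ)) * traceEnergy Ω ((n : ℝ) + 1) ψ := by
  have hn : (0 : ℝ) ≤ n := Nat.cast_nonneg n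
  set d : 𝔼 × 𝔼 → ℝ≥0∞ := (Ω ×ˢ Ω).indicator fun z => ‖ψ z.1 - ψ z.2‖ₑ with hd
  have hdm : Measurable d := Measurable.indicator (by fun_prop) (hΩ.prod hΩ)
  have hpt : ∀ x ∈ S, (ENNReal.ofReal (τ x))⁻¹ ^ (n : ℝ) *
        ∫⁻ y in B, ‖ψ x - ψ (x + τ x • y)‖ₑ ^ ((n : ℝ) + 1) ≤
      ∫⁻ w, ENNReal.ofReal R ^ (2 * (n : ℝ)) *
        (d (x, w) ^ ((n : ℝ) + 1) / ‖x - w‖ₑ ^ ((n : ℝ) + ((n : ℝ) + 1) - 1)) := by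
    intro x hx
    have ht := hτS x hx
    set H : 𝔼 → ℝ≥0∞ := {w : 𝔼 | ‖x - w‖ ≤ R * τ x}.indicator fun w => d (x, w) ^ ((n : ℝ) + 1)
      with hH
    have hHm : Measurable H :=
      Measurable.indicator (by fun_prop) (measurableSet_le (by fun_prop) (by fun_prop))
    have h1 : ∫⁻ y in B, ‖ψ x - ψ (x + τ x • y)‖ₑ ^ ((n : ℝ) + 1) ≤ ∫⁻ y, H (x + τ x • y) := by
      rw [← lintegral_indicator hB]
      refine lintegral_mono fun y => ?_
      by_cases hy : y ∈ B
      · rw [indicator_of_mem hy, hH, indicator_of_mem, hd,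
          indicator_of_mem (show (x, x + τ x • y) ∈ Ω ×ˢ Ω from ⟨hSΩ hx, hBΩ x hx y hy⟩)]
        simp only [mem_ofPred_eq, sub_add_cancel_left, norm_neg, norm_smul,
          Real.norm_of_nonneg ht.le]
        rw [mul_comm]
        exact mul_le_mul_of_nonneg_right (hBR y hy) ht.le
      · rw [indicator_of_notMem hy]
        exact zero_le
    rw [lintegral_comp_add_smul H hHm x ht] at h1
    refine (mul_le_mul_right h1 _).trans ?_
    rw [← mul_assoc, ← ENNReal.rpow_add_of_nonneg _ _ hn hn, ← two_mul, ← lintegral_const_mul _ hHm]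
    refine lintegral_mono fun w => ?_
    by_cases hw : ‖x - w‖ ≤ R * τ x
    swap
    · have h0 : H w = 0 :=
        indicator_of_notMem (show w ∉ {w : 𝔼 | ‖x - w‖ ≤ R * τ x} from hw) _
      simp only [h0, mul_zero]
      exact zero_le
    have h2 : H w = d (x, w) ^ ((n : ℝ) + 1) :=
      indicator_of_mem (show w ∈ {w : 𝔼 | ‖x - w‖ ≤ R * τ x} from hw) _
    rw [h2, show (n : ℝ) + ((n : ℝ) + 1) - 1 = 2 * n by ring]
    rcases eq_or_ne x w with rfl | hne
    · have h3 : d (x, x) = 0 := indicator_apply_eq_zero.2 fun _ => by simp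
      rw [h3, ENNReal.zero_rpow_of_pos (by positivity), mul_zero]
      exact zero_le
    have hpos : 0 < ‖x - w‖ := norm_pos_iff.2 (sub_ne_zero.2 hne)
    have h4 : (ENNReal.ofReal (τ x))⁻¹ ≤ ENNReal.ofReal R * ‖x - w‖ₑ⁻¹ := by
      rw [← ofReal_norm, ← ENNReal.ofReal_inv_of_pos ht, ← ENNReal.ofReal_inv_of_pos hpos,
        ← ENNReal.ofReal_mul' (by positivity)]
      refine ENNReal.ofReal_le_ofReal ?_
      rw [inv_le_iff_one_le_mul₀ ht, mul_right_comm, ← div_eq_mul_inv, one_le_div hpos]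
      exact hw
    calc (ENNReal.ofReal (τ x))⁻¹ ^ (2 * (n : ℝ)) * d (x, w) ^ ((n : ℝ) + 1)
        ≤ (ENNReal.ofReal R * ‖x - w‖ₑ⁻¹) ^ (2 * (n : ℝ)) * d (x, w) ^ ((n : ℝ) + 1) := by gcongr
      _ = _ := by
          rw [ENNReal.mul_rpow_of_nonneg _ _ (by positivity), ENNReal.inv_rpow, div_eq_mul_inv]
          ring
  refine (setLIntegral_mono' hS hpt).trans ?_
  have hCt : ENNReal.ofReal R ^ (2 * (n : ℝ)) ≠ ∞ :=
    ENNReal.rpow_ne_top_of_nonneg (by positivity) ENNReal.ofReal_ne_top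
  have hm : Measurable fun z : 𝔼 × 𝔼 =>
      d z ^ ((n : ℝ) + 1) / ‖z.1 - z.2‖ₑ ^ ((n : ℝ) + ((n : ℝ) + 1) - 1) := by fun_prop
  rw [← traceEnergy_eq_lintegral_indicator hΩ (by positivity) ψ, Measure.volume_eq_prod,
    lintegral_prod _ hm.aemeasurable, ← lintegral_const_mul' _ _ hCt]
  refine (setLIntegral_le_lintegral _ _).trans (lintegral_mono fun x => ?_)
  rw [lintegral_const_mul' _ _ hCt]

/-- Absorption: a finite quantity that is at most `θ < 1` times itself plus `b` is controlled by
`b`. -/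
theorem le_inv_one_sub_mul_of_le_mul_add {X b : ℝ≥0∞} {θ : ℝ≥0∞} (hθ : θ < 1) (hX : X ≠ ∞)
    (h : X ≤ θ * X + b) : X ≤ (1 - θ)⁻¹ * b := by
  have hne : 1 - θ ≠ 0 := (tsub_pos_of_lt hθ).ne'
  have hne' : 1 - θ ≠ ∞ := ENNReal.sub_ne_top ENNReal.one_ne_top
  rw [mul_comm, ← div_eq_mul_inv, ENNReal.le_div_iff_mul_le (Or.inl hne) (Or.inl hne'), mul_comm,
    ENNReal.sub_mul (fun _ _ => hX), one_mul]
  exact tsub_le_iff_left.2 h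

/-- A fractional Hardy inequality above a Lipschitz graph. Composition with `halveHeight`
multiplies the weighted norm of `ψ` by at most `2 ^ ((1 - n) / (n + 1)) < 1`, and `ψ - ψ ∘
halveHeight` is controlled by the Gagliardo seminorm, by comparing both values with averages over
common points; thus the weighted norm of `ψ`, finite as `ψ` vanishes near the graph, can be
absorbed. -/
theorem exists_hardy (hn : 2 ≤ n) {ν : 𝔼} (hν : ‖ν‖ = 1) {γ : (Submodule.span ℝ {ν})ᗮ → ℝ}
    {L : ℝ≥0} (hγ : LipschitzWith L γ) {S Ω : Set 𝔼} (hS : MeasurableSet S)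
    (hΩ : MeasurableSet Ω) (hSΩ : S ⊆ Ω) (hSb : Bornology.IsBounded S)
    (hpos : ∀ x ∈ S, 0 < graphHeight ν γ x) (hhalf : ∀ x ∈ S, halveHeight ν γ x ∈ S)
    {κ : ℝ} (hκ : 0 < κ) (hκ1 : κ ≤ 1)
    (h1 : ∀ x ∈ S, ∀ y ∈ Metric.closedBall ν κ, x + graphHeight ν γ x • y ∈ Ω)
    (h2 : ∀ x ∈ S, ∀ y ∈ Metric.closedBall ((3 : ℝ) • ν) (2 * κ), x + graphHeight ν γ x • y ∈ Ω) :
    ∃ C : ℝ≥0, ∀ ψ : 𝔼 → ℝ, Continuous ψ → HasCompactSupport ψ →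
      (∃ c > 0, ∀ x ∈ S ∩ tsupport ψ, c ≤ graphHeight ν γ x) →
      ∫⁻ x in S, ‖ψ x‖ₑ ^ ((n : ℝ) + 1) * (ENNReal.ofReal (graphHeight ν γ x))⁻¹ ^ (n : ℝ) ≤
        C * traceEnergy Ω ((n : ℝ) + 1) ψ := by
  set τ := graphHeight ν γ with hτdef
  set T := halveHeight ν γ with hTdef
  have hn1 : (1 : ℝ) ≤ n := by exact_mod_cast (by omega : 1 ≤ n)
  have hn0 : (0 : ℝ) ≤ n := by linarith
  set p : ℝ := (n : ℝ) + 1 with hp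
  have hp1 : 1 ≤ p := by linarith
  have hp0 : 0 < p := by linarith
  have hτc : Continuous τ := continuous_graphHeight hγ
  have hτm : Measurable τ := hτc.measurable
  have hTc : Continuous T := by
    rw [hTdef]
    unfold halveHeight
    exact continuous_id.add (((hτc.div_const 2).neg).smul continuous_const)
  set B := Metric.closedBall ν κ with hB
  set B' := Metric.closedBall ((3 : ℝ) • ν) (2 * κ) with hB'
  have hB0 : volume B ≠ 0 := (Metric.measure_closedBall_pos volume ν hκ).ne'
  have hBt : volume B ≠ ∞ := measure_closedBall_lt_top.ne
  set W : 𝔼 → ℝ≥0∞ := fun x => (ENNReal.ofReal (τ x))⁻¹ ^ (n : ℝ) with hW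
  have hWm : Measurable W := measurable_inv_ofReal_rpow hτm _
  have hWT : ∀ x, W x = 2⁻¹ ^ (n : ℝ) * W (T x) := by
    intro x
    simp only [hW]
    rw [hTdef, hτdef, graphHeight_halveHeight hν, ← ENNReal.mul_rpow_of_nonneg _ _ hn0,
      ENNReal.ofReal_div_of_pos two_pos, ENNReal.inv_div (by simp) (by simp), div_eq_mul_inv,
      ← mul_assoc]
    simp [ENNReal.inv_mul_cancel]
  have hTint : ∀ F : 𝔼 → ℝ≥0∞, Measurable F →
      ∫⁻ x in S, F (T x) ≤ 2 * ∫⁻ x in S, F x := by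
    intro F hF
    rw [← lintegral_indicator hS, ← lintegral_indicator hS,
      ← lintegral_comp_halveHeight hν hγ.continuous.measurable (hF.indicator hS)]
    refine lintegral_mono fun x => ?_
    by_cases hx : x ∈ S
    · rw [indicator_of_mem hx, indicator_of_mem (hhalf x hx)]
    · rw [indicator_of_notMem hx]
      exact zero_le
  set θ : ℝ≥0∞ := (2⁻¹ ^ (n : ℝ) * 2) ^ (1 / p) with hθ
  have hθ1 : θ < 1 := by
    refine ENNReal.rpow_lt_one ?_ (by positivity)
    have h3 : (2 : ℝ≥0∞)⁻¹ ^ (n : ℝ) ≤ 2⁻¹ ^ (2 : ℝ) := by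
      refine ENNReal.rpow_le_rpow_of_exponent_ge (by simp) ?_
      exact_mod_cast hn
    refine (mul_le_mul_left h3 _).trans_lt ?_
    rw [ENNReal.rpow_two, sq, mul_assoc, ENNReal.inv_mul_cancel (by norm_num) (by norm_num),
      mul_one]
    exact ENNReal.one_half_lt_one.trans_le' (by simp)
  set A : ℝ≥0∞ := (volume B)⁻¹ * (2 ^ (p - 1) * (ENNReal.ofReal 2 ^ (2 * (n : ℝ)) +
    2 * ENNReal.ofReal 5 ^ (2 * (n : ℝ)))) with hA
  have hAt : A ≠ ∞ := by
    have h5 : ∀ a : ℝ, ENNReal.ofReal a ^ (2 * (n : ℝ)) ≠ ∞ := fun a =>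
      ENNReal.rpow_ne_top_of_nonneg (by positivity) ENNReal.ofReal_ne_top
    refine ENNReal.mul_ne_top (ENNReal.inv_ne_top.2 hB0) (ENNReal.mul_ne_top
      (ENNReal.rpow_ne_top_of_nonneg (by linarith) ENNReal.ofNat_ne_top) (ENNReal.add_ne_top.2
        ⟨h5 _, ENNReal.mul_ne_top ENNReal.ofNat_ne_top (h5 _)⟩))
  have hCt : (1 - θ)⁻¹ ^ p * A ≠ ∞ := by
    refine ENNReal.mul_ne_top (ENNReal.rpow_ne_top_of_nonneg hp0.le ?_) hAt
    exact ENNReal.inv_ne_top.2 (tsub_pos_of_lt hθ1).ne'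
  refine ⟨((1 - θ)⁻¹ ^ p * A).toNNReal, fun ψ hψ hψc hc => ?_⟩
  rw [ENNReal.coe_toNNReal hCt]
  have hψm : Measurable ψ := hψ.measurable
  set X : ℝ≥0∞ := ∫⁻ x in S, ‖ψ x‖ₑ ^ p * W x with hX
  have hXt : X ≠ ∞ := by
    obtain ⟨c, hc0, hc⟩ := hc
    obtain ⟨M, hM⟩ := hψc.exists_bound_of_continuous hψ
    have hle : ∀ x ∈ S, ‖ψ x‖ₑ ^ p * W x ≤
        ENNReal.ofReal M ^ p * (ENNReal.ofReal c)⁻¹ ^ (n : ℝ) := by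
      intro x hx
      by_cases hxt : x ∈ tsupport ψ
      · have h6 := hc x ⟨hx, hxt⟩
        simp only [hW]
        gcongr
        rw [← ofReal_norm]
        exact ENNReal.ofReal_le_ofReal (hM x)
      · rw [image_eq_zero_of_notMem_tsupport hxt, enorm_zero, ENNReal.zero_rpow_of_pos hp0,
          zero_mul]
        exact zero_le
    refine ne_top_of_le_ne_top ?_ (setLIntegral_mono' hS hle)
    rw [lintegral_const, Measure.restrict_apply_univ]
    refine ENNReal.mul_ne_top (ENNReal.mul_ne_top
      (ENNReal.rpow_ne_top_of_nonneg hp0.le ENNReal.ofReal_ne_top)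
      (ENNReal.rpow_ne_top_of_nonneg hn0 ?_)) hSb.measure_lt_top.ne
    simpa using hc0
  set Y : ℝ≥0∞ := ∫⁻ x in S, ‖ψ x - ψ (T x)‖ₑ ^ p * W x with hY
  -- The factor `2⁻¹ ^ n` comes from the weight and the factor `2` from the change of variables.
  have hXT : ∫⁻ x in S, ‖ψ (T x)‖ₑ ^ p * W x ≤ 2⁻¹ ^ (n : ℝ) * 2 * X := by
    calc ∫⁻ x in S, ‖ψ (T x)‖ₑ ^ p * W x
        = ∫⁻ x in S, 2⁻¹ ^ (n : ℝ) * (‖ψ (T x)‖ₑ ^ p * W (T x)) := by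
          refine lintegral_congr fun x => ?_
          rw [hWT x]
          ring
      _ = 2⁻¹ ^ (n : ℝ) * ∫⁻ x in S, ‖ψ (T x)‖ₑ ^ p * W (T x) := by
          rw [lintegral_const_mul' _ _ (ENNReal.rpow_ne_top_of_nonneg hn0 (by simp))]
      _ ≤ 2⁻¹ ^ (n : ℝ) * (2 * X) := by
          gcongr
          exact hTint (fun x => ‖ψ x‖ₑ ^ p * W x) (by fun_prop)
      _ = _ := by ring
  have hMink : X ^ (1 / p) ≤ θ * X ^ (1 / p) + Y ^ (1 / p) := by
    have hw : ∀ a : ℝ≥0∞, ∀ x, (a * W x ^ (1 / p)) ^ p = a ^ p * W x := by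
      intro a x
      rw [ENNReal.mul_rpow_of_nonneg _ _ hp0.le, ← ENNReal.rpow_mul, one_div_mul_cancel hp0.ne',
        ENNReal.rpow_one]
    have h7 := ENNReal.lintegral_Lp_add_le (μ := volume.restrict S)
      (f := fun x => ‖ψ (T x)‖ₑ * W x ^ (1 / p)) (g := fun x => ‖ψ x - ψ (T x)‖ₑ * W x ^ (1 / p))
      (Measurable.aemeasurable (by fun_prop)) (Measurable.aemeasurable (by fun_prop)) hp1
    simp only [hw] at h7
    calc X ^ (1 / p) ≤ (∫⁻ x in S, (‖ψ (T x)‖ₑ * W x ^ (1 / p) +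
          ‖ψ x - ψ (T x)‖ₑ * W x ^ (1 / p)) ^ p) ^ (1 / p) := by
          refine ENNReal.rpow_le_rpow (lintegral_mono fun x => ?_) (by positivity)
          rw [← hw, ← add_mul]
          gcongr
          calc ‖ψ x‖ₑ = ‖ψ (T x) + (ψ x - ψ (T x))‖ₑ := by rw [add_sub_cancel]
            _ ≤ _ := enorm_add_le _ _
      _ ≤ _ := h7
      _ ≤ (2⁻¹ ^ (n : ℝ) * 2 * X) ^ (1 / p) + Y ^ (1 / p) := by gcongr
      _ = _ := by rw [ENNReal.mul_rpow_of_nonneg _ _ (by positivity)]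
  have habs := le_inv_one_sub_mul_of_le_mul_add hθ1
    (ENNReal.rpow_ne_top_of_nonneg (by positivity) hXt) hMink
  have hXY : X ≤ (1 - θ)⁻¹ ^ p * Y := by
    have h8 := ENNReal.rpow_le_rpow habs hp0.le
    rwa [ENNReal.mul_rpow_of_nonneg _ _ hp0.le, ← ENNReal.rpow_mul, ← ENNReal.rpow_mul,
      one_div_mul_cancel hp0.ne', ENNReal.rpow_one, ENNReal.rpow_one] at h8
  have hYA : Y ≤ A * traceEnergy Ω p ψ := by
    set J1 : 𝔼 → ℝ≥0∞ := fun x => ∫⁻ y in B, ‖ψ x - ψ (x + τ x • y)‖ₑ ^ p with hJ1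
    set J2 : 𝔼 → ℝ≥0∞ := fun x => ∫⁻ y in B', ‖ψ x - ψ (x + τ x • y)‖ₑ ^ p with hJ2
    have hJm : ∀ D : Set 𝔼, Measurable fun x => ∫⁻ y in D, ‖ψ x - ψ (x + τ x • y)‖ₑ ^ p :=
      fun D => Measurable.lintegral_prod_right' (f := fun z : 𝔼 × 𝔼 =>
        ‖ψ z.1 - ψ (z.1 + τ z.1 • z.2)‖ₑ ^ p) (by fun_prop)
    have hI1 : ∫⁻ x in S, W x * J1 x ≤
        ENNReal.ofReal 2 ^ (2 * (n : ℝ)) * traceEnergy Ω p ψ := by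
      refine lintegral_inv_rpow_mul_oscillation_le hS hΩ Metric.isClosed_closedBall.measurableSet
        hpos hSΩ (fun y hy => ?_) h1 hψm
      have := norm_le_of_mem_closedBall hy
      linarith
    have hI2 : ∫⁻ x in S, W x * J2 x ≤
        ENNReal.ofReal 5 ^ (2 * (n : ℝ)) * traceEnergy Ω p ψ := by
      refine lintegral_inv_rpow_mul_oscillation_le hS hΩ Metric.isClosed_closedBall.measurableSet
        hpos hSΩ (fun y hy => ?_) h2 hψm
      have := norm_le_of_mem_closedBall hy
      rw [norm_smul, hν, Real.norm_of_nonneg (by norm_num)] at this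
      linarith
    have hpt : ∀ x, volume B * ‖ψ x - ψ (T x)‖ₑ ^ p ≤ 2 ^ (p - 1) * (J1 x + J2 (T x)) := by
      intro x
      -- Both values are compared with values at the same points, which seen from `x` lie in the
      -- directions of `B` and seen from `T x`, at half the scale, in those of `B'`.
      have hcommon : ∀ y, T x + τ (T x) • (ν + (2 : ℝ) • y) = x + τ x • y := by
        intro y
        rw [hTdef, hτdef, graphHeight_halveHeight hν, halveHeight]
        simp only [smul_add, smul_smul, neg_smul]
        rw [show graphHeight ν γ x / 2 * 2 = graphHeight ν γ x by ring]
        abel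
      have hle : ∀ y, ‖ψ x - ψ (T x)‖ₑ ^ p ≤ 2 ^ (p - 1) * (‖ψ x - ψ (x + τ x • y)‖ₑ ^ p +
          ‖ψ (T x) - ψ (T x + τ (T x) • (ν + (2 : ℝ) • y))‖ₑ ^ p) := by
        intro y
        rw [hcommon]
        refine le_trans ?_ (ENNReal.rpow_add_le_mul_rpow_add_rpow _ _ hp1)
        gcongr
        calc ‖ψ x - ψ (T x)‖ₑ
            = ‖(ψ x - ψ (x + τ x • y)) - (ψ (T x) - ψ (x + τ x • y))‖ₑ := by
              rw [sub_sub_sub_cancel_right]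
          _ ≤ _ := enorm_sub_le
      have hsecond : ∫⁻ y in B, ‖ψ (T x) - ψ (T x + τ (T x) • (ν + (2 : ℝ) • y))‖ₑ ^ p ≤
          J2 (T x) := by
        set F : 𝔼 → ℝ≥0∞ := B'.indicator fun z => ‖ψ (T x) - ψ (T x + τ (T x) • z)‖ₑ ^ p with hF
        have hFm : Measurable F :=
          Measurable.indicator (by fun_prop) Metric.isClosed_closedBall.measurableSet
        calc ∫⁻ y in B, ‖ψ (T x) - ψ (T x + τ (T x) • (ν + (2 : ℝ) • y))‖ₑ ^ p
            ≤ ∫⁻ y, F (ν + (2 : ℝ) • y) := by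
              rw [← lintegral_indicator Metric.isClosed_closedBall.measurableSet]
              refine lintegral_mono fun y => ?_
              by_cases hy : y ∈ B
              · have hy' : ν + (2 : ℝ) • y ∈ B' := by
                  rw [hB', mem_closedBall_iff_norm,
                    show ν + (2 : ℝ) • y - (3 : ℝ) • ν = (2 : ℝ) • (y - ν) by module, norm_smul,
                    Real.norm_of_nonneg (by norm_num)]
                  have := mem_closedBall_iff_norm.1 hy
                  linarith
                rw [indicator_of_mem hy, hF, indicator_of_mem hy']
              · rw [indicator_of_notMem hy]
                exact zero_le
          _ = (ENNReal.ofReal 2)⁻¹ ^ (n : ℝ) * ∫⁻ z, F z :=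
              lintegral_comp_add_smul F hFm ν two_pos
          _ ≤ 1 * ∫⁻ z, F z := by
              gcongr
              exact ENNReal.rpow_le_one (by simp) hn0
          _ = J2 (T x) := by
              rw [one_mul, hF, lintegral_indicator Metric.isClosed_closedBall.measurableSet]
      calc volume B * ‖ψ x - ψ (T x)‖ₑ ^ p = ∫⁻ y in B, ‖ψ x - ψ (T x)‖ₑ ^ p := by
            rw [lintegral_const, Measure.restrict_apply_univ, mul_comm]
        _ ≤ ∫⁻ y in B, 2 ^ (p - 1) * (‖ψ x - ψ (x + τ x • y)‖ₑ ^ p +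
            ‖ψ (T x) - ψ (T x + τ (T x) • (ν + (2 : ℝ) • y))‖ₑ ^ p) := lintegral_mono hle
        _ = 2 ^ (p - 1) * (J1 x + ∫⁻ y in B,
            ‖ψ (T x) - ψ (T x + τ (T x) • (ν + (2 : ℝ) • y))‖ₑ ^ p) := by
            rw [lintegral_const_mul' _ _
              (ENNReal.rpow_ne_top_of_nonneg (by linarith) ENNReal.ofNat_ne_top),
              lintegral_add_left (by fun_prop)]
        _ ≤ _ := by gcongr
    have hsum : volume B * Y ≤ 2 ^ (p - 1) * (ENNReal.ofReal 2 ^ (2 * (n : ℝ)) +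
        2 * ENNReal.ofReal 5 ^ (2 * (n : ℝ))) * traceEnergy Ω p ψ := by
      calc volume B * Y = ∫⁻ x in S, volume B * ‖ψ x - ψ (T x)‖ₑ ^ p * W x := by
            rw [hY, ← lintegral_const_mul' _ _ hBt]
            simp_rw [mul_assoc]
        _ ≤ ∫⁻ x in S, 2 ^ (p - 1) * (W x * J1 x + W (T x) * J2 (T x)) := by
            refine lintegral_mono fun x => ?_
            have hWle : W x ≤ W (T x) := by
              rw [hWT x]
              calc 2⁻¹ ^ (n : ℝ) * W (T x) ≤ 1 * W (T x) := by
                    gcongr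
                    exact ENNReal.rpow_le_one (by simp) hn0
                _ = _ := one_mul _
            calc volume B * ‖ψ x - ψ (T x)‖ₑ ^ p * W x
                ≤ 2 ^ (p - 1) * (J1 x + J2 (T x)) * W x :=
                  mul_le_mul' (hpt x) le_rfl
              _ = 2 ^ (p - 1) * (W x * J1 x + W x * J2 (T x)) := by ring
              _ ≤ _ := by gcongr
        _ = 2 ^ (p - 1) * ((∫⁻ x in S, W x * J1 x) + ∫⁻ x in S, W (T x) * J2 (T x)) := by
            rw [lintegral_const_mul' _ _
              (ENNReal.rpow_ne_top_of_nonneg (by linarith) ENNReal.ofNat_ne_top),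
              lintegral_add_left (f := fun x => W x * J1 x) (hWm.mul (hJm B))]
        _ ≤ 2 ^ (p - 1) * (ENNReal.ofReal 2 ^ (2 * (n : ℝ)) * traceEnergy Ω p ψ +
            2 * (ENNReal.ofReal 5 ^ (2 * (n : ℝ)) * traceEnergy Ω p ψ)) := by
            gcongr
            exact (hTint (fun x => W x * J2 x) (hWm.mul (hJm B'))).trans (by gcongr)
        _ = _ := by ring
    rw [hA, mul_assoc, ← ENNReal.div_eq_inv_mul, ENNReal.le_div_iff_mul_le (Or.inl hB0)
      (Or.inl hBt), mul_comm]
    exact hsum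
  calc X ≤ (1 - θ)⁻¹ ^ p * Y := hXY
    _ ≤ (1 - θ)⁻¹ ^ p * (A * traceEnergy Ω p ψ) := by gcongr
    _ = _ := (mul_assoc _ _ _).symm

/-! ### Charts of a Lipschitz domain -/

/-- A window `N` in which `Ω` contains the truncated cones with directions in `closedBall ν κ`
based at its points in `Ω`, and in which the points outside `Ω` stay outside when moved in the opposite
directions. The last field is a fractional Hardy inequality, for a function `τ` that bounds from
below the time at which the opposite cones can leave `Ω`. In the interior `ν = 0` is allowed. -/
structure ConeChart (Ω N : Set (EuclideanSpace ℝ (Fin n))) (ν : EuclideanSpace ℝ (Fin n))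
    (κ t₀ : ℝ) : Prop where
  isOpen : IsOpen N
  isBounded : Bornology.IsBounded N
  κ_pos : 0 < κ
  t₀_pos : 0 < t₀
  add_mem : ∀ x ∈ N ∩ Ω, ∀ t ∈ Icc 0 t₀, ∀ y ∈ Metric.closedBall ν κ, x + t • y ∈ Ω
  mem_of_add_mem : ∀ x ∈ N, ∀ t ∈ Icc 0 t₀, ∀ y ∈ Metric.closedBall (-ν) κ, x + t • y ∈ Ω → x ∈ Ω
  hardy : ∃ (τ : EuclideanSpace ℝ (Fin n) → ℝ) (C : ℝ≥0), Measurable τ ∧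
    (∀ x ∈ N ∩ Ω, 0 < τ x) ∧
    (∀ x ∈ N ∩ Ω, ∀ t ∈ Ioc 0 t₀, ∀ y ∈ Metric.closedBall (-ν) κ, x + t • y ∉ Ω → τ x < t) ∧
    ∀ ψ : EuclideanSpace ℝ (Fin n) → ℝ, Continuous ψ → HasCompactSupport ψ → tsupport ψ ⊆ Ω →
      ∫⁻ x in N ∩ Ω, ‖ψ x‖ₑ ^ ((n : ℝ) + 1) * (ENNReal.ofReal (τ x))⁻¹ ^ (n : ℝ) ≤
        C * ((∫⁻ x in Ω, ‖ψ x‖ₑ ^ ((n : ℝ) + 1)) + traceEnergy Ω ((n : ℝ) + 1) ψ)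

theorem exists_coneChart_of_mem {Ω : Set 𝔼} (hΩ : IsOpen Ω) {x₀ : 𝔼} (hx₀ : x₀ ∈ Ω) :
    ∃ (N : Set 𝔼) (ν : 𝔼) (κ t₀ : ℝ), x₀ ∈ N ∧ ConeChart Ω N ν κ t₀ := by
  obtain ⟨r, hr, hball⟩ := Metric.isOpen_iff.1 hΩ x₀ hx₀
  have hmem : ∀ x ∈ Metric.ball x₀ (r / 2), ∀ t ∈ Icc 0 (r / 2), ∀ y ∈ Metric.closedBall (0 : 𝔼) 1,
      x + t • y ∈ Ω := by
    intro x hx t ht y hy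
    apply hball
    rw [mem_ball_iff_norm] at hx ⊢
    rw [mem_closedBall_zero_iff] at hy
    calc ‖x + t • y - x₀‖ = ‖(x - x₀) + t • y‖ := by congr 1; abel
      _ ≤ ‖x - x₀‖ + ‖t • y‖ := norm_add_le _ _
      _ = ‖x - x₀‖ + t * ‖y‖ := by rw [norm_smul, Real.norm_of_nonneg ht.1]
      _ ≤ ‖x - x₀‖ + r / 2 * 1 := by
          have := mul_le_mul ht.2 hy (norm_nonneg _) (by positivity)
          linarith
      _ < r := by linarith
  refine ⟨Metric.ball x₀ (r / 2), 0, 1, r / 2, Metric.mem_ball_self (by positivity),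
    Metric.isOpen_ball, Metric.isBounded_ball, one_pos, by positivity, fun x hx => hmem x hx.1,
    fun x hx _ _ _ _ _ => ?_,
    fun _ => 1, 1, measurable_const, fun _ _ => one_pos, fun x hx t ht y hy hn => ?_,
    fun ψ _ _ _ => ?_⟩
  · exact hball (Metric.ball_subset_ball (by linarith) hx)
  · rw [neg_zero] at hy
    exact absurd (hmem x hx.1 t ⟨ht.1.le, ht.2⟩ y hy) hn
  · simp only [ENNReal.ofReal_one, inv_one, ENNReal.one_rpow, mul_one, ENNReal.coe_one, one_mul]
    exact (lintegral_mono_set inter_subset_right).trans le_self_add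

/-- Directions within `δ` of `c • ν` raise the height at a speed of at least `c - (1 + L) δ`. -/
theorem graphHeight_add_smul_le {ν : 𝔼} (hν : ‖ν‖ = 1) {γ : (Submodule.span ℝ {ν})ᗮ → ℝ} {L : ℝ≥0}
    (hγ : LipschitzWith L γ) (x : 𝔼) {t c δ : ℝ} (ht : 0 ≤ t) {y : 𝔼}
    (hy : y ∈ Metric.closedBall (c • ν) δ) :
    graphHeight ν γ x + t * (c - (1 + L) * δ) ≤ graphHeight ν γ (x + t • y) := by
  rw [mem_closedBall_iff_norm] at hy
  have h1 : x + t • y = (x + t • (y - c • ν)) + (t * c) • ν := by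
    rw [smul_sub, smul_smul]
    abel
  have h2 := graphHeight_add_le hν hγ x (t • (y - c • ν))
  rw [norm_smul, Real.norm_of_nonneg ht] at h2
  have h3 : (1 + (L : ℝ)) * (t * ‖y - c • ν‖) ≤ (1 + L) * (t * δ) := by gcongr
  rw [h1, graphHeight_add_smul hν]
  linarith

theorem exists_coneChart_of_mem_frontier (hn : 2 ≤ n) {Ω : Set 𝔼} (hΩ : IsOpen Ω)
    (hlip : HasLipschitzBoundary Ω) {x₀ : 𝔼} (hx₀ : x₀ ∈ frontier Ω) :
    ∃ (N : Set 𝔼) (ν : 𝔼) (κ t₀ : ℝ), x₀ ∈ N ∧ ConeChart Ω N ν κ t₀ := by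
  obtain ⟨r, hr, ν, hν, L, γ, hγ, hgraph⟩ := hlip x₀ hx₀
  set h : 𝔼 → ℝ := graphHeight ν γ with hh
  have hhc : Continuous h := continuous_graphHeight hγ
  have hΩh : ∀ x ∈ Metric.ball x₀ r, (x ∈ Ω ↔ 0 < h x) := fun x hx =>
    (hgraph x hx).trans sub_pos.symm
  have hx₀b : x₀ ∈ Metric.ball x₀ r := Metric.mem_ball_self hr
  have h0 : h x₀ = 0 := by
    refine le_antisymm (not_lt.1 fun h1 => ?_) (not_lt.1 fun h1 => ?_)
    · rw [hΩ.frontier_eq] at hx₀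
      exact hx₀.2 ((hΩh x₀ hx₀b).2 h1)
    · have hU : IsOpen (Metric.ball x₀ r ∩ {x | h x < 0}) :=
        Metric.isOpen_ball.inter (isOpen_lt hhc continuous_const)
      obtain ⟨z, hz, hzΩ⟩ := mem_closure_iff.1 (frontier_subset_closure hx₀) _ hU ⟨hx₀b, h1⟩
      exact absurd ((hΩh z hz.1).1 hzΩ) (not_lt.2 (le_of_lt hz.2))
  have hL : (0 : ℝ) ≤ L := L.2
  -- `ρ (2 + L) ≤ r / 2` puts the window into half of the ball, and `5 ρ ≤ r / 2` leaves room for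
  -- the points that occur in the Hardy inequality, as `5` bounds the norm on `closedBall (3 • ν)
  -- (2 * κ)`.
  set ρ : ℝ := r / (2 * (5 + L)) with hρ
  have hρ0 : 0 < ρ := by positivity
  have hρr : ρ * (5 + L) = r / 2 := by rw [hρ]; field_simp
  -- Directions within `κ` of `ν` raise the height at a speed of at least `1 - (1 + L) κ = 1 / 2`.
  set κ : ℝ := 1 / (2 * (1 + L)) with hκ
  have hκ0 : 0 < κ := by positivity
  have hκL : (1 + (L : ℝ)) * κ = 1 / 2 := by rw [hκ]; field_simp
  have hκ1 : κ ≤ 1 := by nlinarith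
  set N : Set 𝔼 := {x | ‖hyperplaneProj ν (x - x₀)‖ < ρ ∧ |h x| < ρ} with hN
  have hNo : IsOpen N := by
    rw [hN, ofPred_and]
    refine IsOpen.inter (isOpen_lt ?_ continuous_const) (isOpen_lt ?_ continuous_const)
    · exact ((hyperplaneProj ν).continuous.comp (continuous_id.sub continuous_const)).norm
    · exact hhc.abs
  have hNb : ∀ x ∈ N, ‖x - x₀‖ < r / 2 := by
    intro x hx
    have h1 := norm_le_norm_hyperplaneProj_add hν (x - x₀)
    have h2 := le_graphHeight_add hγ x₀ (x - x₀)
    have h3 := le_graphHeight_add hγ x (x₀ - x)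
    rw [add_sub_cancel] at h2 h3
    rw [← neg_sub x x₀, inner_neg_left, map_neg, norm_neg] at h3
    rw [← hh, h0] at h2 h3
    have h4 : (L : ℝ) * ‖hyperplaneProj ν (x - x₀)‖ ≤ L * ρ := by
      have := hx.1.le
      gcongr
    have h5 := abs_lt.1 hx.2
    have h6 : |inner ℝ (x - x₀) ν| ≤ ρ + L * ρ := abs_le.2 ⟨by linarith, by linarith⟩
    have h7 := hx.1
    nlinarith
  have hadd : ∀ x ∈ N, ∀ v : 𝔼, ‖v‖ < r / 2 → x + v ∈ Metric.ball x₀ r := by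
    intro x hx v hv
    rw [mem_ball_iff_norm, show x + v - x₀ = (x - x₀) + v by abel]
    linarith [norm_add_le (x - x₀) v, hNb x hx]
  have hNball : ∀ x ∈ N, x ∈ Metric.ball x₀ r := fun x hx => by
    rw [mem_ball_iff_norm]
    linarith [hNb x hx]
  have hSpos : ∀ x ∈ N ∩ Ω, 0 < h x := fun x hx => (hΩh x (hNball x hx.1)).1 hx.2
  have hynorm : ∀ {c δ : ℝ} {y : 𝔼}, y ∈ Metric.closedBall (c • ν) δ → ‖y‖ ≤ |c| + δ := by
    intro c δ y hy
    have := norm_le_of_mem_closedBall hy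
    rwa [norm_smul, hν, mul_one, Real.norm_eq_abs] at this
  have hcone : ∀ x ∈ N ∩ Ω, ∀ t : ℝ, 0 ≤ t → ∀ (c δ : ℝ) (y : 𝔼), y ∈ Metric.closedBall (c • ν) δ →
      t * (|c| + δ) < r / 2 → (1 + L) * δ ≤ c → x + t • y ∈ Ω := by
    intro x hx t ht c δ y hy htr hc
    have h1 : ‖t • y‖ < r / 2 := by
      rw [norm_smul, Real.norm_of_nonneg ht]
      exact (mul_le_mul_of_nonneg_left (hynorm hy) ht).trans_lt htr
    rw [hΩh _ (hadd x hx.1 _ h1)]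
    have h2 := graphHeight_add_smul_le hν hγ x ht hy
    have h3 : 0 ≤ t * (c - (1 + L) * δ) := mul_nonneg ht (by linarith)
    linarith [hSpos x hx]
  set t₀ : ℝ := r / 8 with ht₀
  have hneg : ∀ x ∈ N, ∀ t ∈ Icc 0 t₀, ∀ y ∈ Metric.closedBall (-ν) κ,
      x + t • y ∈ Metric.ball x₀ r ∧ t * ‖y‖ ≤ 2 * t := by
    intro x hx t ht y hy
    have h1 : ‖y‖ ≤ 2 := by
      have := norm_le_of_mem_closedBall hy
      rw [norm_neg, hν] at this
      linarith
    have h2 : t * ‖y‖ ≤ 2 * t := by nlinarith [ht.1]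
    refine ⟨hadd x hx _ ?_, h2⟩
    rw [norm_smul, Real.norm_of_nonneg ht.1]
    linarith [ht.2]
  refine ⟨N, ν, κ, t₀, ⟨by simpa using hρ0, by simpa [h0] using hρ0⟩, hNo,
    (Metric.isBounded_ball (x := x₀) (r := r)).subset hNball, hκ0, by positivity,
    fun x hx t ht y hy => ?_, fun x hx t ht y hy hxy => ?_, ?_⟩
  · refine hcone x hx t ht.1 1 κ y (by rwa [one_smul]) ?_ (by linarith)
    rw [abs_one]
    nlinarith [ht.1, ht.2]
  · rw [hΩh _ (hneg x hx t ht y hy).1] at hxy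
    have h1 : -y ∈ Metric.closedBall ((1 : ℝ) • ν) κ := by
      rw [one_smul]
      rwa [mem_closedBall_iff_norm, ← norm_neg, show -(-y - ν) = y - -ν by abel,
        ← mem_closedBall_iff_norm]
    have h2 := graphHeight_add_smul_le hν hγ (x + t • y) ht.1 h1
    rw [smul_neg, add_neg_cancel_right, hκL] at h2
    rw [hΩh x (hNball x hx)]
    linarith [ht.1]
  · have hbd : Bornology.IsBounded (N ∩ Ω) := by
      refine (Metric.isBounded_ball (x := x₀) (r := r)).subset fun x hx => hNball x hx.1
    have hτρ : ∀ x ∈ N ∩ Ω, h x < ρ := fun x hx => (abs_lt.1 hx.1.2).2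
    have hhalf : ∀ x ∈ N ∩ Ω, halveHeight ν γ x ∈ N ∩ Ω := by
      intro x hx
      have h1 : halveHeight ν γ x ∈ N := by
        refine ⟨?_, ?_⟩
        · rw [halveHeight, add_sub_right_comm, hyperplaneProj_add_smul]
          exact hx.1.1
        · rw [hh, graphHeight_halveHeight hν, ← hh, abs_of_pos (half_pos (hSpos x hx))]
          linarith [hτρ x hx, hSpos x hx]
      refine ⟨h1, (hΩh _ (hNball _ h1)).2 ?_⟩
      rw [hh, graphHeight_halveHeight hν]
      exact half_pos (hSpos x hx)
    have hc1 : ∀ x ∈ N ∩ Ω, ∀ y ∈ Metric.closedBall ν κ, x + graphHeight ν γ x • y ∈ Ω := by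
      intro x hx y hy
      refine hcone x hx _ (hSpos x hx).le 1 κ y (by rwa [one_smul]) ?_ (by linarith)
      rw [abs_one]
      nlinarith [hτρ x hx, hSpos x hx]
    have hc2 : ∀ x ∈ N ∩ Ω, ∀ y ∈ Metric.closedBall ((3 : ℝ) • ν) (2 * κ),
        x + graphHeight ν γ x • y ∈ Ω := by
      intro x hx y hy
      refine hcone x hx _ (hSpos x hx).le 3 (2 * κ) y hy ?_ (by linarith)
      rw [abs_of_pos (by norm_num)]
      nlinarith [hτρ x hx, hSpos x hx]
    obtain ⟨C, hC⟩ := exists_hardy hn hν hγ (hNo.inter hΩ).measurableSet hΩ.measurableSet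
      inter_subset_right hbd hSpos hhalf hκ0 hκ1 hc1 hc2
    -- Along the opposite cones the height decreases at a speed of at most `2 (1 + L)`; twice that
    -- number makes the inequality `h x / a < t` strict.
    set a : ℝ := 4 * (1 + L) with ha
    have ha0 : 0 < a := by positivity
    have hCt : ENNReal.ofReal a ^ (n : ℝ) * C ≠ ∞ := ENNReal.mul_ne_top
      (ENNReal.rpow_ne_top_of_nonneg (Nat.cast_nonneg n) ENNReal.ofReal_ne_top)
      ENNReal.coe_ne_top
    refine ⟨fun x => h x / a, (ENNReal.ofReal a ^ (n : ℝ) * C).toNNReal,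
      (hhc.div_const a).measurable, fun x hx => div_pos (hSpos x hx) ha0,
      fun x hx t ht y hy hxy => ?_, fun ψ hψ hψc hψs => ?_⟩
    · obtain ⟨h1, h2⟩ := hneg x hx.1 t ⟨ht.1.le, ht.2⟩ y hy
      rw [hΩh _ h1, not_lt] at hxy
      have h3 := graphHeight_add_le hν hγ x (t • y)
      rw [norm_smul, Real.norm_of_nonneg ht.1.le] at h3
      rw [div_lt_iff₀ ha0]
      have h4 : (1 + (L : ℝ)) * (t * ‖y‖) ≤ (1 + L) * (2 * t) := by gcongr
      have h5 : 0 < (1 + (L : ℝ)) * t := mul_pos (by positivity) ht.1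
      calc h x ≤ (1 + L) * (2 * t) := by linarith
        _ < t * a := by rw [ha]; linarith
    · rw [ENNReal.coe_toNNReal hCt]
      have hw : ∀ x, (ENNReal.ofReal (h x / a))⁻¹ ^ (n : ℝ) =
          ENNReal.ofReal a ^ (n : ℝ) * (ENNReal.ofReal (h x))⁻¹ ^ (n : ℝ) := by
        intro x
        rw [ENNReal.ofReal_div_of_pos ha0, ENNReal.inv_div (by simp) (by simp [ha0]),
          div_eq_mul_inv, ENNReal.mul_rpow_of_nonneg _ _ (Nat.cast_nonneg n)]
      -- The height is positive on the compact part of the support of `ψ` near the window.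
      have hc : ∃ c > 0, ∀ x ∈ (N ∩ Ω) ∩ tsupport ψ, c ≤ graphHeight ν γ x := by
        set K := tsupport ψ ∩ Metric.closedBall x₀ (r / 2) with hK
        have hKc : IsCompact K := hψc.isCompact.inter_right Metric.isClosed_closedBall
        have hsub : (N ∩ Ω) ∩ tsupport ψ ⊆ K := fun x hx =>
          ⟨hx.2, mem_closedBall_iff_norm.2 (hNb x hx.1.1).le⟩
        rcases K.eq_empty_or_nonempty with hE | hE
        · exact ⟨1, one_pos, fun x hx => absurd (hsub hx) (by simp [hE])⟩
        · obtain ⟨z, hz, hmin⟩ := hKc.exists_isMinOn hE hhc.continuousOn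
          refine ⟨h z, ?_, fun x hx => hmin (hsub hx)⟩
          refine (hΩh z (Metric.closedBall_subset_ball (by linarith) hz.2)).1 (hψs hz.1)
      simp_rw [hw, mul_left_comm _ (ENNReal.ofReal a ^ (n : ℝ)) _]
      rw [lintegral_const_mul' _ _
        (ENNReal.rpow_ne_top_of_nonneg (Nat.cast_nonneg n) ENNReal.ofReal_ne_top), mul_assoc]
      gcongr
      refine (hC ψ hψ hψc hc).trans ?_
      gcongr
      exact le_add_self

theorem exists_coneChart (hn : 2 ≤ n) {Ω : Set 𝔼} (hΩ : IsOpen Ω)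
    (hlip : HasLipschitzBoundary Ω) {x₀ : 𝔼} (hx₀ : x₀ ∈ closure Ω) :
    ∃ (N : Set 𝔼) (ν : 𝔼) (κ t₀ : ℝ), x₀ ∈ N ∧ ConeChart Ω N ν κ t₀ := by
  by_cases hx : x₀ ∈ Ω
  · exact exists_coneChart_of_mem hΩ hx
  · exact exists_coneChart_of_mem_frontier hn hΩ hlip (hΩ.frontier_eq ▸ ⟨hx₀, hx⟩)

/-! ### Reduction to oscillations in a window -/

/-- The Jacobian determinant of a family of `n` functions on `ℝⁿ`. -/
noncomputable def jacobian (f : Fin n → EuclideanSpace ℝ (Fin n) → ℝ)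
    (x : EuclideanSpace ℝ (Fin n)) : ℝ :=
  (Matrix.of fun i j => fderiv ℝ (f i) x (EuclideanSpace.basisFun (Fin n) ℝ j)).det

theorem exists_contDiff_kernel (c : 𝔼) {κ : ℝ} (hκ : 0 < κ) :
    ∃ η : 𝔼 → ℝ, ContDiff ℝ 2 η ∧ HasCompactSupport η ∧ tsupport η = Metric.closedBall c κ ∧
      ∫ y, η y = 1 := by
  set b : ContDiffBump c := ⟨κ / 2, κ, by positivity, by linarith⟩ with hb
  exact ⟨b.normed volume, b.contDiff_normed (n := 2), b.hasCompactSupport_normed,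
    b.tsupport_normed_eq, b.integral_normed⟩

theorem exists_contDiff_eventuallyEq {Ω K : Set 𝔼} (hΩ : IsOpen Ω) (hK : IsCompact K)
    (hKΩ : K ⊆ Ω) {f : 𝔼 → ℝ} (hf : ContDiffOn ℝ 1 f Ω) :
    ∃ g : 𝔼 → ℝ, ContDiff ℝ 1 g ∧ ∀ᶠ x in 𝓝ˢ K, g x = f x := by
  obtain ⟨T, hTc, hKT, hTΩ⟩ := exists_compact_between hK hΩ hKΩ
  obtain ⟨ζ, h1, h0, -⟩ := exists_contMDiffMap_one_nhds_of_subset_interior (n := 1)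
    (modelWithCornersSelf ℝ 𝔼) hK.isClosed hKT
  have hζ : ContDiff ℝ 1 ζ := ζ.contMDiff.contDiff
  refine ⟨fun x => ζ x * f x, contDiff_iff_contDiffAt.2 fun x => ?_, ?_⟩
  · by_cases hx : x ∈ Ω
    · exact hζ.contDiffAt.mul (hf.contDiffAt (hΩ.mem_nhds hx))
    · have hev : (fun y => ζ y * f y) =ᶠ[𝓝 x] fun _ => 0 := by
        filter_upwards [hTc.isClosed.isOpen_compl.mem_nhds fun h => hx (hTΩ h)] with y hy
        rw [h0 y hy, zero_mul]
      exact contDiffAt_const.congr_of_eventuallyEq hev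
  · filter_upwards [h1] with x hx
    rw [hx, one_mul]

theorem jacobian_congr {f g : Fin n → 𝔼 → ℝ} {x : 𝔼} (h : ∀ i, f i =ᶠ[𝓝 x] g i) :
    jacobian f x = jacobian g x := by
  have h' : ∀ i, fderiv ℝ (f i) x = fderiv ℝ (g i) x := fun i => (h i).fderiv_eq
  simp only [jacobian, h']

theorem norm_basisFun (j : Fin n) : ‖EuclideanSpace.basisFun (Fin n) ℝ j‖ = 1 :=
  (EuclideanSpace.basisFun (Fin n) ℝ).orthonormal.norm_eq_one j

theorem enorm_det_cylinderJacobian_le (F : Fin n → 𝔼 × ℝ → ℝ) (Ψ : 𝔼 × ℝ → ℝ) (q : 𝔼 × ℝ) :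
    ‖(cylinderJacobian (EuclideanSpace.basisFun (Fin n) ℝ) F Ψ q).det‖ₑ ≤
      (n + 1).factorial * ((∏ i, ‖fderiv ℝ (F i) q‖ₑ) * ‖fderiv ℝ Ψ q‖ₑ) := by
  have hdir : ∀ j : Fin n ⊕ Unit,
      ‖Sum.elim (fun j => (EuclideanSpace.basisFun (Fin n) ℝ j, (0 : ℝ)))
      (fun _ => ((0 : 𝔼), (1 : ℝ))) j‖ ≤ 1 := by
    rintro (j | j)
    · simp only [Sum.elim_inl, Prod.norm_def, norm_basisFun, norm_zero]
      simp
    · simp [Prod.norm_def]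
  have h := abs_det_le_factorial_mul_prod
    (cylinderJacobian (EuclideanSpace.basisFun (Fin n) ℝ) F Ψ q)
    (fun i => ‖fderiv ℝ (Sum.elim F (fun _ => Ψ) i) q‖) (fun i j =>
      ((fderiv ℝ (Sum.elim F (fun _ => Ψ) i) q).le_opNorm _).trans
        (mul_le_of_le_one_right (norm_nonneg _) (hdir j)))
  rw [Fintype.prod_sum_type, Fintype.card_sum, Fintype.card_fin, Fintype.card_unit] at h
  simp only [Sum.elim_inl, Sum.elim_inr, Finset.univ_unique, Finset.prod_const,
    Finset.card_singleton, pow_one] at h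
  rw [Real.enorm_eq_ofReal_abs]
  refine (ENNReal.ofReal_le_ofReal h).trans_eq ?_
  rw [ENNReal.ofReal_mul (by positivity), ENNReal.ofReal_natCast,
    ENNReal.ofReal_mul (Finset.prod_nonneg fun _ _ => norm_nonneg _),
    ENNReal.ofReal_prod_of_nonneg fun _ _ => norm_nonneg _]
  simp only [ofReal_norm]

/-- In a window of a chart, the pairing of a Jacobian determinant with the trace of a function `Ψ`
on the half-space is controlled by the oscillations of the components over cones contained in `Ω`.
The components are replaced by globally defined functions that agree with them near the part of
`Ω` that matters. -/
theorem ConeChart.exists_enorm_integral_mul_jacobian_le {Ω N : Set 𝔼} {ν : 𝔼} {κ t₀ : ℝ}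
    (h : ConeChart Ω N ν κ t₀) (hΩ : IsOpen Ω) :
    ∃ C : ℝ≥0, ∀ f : Fin n → 𝔼 → ℝ, (∀ i, ContDiffOn ℝ 1 (f i) Ω) →
      ∀ K : Set 𝔼, IsCompact K → K ⊆ N ∩ Ω →
      ∀ Ψ : 𝔼 × ℝ → ℝ, ContDiff ℝ 1 Ψ → HasCompactSupport Ψ →
        (∀ q ∈ tsupport Ψ, 0 ≤ q.2 → q.1 ∈ K ∧ q.2 ≤ t₀) →
      ∃ (L : Set 𝔼) (g : Fin n → 𝔼 → ℝ), MeasurableSet L ∧ K ⊆ L ∧ L ⊆ Ω ∧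
        (∀ x ∈ K, ∀ t ∈ Icc 0 t₀, ∀ y ∈ Metric.closedBall ν κ, x + t • y ∈ L) ∧
        (∀ i, Measurable (g i)) ∧ (∀ i, EqOn (g i) (f i) L) ∧
        ‖∫ x in Ω, Ψ (x, 0) * jacobian f x‖ₑ ≤ C * ∫⁻ q in K ×ˢ Ioc 0 t₀, ‖fderiv ℝ Ψ q‖ₑ *
          ∏ i, ((ENNReal.ofReal q.2)⁻¹ * coneOscillation (Metric.closedBall ν κ) (g i) q) := by
  obtain ⟨η, hη, hηc, hηs, hη1⟩ := exists_contDiff_kernel ν h.κ_pos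
  have hη' : ContDiff ℝ 1 η := hη.of_le (by norm_num)
  obtain ⟨C, hC⟩ := exists_enorm_fderiv_coneAverage_le (μ := (volume : Measure 𝔼)) hη hηc
  refine ⟨(n + 1).factorial * C ^ n, fun f hf K hK hKN Ψ hΨ hΨc hΨK => ?_⟩
  set B := Metric.closedBall ν κ with hB
  set L : Set 𝔼 := (fun z : 𝔼 × ℝ × 𝔼 => z.1 + z.2.1 • z.2.2) '' (K ×ˢ Icc 0 t₀ ×ˢ B) with hL
  have hLc : IsCompact L := (hK.prod (isCompact_Icc.prod (isCompact_closedBall ν κ))).image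
    (by fun_prop)
  have hmemL : ∀ x ∈ K, ∀ t ∈ Icc 0 t₀, ∀ y ∈ B, x + t • y ∈ L := fun x hx t ht y hy =>
    ⟨(x, t, y), ⟨hx, ht, hy⟩, rfl⟩
  have hLΩ : L ⊆ Ω := by
    rintro _ ⟨⟨x, t, y⟩, ⟨hx, ht, hy⟩, rfl⟩
    exact h.add_mem x (hKN hx) t ht y hy
  have hKL : K ⊆ L := fun x hx => by
    simpa using hmemL x hx 0 ⟨le_rfl, h.t₀_pos.le⟩ ν (Metric.mem_closedBall_self h.κ_pos.le)
  choose g hg hgf using fun i => exists_contDiff_eventuallyEq hΩ hLc hLΩ (hf i)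
  have hev : ∀ i, ∀ x ∈ L, g i =ᶠ[𝓝 x] f i := fun i x hx =>
    (hgf i).filter_mono (nhds_le_nhdsSet hx)
  refine ⟨L, g, hLc.isClosed.measurableSet, hKL, hLΩ, hmemL, fun i => (hg i).continuous.measurable,
    fun i x hx => (hev i x hx).self_of_nhds, ?_⟩
  set F : Fin n → 𝔼 × ℝ → ℝ := fun i => coneAverage volume η (g i) with hF
  have hF1 : ∀ i, ContDiff ℝ 1 (F i) := fun i => contDiff_coneAverage hη' hηc (hg i)
  have hFx : ∀ i x v, fderiv ℝ (F i) (x, 0) (v, 0) = fderiv ℝ (g i) x v := by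
    intro i x v
    have h1 : g i = F i ∘ fun x => (x, (0 : ℝ)) :=
      funext fun x => (coneAverage_zero η (g i) x hη1).symm
    have h2 : HasFDerivAt (fun x : 𝔼 => (x, (0 : ℝ))) (ContinuousLinearMap.inl ℝ 𝔼 ℝ) x :=
      hasFDerivAt_prodMk_left x 0
    rw [h1, (((hF1 i).differentiable one_ne_zero (x, 0)).hasFDerivAt.comp x h2).fderiv]
    rfl
  have hint : ∫ x in Ω, Ψ (x, 0) * jacobian f x = ∫ x, Ψ (x, 0) *
      (Matrix.of fun i j =>
        fderiv ℝ (F i) (x, 0) (EuclideanSpace.basisFun (Fin n) ℝ j, 0)).det := by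
    have h0 : ∀ x ∉ K, Ψ (x, 0) = 0 := fun x hx =>
      image_eq_zero_of_notMem_tsupport fun h' => hx (hΨK (x, 0) h' le_rfl).1
    rw [setIntegral_eq_integral_of_forall_compl_eq_zero fun x hx => by
      rw [h0 x fun h' => hx (hKN h').2, zero_mul]]
    refine integral_congr_ae (Eventually.of_forall fun x => ?_)
    by_cases hx : x ∈ K
    · simp only [hFx]
      rw [← jacobian_congr fun i => hev i x (hKL hx)]
      rfl
    · simp only [h0 x hx, zero_mul]
  rw [hint]
  have hO : MeasurableSet (univ ×ˢ Ioi (0 : ℝ) : Set (𝔼 × ℝ)) :=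
    MeasurableSet.univ.prod measurableSet_Ioi
  have hQ : MeasurableSet (K ×ˢ Ioc 0 t₀) := hK.isClosed.measurableSet.prod measurableSet_Ioc
  refine (enorm_integral_mul_det_le (EuclideanSpace.basisFun (Fin n) ℝ) hF1
    (fun i => contDiffOn_coneAverage hη hηc (hg i).continuous) hΨ hΨc).trans ?_
  rw [← Measure.volume_eq_prod, ← lintegral_indicator hO]
  have hCt : (((n + 1).factorial * C ^ n : ℝ≥0) : ℝ≥0∞) ≠ ∞ := ENNReal.coe_ne_top
  rw [← lintegral_const_mul' _ _ hCt, ← lintegral_indicator hQ]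
  refine lintegral_mono fun q => ?_
  refine indicator_le (fun q hq => ?_) q
  by_cases hqs : q ∈ tsupport Ψ
  · obtain ⟨h1, h2⟩ := hΨK q hqs (le_of_lt hq.2)
    rw [indicator_of_mem (show q ∈ K ×ˢ Ioc 0 t₀ from ⟨h1, hq.2, h2⟩)]
    refine (enorm_det_cylinderJacobian_le F Ψ q).trans ?_
    have h3 : ∏ i, ‖fderiv ℝ (F i) q‖ₑ ≤
        ∏ i, (C * ((ENNReal.ofReal q.2)⁻¹ * coneOscillation B (g i) q)) := by
      refine Finset.prod_le_prod' fun i _ => ?_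
      rw [← mul_assoc]
      have := hC (g i) (hg i) q hq.2
      rwa [hηs] at this
    rw [Finset.prod_mul_distrib, Finset.prod_const, Finset.card_univ, Fintype.card_fin] at h3
    refine (mul_le_mul_right (mul_le_mul_left h3 _) _).trans_eq ?_
    push_cast
    ring
  · have h1 : fderiv ℝ Ψ q = 0 := fderiv_eq_zero_of_notMem_tsupport hqs
    have h2 := enorm_det_cylinderJacobian_le F Ψ q
    rw [h1, ← ofReal_norm (0 : 𝔼 × ℝ →L[ℝ] ℝ), norm_zero, ENNReal.ofReal_zero, mul_zero,
      mul_zero] at h2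
    exact h2.trans zero_le

theorem exists_enorm_fderiv_mul_le {E : Type*} [NormedAddCommGroup E] [NormedSpace ℝ E] {a : E → ℝ}
    (ha : ContDiff ℝ 1 a) (hac : HasCompactSupport a) :
    ∃ M : ℝ≥0, ∀ (b : E → ℝ) (q : E), DifferentiableAt ℝ b q →
      ‖fderiv ℝ (fun z => a z * b z) q‖ₑ ≤ M * (‖fderiv ℝ b q‖ₑ + ‖b q‖ₑ) := by
  obtain ⟨M₁, h1⟩ := hac.exists_bound_of_continuous ha.continuous
  obtain ⟨M₂, h2⟩ := (hac.fderiv ℝ).exists_bound_of_continuous (ha.continuous_fderiv one_ne_zero)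
  refine ⟨(max M₁ M₂).toNNReal, fun b q hb => ?_⟩
  rw [fderiv_fun_mul (ha.differentiable one_ne_zero q) hb]
  refine (enorm_add_le (a q • fderiv ℝ b q) (b q • fderiv ℝ a q)).trans ?_
  rw [enorm_smul, enorm_smul, mul_add, mul_comm ‖b q‖ₑ]
  gcongr
  · rw [← ofReal_norm]
    exact ENNReal.ofReal_le_ofReal ((h1 q).trans (le_max_left _ _))
  · rw [← ofReal_norm]
    exact ENNReal.ofReal_le_ofReal ((h2 q).trans (le_max_right _ _))

/-! ### Estimates by the gradient of the test function -/

/-- The pairing of `χ ψ` with Jacobian determinants, for `ψ` a test function on `Ω`, is bounded by a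
product of quantities `N`, one for each component, and a quantity `M` of the test function. -/
def JacobianBound (Ω : Set (EuclideanSpace ℝ (Fin n))) (χ : EuclideanSpace ℝ (Fin n) → ℝ)
    (N M : (EuclideanSpace ℝ (Fin n) → ℝ) → ℝ≥0∞) : Prop :=
  ∃ C : ℝ≥0∞, C ≠ ∞ ∧ ∀ f : Fin n → EuclideanSpace ℝ (Fin n) → ℝ,
    (∀ i, ContDiffOn ℝ 1 (f i) Ω) → ∀ ψ : EuclideanSpace ℝ (Fin n) → ℝ, ContDiff ℝ 1 ψ →
      HasCompactSupport ψ → tsupport ψ ⊆ Ω →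
      ‖∫ x in Ω, χ x * ψ x * jacobian f x‖ₑ ≤ C * (∏ i, N (f i)) * M ψ

/-- The case `Ψ (x, t) = χ x * φ t * b (x, t)` of `exists_enorm_integral_mul_jacobian_le`, with
cutoffs `χ` in the window and `φ` in the range of heights of the cones. -/
theorem ConeChart.exists_enorm_integral_cutoff_mul_le {Ω N : Set 𝔼} {ν : 𝔼} {κ t₀ : ℝ}
    (h : ConeChart Ω N ν κ t₀) (hΩ : IsOpen Ω) {χ : 𝔼 → ℝ} (hχ : ContDiff ℝ 1 χ)
    (hχc : HasCompactSupport χ) :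
    ∃ C : ℝ≥0, ∀ f : Fin n → 𝔼 → ℝ, (∀ i, ContDiffOn ℝ 1 (f i) Ω) →
      ∀ K : Set 𝔼, IsCompact K → K ⊆ N ∩ Ω →
      ∀ b : 𝔼 × ℝ → ℝ, ContDiff ℝ 1 b →
        (∀ q ∈ tsupport b, q.1 ∈ tsupport χ → q.2 ∈ Icc 0 t₀ → q.1 ∈ K) →
      ∃ (L : Set 𝔼) (g : Fin n → 𝔼 → ℝ), MeasurableSet L ∧ K ⊆ L ∧ L ⊆ Ω ∧
        (∀ x ∈ K, ∀ t ∈ Icc 0 t₀, ∀ y ∈ Metric.closedBall ν κ, x + t • y ∈ L) ∧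
        (∀ i, Measurable (g i)) ∧ (∀ i, EqOn (g i) (f i) L) ∧
        ‖∫ x in Ω, χ x * b (x, 0) * jacobian f x‖ₑ ≤ C * ∫⁻ q in K ×ˢ Ioc 0 t₀,
          (‖fderiv ℝ b q‖ₑ + ‖b q‖ₑ) *
            ∏ i, ((ENNReal.ofReal q.2)⁻¹ * coneOscillation (Metric.closedBall ν κ) (g i) q) := by
  have ht₀ := h.t₀_pos
  set φ : ContDiffBump (0 : ℝ) := ⟨t₀ / 2, t₀, by positivity, by linarith⟩ with hφ
  have hφ0 : φ 0 = 1 := φ.one_of_mem_closedBall (Metric.mem_closedBall_self φ.rIn_pos.le)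
  set a : 𝔼 × ℝ → ℝ := fun q => χ q.1 * φ q.2 with ha
  have ha1 : ContDiff ℝ 1 a := (hχ.comp contDiff_fst).mul ((φ.contDiff (n := 1)).comp contDiff_snd)
  have hsupp : tsupport a ⊆ tsupport χ ×ˢ Metric.closedBall (0 : ℝ) t₀ := by
    refine closure_minimal (fun q hq => ?_) ((isClosed_tsupport χ).prod Metric.isClosed_closedBall)
    have h1 : χ q.1 * φ q.2 ≠ 0 := hq
    refine ⟨subset_tsupport χ (left_ne_zero_of_mul h1), ?_⟩
    have h2 : q.2 ∈ tsupport φ := subset_tsupport φ (right_ne_zero_of_mul h1)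
    rwa [φ.tsupport_eq] at h2
  have hac : HasCompactSupport a :=
    (hχc.isCompact.prod (isCompact_closedBall (0 : ℝ) t₀)).of_isClosed_subset
      (isClosed_tsupport a) hsupp
  obtain ⟨M, hM⟩ := exists_enorm_fderiv_mul_le ha1 hac
  obtain ⟨C, hC⟩ := h.exists_enorm_integral_mul_jacobian_le hΩ
  refine ⟨C * M, fun f hf K hK hKN b hb hbK => ?_⟩
  obtain ⟨L, g, hL, hKL, hLΩ, hcone, hg, hgf, hle⟩ := hC f hf K hK hKN (fun q => a q * b q)
    (ha1.mul hb) hac.mul_right (fun q hq hq0 => by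
      have h1 := hsupp (tsupport_mul_subset_left hq)
      have h2 : q.2 ≤ t₀ := by
        have := h1.2
        rw [mem_closedBall_zero_iff] at this
        exact (le_abs_self _).trans this
      exact ⟨hbK q (tsupport_mul_subset_right hq) h1.1 ⟨hq0, h2⟩, h2⟩)
  refine ⟨L, g, hL, hKL, hLΩ, hcone, hg, hgf, ?_⟩
  simp only [ha, hφ0, mul_one] at hle
  refine hle.trans ?_
  rw [ENNReal.coe_mul, mul_assoc]
  gcongr
  rw [← lintegral_const_mul' _ _ ENNReal.coe_ne_top]
  refine lintegral_mono fun q => ?_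
  rw [← mul_assoc]
  gcongr
  exact hM b q (hb.differentiable one_ne_zero q)

theorem norm_lt_of_mem_closedBall {ν y : 𝔼} {κ : ℝ} (hy : y ∈ Metric.closedBall ν κ) :
    ‖y‖ < ‖ν‖ + κ + 1 := by
  linarith [norm_le_of_mem_closedBall hy]

theorem ConeChart.lintegral_coneOscillation_rpow_le {Ω N : Set 𝔼} {ν : 𝔼} {κ t₀ : ℝ}
    (h : ConeChart Ω N ν κ t₀) {K L : Set 𝔼} (hK : MeasurableSet K) (hL : MeasurableSet L)
    (hKL : K ⊆ L) (hLΩ : L ⊆ Ω)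
    (hcone : ∀ x ∈ K, ∀ t ∈ Icc 0 t₀, ∀ y ∈ Metric.closedBall ν κ, x + t • y ∈ L) {f g : 𝔼 → ℝ}
    (hg : Measurable g) (hgf : EqOn g f L) {p : ℝ} (hp : 1 ≤ p) (hnp : 1 < n + p) :
    ∫⁻ q in K ×ˢ Ioc 0 t₀,
        ((ENNReal.ofReal q.2)⁻¹ * coneOscillation (Metric.closedBall ν κ) g q) ^ p ≤
      traceConst (Metric.closedBall ν κ) (‖ν‖ + κ + 1) p * traceEnergy Ω p f := by
  have hκ := h.κ_pos
  refine (lintegral_inv_mul_coneOscillation_rpow_le Metric.isClosed_closedBall.measurableSet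
    (by positivity) (fun y hy => norm_lt_of_mem_closedBall hy) hp hnp hg hL
    (hK.prod measurableSet_Ioc) (fun q hq => hq.2.1) (fun q hq => hKL hq.1)
    (fun q hq y hy => hcone q.1 hq.1 q.2 ⟨hq.2.1.le, hq.2.2⟩ y hy)).trans ?_
  rw [traceEnergy_congr hL p hgf]
  gcongr
  exact traceEnergy_mono hLΩ p f

theorem prod_mul_rpow_eq {ι : Type*} [Fintype ι] (T : ℝ≥0∞) (E : ι → ℝ≥0∞) {r : ℝ} (hr : 0 ≤ r) :
    ∏ i, (T * E i) ^ r = (T ^ r) ^ Fintype.card ι * ∏ i, E i ^ r := by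
  simp_rw [ENNReal.mul_rpow_of_nonneg _ _ hr, Finset.prod_mul_distrib, Finset.prod_const,
    Finset.card_univ]

theorem mem_tsupport_comp_fst {ψ : 𝔼 → ℝ} {q : 𝔼 × ℝ} (hq : q ∈ tsupport fun q : 𝔼 × ℝ => ψ q.1) :
    q.1 ∈ tsupport ψ :=
  tsupport_comp_subset_preimage ψ continuous_fst hq

theorem enorm_fderiv_comp_fst_le {ψ : 𝔼 → ℝ} (hψ : ContDiff ℝ 1 ψ) (q : 𝔼 × ℝ) :
    ‖fderiv ℝ (fun q : 𝔼 × ℝ => ψ q.1) q‖ₑ ≤ ‖fderiv ℝ ψ q.1‖ₑ := by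
  have h1 : HasFDerivAt (fun q : 𝔼 × ℝ => ψ q.1)
      ((fderiv ℝ ψ q.1).comp (ContinuousLinearMap.fst ℝ 𝔼 ℝ)) q :=
    ((hψ.differentiable one_ne_zero q.1).hasFDerivAt).comp q hasFDerivAt_fst
  rw [h1.fderiv, ← ofReal_norm, ← ofReal_norm]
  refine ENNReal.ofReal_le_ofReal ((ContinuousLinearMap.opNorm_comp_le _ _).trans ?_)
  exact mul_le_of_le_one_right (norm_nonneg _) (ContinuousLinearMap.norm_fst_le ℝ 𝔼 ℝ)

/-- The estimate with the gradient of the test function in `L^∞`, in a window. -/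
theorem ConeChart.jacobianBound_top (hn : 2 ≤ n) {Ω N : Set 𝔼} {ν : 𝔼} {κ t₀ : ℝ}
    (h : ConeChart Ω N ν κ t₀) (hΩ : IsOpen Ω) (hb : Bornology.IsBounded Ω) {χ : 𝔼 → ℝ}
    (hχ : ContDiff ℝ 1 χ) (hχc : HasCompactSupport χ) (hχN : tsupport χ ⊆ N) :
    JacobianBound Ω χ (fun f => traceEnergy Ω n f ^ (1 / (n : ℝ)))
      (fun ψ => eLpNorm (gradient ψ) ∞ (volume.restrict Ω)) := by
  have hn1 : (1 : ℝ) ≤ n := by exact_mod_cast (by omega : 1 ≤ n)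
  obtain ⟨C, hC⟩ := h.exists_enorm_integral_cutoff_mul_le hΩ hχ hχc
  obtain ⟨P, hP⟩ := exists_enorm_le_eLpNorm_top_gradient (by omega : n ≠ 0) hΩ hb
  set T := traceConst (Metric.closedBall ν κ) (‖ν‖ + κ + 1) n with hT
  have hTt : T ≠ ∞ := traceConst_ne_top measure_closedBall_lt_top.ne _ hn1
  refine ⟨C * ((1 + P) * (T ^ (1 / (n : ℝ))) ^ n), ?_, fun f hf ψ hψ hψc hψs => ?_⟩
  · exact ENNReal.mul_ne_top ENNReal.coe_ne_top (ENNReal.mul_ne_top (by simp)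
      (ENNReal.pow_ne_top (ENNReal.rpow_ne_top_of_nonneg (by positivity) hTt)))
  have hKc : IsCompact (tsupport χ ∩ tsupport ψ) :=
    hχc.isCompact.inter_right (isClosed_tsupport ψ)
  set K := tsupport χ ∩ tsupport ψ with hK
  obtain ⟨L, g, hL, hKL, hLΩ, hcone, hg, hgf, hle⟩ := hC f hf K hKc
    (inter_subset_inter hχN hψs) (fun q => ψ q.1) (hψ.comp contDiff_fst)
    (fun q hq h1 _ => ⟨h1, mem_tsupport_comp_fst hq⟩)
  set D := eLpNorm (gradient ψ) ∞ (volume.restrict Ω) with hD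
  set F : Fin n → 𝔼 × ℝ → ℝ≥0∞ := fun i q =>
    (ENNReal.ofReal q.2)⁻¹ * coneOscillation (Metric.closedBall ν κ) (g i) q with hF
  have hFm : ∀ i, Measurable (F i) := fun i => by
    have := measurable_coneOscillation (Metric.closedBall ν κ) (hg i)
    fun_prop
  have hpt : ∀ q : 𝔼 × ℝ, ‖fderiv ℝ (fun q : 𝔼 × ℝ => ψ q.1) q‖ₑ + ‖ψ q.1‖ₑ ≤ (1 + P) * D := by
    intro q
    rw [add_mul, one_mul]
    exact add_le_add ((enorm_fderiv_comp_fst_le hψ q).trans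
      (enorm_fderiv_le_eLpNorm_top hΩ hψ hψs _)) (hP ψ hψ hψs _)
  calc ‖∫ x in Ω, χ x * ψ x * jacobian f x‖ₑ
      ≤ C * ∫⁻ q in K ×ˢ Ioc 0 t₀, (‖fderiv ℝ (fun q : 𝔼 × ℝ => ψ q.1) q‖ₑ + ‖ψ q.1‖ₑ) *
          ∏ i, F i q := hle
    _ ≤ C * ∫⁻ q in K ×ˢ Ioc 0 t₀, (1 + P) * D * ∏ i, F i q := by
        gcongr with q
        exact hpt q
    _ = C * ((1 + P) * D * ∫⁻ q in K ×ˢ Ioc 0 t₀, ∏ i, F i q) := by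
        rw [lintegral_const_mul _ (Finset.measurable_fun_prod _ fun i _ => hFm i)]
    _ ≤ C * ((1 + P) * D * ∏ i, (T * traceEnergy Ω n (f i)) ^ (1 / (n : ℝ))) := by
        gcongr
        refine (lintegral_prod_le_prod_rpow _ (by omega) hFm).trans ?_
        gcongr with i
        exact h.lintegral_coneOscillation_rpow_le hKc.isClosed.measurableSet hL hKL hLΩ hcone (hg i)
          (hgf i) hn1 (by linarith)
    _ = _ := by
        rw [prod_mul_rpow_eq _ _ (by positivity), Fintype.card_fin]
        ring

/-- The Hölder seminorm on `Ω`. -/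
noncomputable def holderSeminorm (Ω : Set (EuclideanSpace ℝ (Fin n))) (α : ℝ)
    (f : EuclideanSpace ℝ (Fin n) → ℝ) : ℝ≥0∞ :=
  ⨆ x ∈ Ω, ⨆ y ∈ Ω, ⨆ _ : x ≠ y, ‖f x - f y‖ₑ / ‖x - y‖ₑ ^ α

theorem enorm_sub_le_holderSeminorm_mul {Ω : Set 𝔼} {α : ℝ} {f : 𝔼 → ℝ} {x y : 𝔼} (hx : x ∈ Ω)
    (hy : y ∈ Ω) : ‖f x - f y‖ₑ ≤ holderSeminorm Ω α f * ‖x - y‖ₑ ^ α := by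
  rcases eq_or_ne x y with rfl | hne
  · simp
  have h1 : ‖x - y‖ₑ ≠ 0 := by rwa [enorm_ne_zero, sub_ne_zero]
  have h2 : ‖x - y‖ₑ ^ α ≠ 0 := fun h => h1 (by
    rcases ENNReal.rpow_eq_zero_iff.1 h with h | h
    · exact h.1
    · exact absurd h.1 enorm_ne_top)
  have h3 : ‖x - y‖ₑ ^ α ≠ ∞ := ENNReal.rpow_ne_top_of_ne_zero h1 enorm_ne_top
  rw [← ENNReal.div_le_iff h2 h3]
  exact le_iSup₂_of_le x hx (le_iSup₂_of_le y hy (le_iSup_of_le hne le_rfl))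

theorem lintegral_Ioc_inv_rpow_lt_top {r : ℝ} (hr : r < 1) (t₀ : ℝ) :
    ∫⁻ t in Ioc 0 t₀, (ENNReal.ofReal t)⁻¹ ^ r < ∞ := by
  have h1 : ∀ t ∈ Ioc 0 t₀, (ENNReal.ofReal t)⁻¹ ^ r = ENNReal.ofReal (t ^ (-r)) := by
    intro t ht
    rw [← ENNReal.ofReal_inv_of_pos ht.1, ENNReal.ofReal_rpow_of_pos (inv_pos.2 ht.1),
      Real.inv_rpow ht.1.le, Real.rpow_neg ht.1.le]
  rw [setLIntegral_congr_fun measurableSet_Ioc h1]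
  exact (intervalIntegral.intervalIntegrable_rpow' (a := 0) (b := t₀)
    (by linarith : -1 < -r)).1.lintegral_lt_top

/-- The estimate with the gradient of the test function in `L¹`, in a window. For Hölder continuous
components the integrand on the half-space is of order `t ^ (n (α - 1))`, and `n (α - 1) > -1`. -/
theorem ConeChart.jacobianBound_one (hn : 2 ≤ n) {Ω N : Set 𝔼} {ν : 𝔼} {κ t₀ : ℝ}
    (h : ConeChart Ω N ν κ t₀) (hΩ : IsOpen Ω) (hb : Bornology.IsBounded Ω) {χ : 𝔼 → ℝ}
    (hχ : ContDiff ℝ 1 χ) (hχc : HasCompactSupport χ) (hχN : tsupport χ ⊆ N) {α : ℝ}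
    (hα0 : 0 ≤ α) (hα : n * (1 - α) < 1) :
    JacobianBound Ω χ (holderSeminorm Ω α)
      (fun ψ => eLpNorm (gradient ψ) 1 (volume.restrict Ω)) := by
  obtain ⟨C, hC⟩ := h.exists_enorm_integral_cutoff_mul_le hΩ hχ hχc
  obtain ⟨P, hP⟩ := exists_lintegral_le_eLpNorm_one_gradient hn hb
  set B := Metric.closedBall ν κ with hB
  set R := ‖ν‖ + κ + 1 with hR
  set I := ∫⁻ t in Ioc 0 t₀, (ENNReal.ofReal t)⁻¹ ^ (n * (1 - α)) with hI
  set A := volume B * ENNReal.ofReal R ^ α with hA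
  have hAt : A ≠ ∞ := ENNReal.mul_ne_top measure_closedBall_lt_top.ne
    (ENNReal.rpow_ne_top_of_nonneg hα0 ENNReal.ofReal_ne_top)
  refine ⟨C * ((1 + P) * (A ^ n * I)), ?_, fun f hf ψ hψ hψc hψs => ?_⟩
  · exact ENNReal.mul_ne_top ENNReal.coe_ne_top (ENNReal.mul_ne_top (by simp)
      (ENNReal.mul_ne_top (ENNReal.pow_ne_top hAt) (lintegral_Ioc_inv_rpow_lt_top hα t₀).ne))
  have hKc : IsCompact (tsupport χ ∩ tsupport ψ) :=
    hχc.isCompact.inter_right (isClosed_tsupport ψ)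
  have hKΩ : tsupport χ ∩ tsupport ψ ⊆ Ω := inter_subset_right.trans hψs
  set K := tsupport χ ∩ tsupport ψ with hK
  obtain ⟨L, g, hL, hKL, hLΩ, hcone, hg, hgf, hle⟩ := hC f hf K hKc
    (inter_subset_inter hχN hψs) (fun q => ψ q.1) (hψ.comp contDiff_fst)
    (fun q hq h1 _ => ⟨h1, mem_tsupport_comp_fst hq⟩)
  set D := eLpNorm (gradient ψ) 1 (volume.restrict Ω) with hD
  set H := ∏ i, holderSeminorm Ω α (f i) with hH
  set G : 𝔼 → ℝ≥0∞ := fun x => ‖fderiv ℝ ψ x‖ₑ + ‖ψ x‖ₑ with hG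
  have hGm : Measurable G := by
    have h1 := (hψ.continuous_fderiv one_ne_zero).measurable
    have h2 := hψ.continuous.measurable
    fun_prop
  have hGD : ∫⁻ x in K, G x ≤ (1 + P) * D := by
    rw [hG, lintegral_add_left (hψ.continuous_fderiv one_ne_zero).measurable.enorm, add_mul,
      one_mul]
    refine add_le_add ?_ ((setLIntegral_le_lintegral _ _).trans (hP ψ hψ hψs))
    rw [hD, eLpNorm_gradient, eLpNorm_one_eq_lintegral_enorm]
    exact lintegral_mono_set hKΩ
  have hosc : ∀ q ∈ K ×ˢ Ioc 0 t₀, ∀ i, (ENNReal.ofReal q.2)⁻¹ * coneOscillation B (g i) q ≤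
      A * holderSeminorm Ω α (f i) * (ENNReal.ofReal q.2)⁻¹ ^ (1 - α) := by
    rintro ⟨x, t⟩ ⟨hx, ht⟩ i
    simp only at hx ht ⊢
    have ht0 : 0 < t := ht.1
    have h1 : coneOscillation B (g i) (x, t) ≤ ∫⁻ _ in B,
        holderSeminorm Ω α (f i) * (ENNReal.ofReal t ^ α * ENNReal.ofReal R ^ α) := by
      refine setLIntegral_mono' Metric.isClosed_closedBall.measurableSet fun y hy => ?_
      have hxy := hcone x hx t ⟨ht0.le, ht.2⟩ y hy
      rw [hgf i hxy, hgf i (hKL hx)]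
      refine (enorm_sub_le_holderSeminorm_mul (hLΩ hxy) (hLΩ (hKL hx)) (α := α)).trans ?_
      rw [add_sub_cancel_left, enorm_smul, ENNReal.mul_rpow_of_nonneg _ _ hα0,
        Real.enorm_eq_ofReal ht0.le, ← ofReal_norm y]
      gcongr
      exact (norm_lt_of_mem_closedBall hy).le
    rw [lintegral_const, Measure.restrict_apply_univ] at h1
    have h2 : (ENNReal.ofReal t)⁻¹ * ENNReal.ofReal t ^ α = (ENNReal.ofReal t)⁻¹ ^ (1 - α) := by
      have ht1 : ENNReal.ofReal t ≠ 0 := by simpa using ht0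
      rw [ENNReal.inv_rpow, ← ENNReal.rpow_neg, ← ENNReal.rpow_neg_one,
        ← ENNReal.rpow_add _ _ ht1 ENNReal.ofReal_ne_top]
      congr 1
      ring
    calc (ENNReal.ofReal t)⁻¹ * coneOscillation B (g i) (x, t)
        ≤ (ENNReal.ofReal t)⁻¹ * (holderSeminorm Ω α (f i) *
          (ENNReal.ofReal t ^ α * ENNReal.ofReal R ^ α) * volume B) := by gcongr
      _ = A * holderSeminorm Ω α (f i) * ((ENNReal.ofReal t)⁻¹ * ENNReal.ofReal t ^ α) := by
          rw [hA]
          ring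
      _ = _ := by rw [h2]
  calc ‖∫ x in Ω, χ x * ψ x * jacobian f x‖ₑ
      ≤ C * ∫⁻ q in K ×ˢ Ioc 0 t₀, (‖fderiv ℝ (fun q : 𝔼 × ℝ => ψ q.1) q‖ₑ + ‖ψ q.1‖ₑ) *
          ∏ i, ((ENNReal.ofReal q.2)⁻¹ * coneOscillation B (g i) q) := hle
    _ ≤ C * ∫⁻ q in K ×ˢ Ioc 0 t₀, G q.1 *
          (A ^ n * H * (ENNReal.ofReal q.2)⁻¹ ^ (n * (1 - α))) := by
        gcongr 1
        refine setLIntegral_mono' (hKc.isClosed.measurableSet.prod measurableSet_Ioc) fun q hq => ?_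
        refine mul_le_mul' (add_le_add_left (enorm_fderiv_comp_fst_le hψ q) _) ?_
        refine (Finset.prod_le_prod' fun i _ => hosc q hq i).trans_eq ?_
        rw [Finset.prod_mul_distrib, Finset.prod_mul_distrib, Finset.prod_const, Finset.prod_const,
          Finset.card_univ, Fintype.card_fin, mul_comm (n : ℝ), ENNReal.rpow_mul,
          ENNReal.rpow_natCast]
    _ = C * ((∫⁻ x in K, G x) * ((A ^ n * H) * I)) := by
        rw [Measure.volume_eq_prod, ← Measure.prod_restrict, lintegral_prod_mul hGm.aemeasurable
          (g := fun t => A ^ n * H * (ENNReal.ofReal t)⁻¹ ^ (n * (1 - α)))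
          (Measurable.aemeasurable (by fun_prop)), lintegral_const_mul _ (by fun_prop)]
    _ ≤ C * ((1 + P) * D * ((A ^ n * H) * I)) := by gcongr
    _ = _ := by ring

/-! ### The estimate by the fractional Sobolev norm of the test function -/

theorem exists_mem_tsupport_of_mem_tsupport_coneAverage {η ψ : 𝔼 → ℝ} (hη : HasCompactSupport η)
    {q : 𝔼 × ℝ} (hq : q ∈ tsupport (coneAverage volume η ψ)) :
    ∃ y ∈ tsupport η, q.1 + q.2 • y ∈ tsupport ψ := by
  by_contra! hne
  refine notMem_tsupport_iff_eventuallyEq.2 ?_ hq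
  have h1 : ∀ᶠ z in 𝓝 q, ∀ y ∈ tsupport η, z.1 + z.2 • y ∉ tsupport ψ := by
    refine hη.isCompact.eventually_forall_of_forall_eventually fun y hy => ?_
    have hc : Continuous fun z : (𝔼 × ℝ) × 𝔼 => z.1.1 + z.1.2 • z.2 := by fun_prop
    exact (hc.continuousAt (x := (q, y))).eventually
      ((isClosed_tsupport ψ).isOpen_compl.mem_nhds (hne y hy))
  filter_upwards [h1] with z hz
  rw [coneAverage_eq_setIntegral]
  refine (setIntegral_congr_fun (isClosed_tsupport η).measurableSet fun y hy => ?_).trans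
    (integral_zero _ _)
  simp only [image_eq_zero_of_notMem_tsupport (hz y hy), mul_zero]

/-- The times `t > τ x` contribute a power of `τ x`. -/
theorem lintegral_indicator_inv_mul_rpow_le {S : Set 𝔼} (hS : MeasurableSet S) {τ : 𝔼 → ℝ}
    (hτ : Measurable τ) (hτS : ∀ x ∈ S, 0 < τ x) {u : 𝔼 → ℝ≥0∞} (hu : Measurable u) {p : ℝ}
    (hp : 1 < p) (t₀ : ℝ) :
    ∫⁻ q in S ×ˢ Ioc 0 t₀, ((ENNReal.ofReal q.2)⁻¹ *
        {q : 𝔼 × ℝ | τ q.1 < q.2}.indicator (fun q => u q.1) q) ^ p ≤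
      ENNReal.ofReal (1 / (p - 1)) * ∫⁻ x in S, u x ^ p * (ENNReal.ofReal (τ x))⁻¹ ^ (p - 1) := by
  have hp0 : 0 < p := by linarith
  have hset : MeasurableSet {q : 𝔼 × ℝ | τ q.1 < q.2} :=
    measurableSet_lt (hτ.comp measurable_fst) measurable_snd
  have hm : Measurable fun q : 𝔼 × ℝ => ((ENNReal.ofReal q.2)⁻¹ *
      {q : 𝔼 × ℝ | τ q.1 < q.2}.indicator (fun q => u q.1) q) ^ p := by
    have := (hu.comp measurable_fst).indicator hset
    exact (Measurable.mul (by fun_prop) this).pow_const p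
  rw [Measure.volume_eq_prod, setLIntegral_prod _ hm.aemeasurable,
    ← lintegral_const_mul' _ _ ENNReal.ofReal_ne_top]
  refine setLIntegral_mono' hS fun x hx => ?_
  calc ∫⁻ t in Ioc 0 t₀, ((ENNReal.ofReal t)⁻¹ *
        {q : 𝔼 × ℝ | τ q.1 < q.2}.indicator (fun q => u q.1) (x, t)) ^ p
      ≤ ∫⁻ t in Ioi (τ x), (ENNReal.ofReal t)⁻¹ ^ p * u x ^ p := by
        rw [← lintegral_indicator measurableSet_Ioc, ← lintegral_indicator measurableSet_Ioi]
        refine lintegral_mono fun t => indicator_le (fun t _ => ?_) t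
        by_cases ht : τ x < t
        · rw [indicator_of_mem (show t ∈ Ioi (τ x) from ht),
            indicator_of_mem (show (x, t) ∈ {q : 𝔼 × ℝ | τ q.1 < q.2} from ht),
            ENNReal.mul_rpow_of_nonneg _ _ hp0.le]
        · rw [indicator_of_notMem (show (x, t) ∉ {q : 𝔼 × ℝ | τ q.1 < q.2} from ht), mul_zero,
            ENNReal.zero_rpow_of_pos hp0]
          exact zero_le
    _ = _ := by
        rw [lintegral_mul_const _ (by fun_prop), lintegral_Ioi_inv_rpow_le hp (hτS x hx)]
        ring

/-- Oscillations over the cones opposite to those of the chart, which may leave `Ω`: at points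
outside `Ω` the test function vanishes, and what remains is the left side of Hardy's inequality. -/
theorem ConeChart.exists_lintegral_coneOscillation_neg_le (hn : 2 ≤ n) {Ω N : Set 𝔼} {ν : 𝔼}
    {κ t₀ : ℝ} (h : ConeChart Ω N ν κ t₀) (hΩ : IsOpen Ω) :
    ∃ C : ℝ≥0∞, C ≠ ∞ ∧ ∀ ψ : 𝔼 → ℝ, Continuous ψ → HasCompactSupport ψ → tsupport ψ ⊆ Ω →
      ∫⁻ q in (N ∩ Ω) ×ˢ Ioc 0 t₀, ((ENNReal.ofReal q.2)⁻¹ *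
          coneOscillation (Metric.closedBall (-ν) κ) ψ q) ^ ((n : ℝ) + 1) ≤
        C * ((∫⁻ x in Ω, ‖ψ x‖ₑ ^ ((n : ℝ) + 1)) + traceEnergy Ω ((n : ℝ) + 1) ψ) := by
  have hn1 : (1 : ℝ) ≤ n := by exact_mod_cast (by omega : 1 ≤ n)
  obtain ⟨τ, C, hτ, hτ0, hτt, hC⟩ := h.hardy
  have hκ := h.κ_pos
  set p : ℝ := (n : ℝ) + 1 with hp
  have hp0 : 0 < p := by linarith
  set B := Metric.closedBall (-ν) κ with hB
  have hBm : MeasurableSet B := Metric.isClosed_closedBall.measurableSet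
  have hBt : volume B ≠ ∞ := measure_closedBall_lt_top.ne
  set R := ‖-ν‖ + κ + 1 with hR
  have hT : traceConst B R p ≠ ∞ := traceConst_ne_top hBt R (by linarith)
  have h2t : (2 : ℝ≥0∞) ^ (p - 1) ≠ ∞ :=
    ENNReal.rpow_ne_top_of_nonneg (by linarith) ENNReal.ofNat_ne_top
  refine ⟨2 ^ (p - 1) * (traceConst B R p + ENNReal.ofReal (1 / (p - 1)) * (volume B ^ p * C)),
    ENNReal.mul_ne_top h2t (ENNReal.add_ne_top.2 ⟨hT, ENNReal.mul_ne_top ENNReal.ofReal_ne_top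
      (ENNReal.mul_ne_top (ENNReal.rpow_ne_top_of_nonneg hp0.le hBt) ENNReal.coe_ne_top)⟩),
    fun ψ hψ hψc hψs => ?_⟩
  have hψm := hψ.measurable
  set S := (∫⁻ x in Ω, ‖ψ x‖ₑ ^ p) + traceEnergy Ω p ψ with hS
  set d : 𝔼 × 𝔼 → ℝ≥0∞ := (Ω ×ˢ Ω).indicator fun z => ‖ψ z.1 - ψ z.2‖ₑ with hd
  have hdm : Measurable d := Measurable.indicator (by fun_prop)
    (hΩ.measurableSet.prod hΩ.measurableSet)
  have hd0 : ∀ x, d (x, x) = 0 := fun x => indicator_apply_eq_zero.2 fun _ => by simp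
  -- `W` bounds the contribution of the points of the opposite cones that are outside `Ω`; there are
  -- none at the scale `t` unless `τ x < t`.
  set W : 𝔼 × ℝ → ℝ≥0∞ := {q : 𝔼 × ℝ | τ q.1 < q.2}.indicator fun q => volume B * ‖ψ q.1‖ₑ with hW
  have hNm : MeasurableSet (N ∩ Ω) := (h.isOpen.inter hΩ).measurableSet
  have hosc : ∀ q ∈ (N ∩ Ω) ×ˢ Ioc 0 t₀, coneOscillation B ψ q ≤
      (∫⁻ y in B, d (q.1, q.1 + q.2 • y)) + W q := by
    rintro ⟨x, t⟩ ⟨hx, ht⟩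
    simp only at hx ht ⊢
    by_cases hlt : τ x < t
    · have h1 : W (x, t) = ∫⁻ _ in B, ‖ψ x‖ₑ := by
        rw [lintegral_const, Measure.restrict_apply_univ, mul_comm]
        exact indicator_of_mem (show (x, t) ∈ {q : 𝔼 × ℝ | τ q.1 < q.2} from hlt) _
      rw [h1, ← lintegral_add_right _ measurable_const]
      refine setLIntegral_mono' hBm fun y hy => ?_
      by_cases hxy : x + t • y ∈ Ω
      · refine le_trans (le_of_eq ?_) le_self_add
        rw [hd, indicator_of_mem (show (x, x + t • y) ∈ Ω ×ˢ Ω from ⟨hx.2, hxy⟩), ← enorm_neg,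
          neg_sub]
      · refine le_trans (le_of_eq ?_) le_add_self
        simp only [image_eq_zero_of_notMem_tsupport fun h' => hxy (hψs h'), zero_sub, enorm_neg]
    · refine le_trans (setLIntegral_mono' hBm fun y hy => le_of_eq ?_) le_self_add
      have hxy : x + t • y ∈ Ω := by
        by_contra hxy
        exact hlt (hτt x hx t ht y hy hxy)
      rw [hd, indicator_of_mem (show (x, x + t • y) ∈ Ω ×ˢ Ω from ⟨hx.2, hxy⟩), ← enorm_neg,
        neg_sub]
  have hfirst : ∫⁻ q in (N ∩ Ω) ×ˢ Ioc 0 t₀, ((ENNReal.ofReal q.2)⁻¹ *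
      ∫⁻ y in B, d (q.1, q.1 + q.2 • y)) ^ p ≤ traceConst B R p * S := by
    refine (lintegral_mono_set fun q hq =>
      (⟨mem_univ _, hq.2.1⟩ : q ∈ univ ×ˢ Ioi (0 : ℝ))).trans ?_
    refine (lintegral_inv_mul_lintegral_rpow_le hBm (by positivity)
      (fun y hy => norm_lt_of_mem_closedBall hy) (by linarith) (by linarith) hdm hd0).trans ?_
    rw [traceEnergy_eq_lintegral_indicator hΩ.measurableSet hp0]
    gcongr
    exact le_add_self
  have hsecond : ∫⁻ q in (N ∩ Ω) ×ˢ Ioc 0 t₀, ((ENNReal.ofReal q.2)⁻¹ * W q) ^ p ≤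
      ENNReal.ofReal (1 / (p - 1)) * (volume B ^ p * C) * S := by
    refine (lintegral_indicator_inv_mul_rpow_le hNm hτ hτ0
      (u := fun x => volume B * ‖ψ x‖ₑ) (by fun_prop) (by linarith) t₀).trans ?_
    rw [mul_assoc, mul_assoc]
    gcongr
    simp_rw [ENNReal.mul_rpow_of_nonneg _ _ hp0.le, mul_assoc]
    rw [lintegral_const_mul' _ _ (ENNReal.rpow_ne_top_of_nonneg hp0.le hBt)]
    gcongr
    have := hC ψ hψ hψc hψs
    rwa [show (n : ℝ) = p - 1 by rw [hp]; ring] at this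
  have hQ : MeasurableSet ((N ∩ Ω) ×ˢ Ioc 0 t₀) := hNm.prod measurableSet_Ioc
  have hWm : Measurable W := Measurable.indicator (by fun_prop)
    (measurableSet_lt (hτ.comp measurable_fst) measurable_snd)
  calc ∫⁻ q in (N ∩ Ω) ×ˢ Ioc 0 t₀, ((ENNReal.ofReal q.2)⁻¹ * coneOscillation B ψ q) ^ p
      ≤ ∫⁻ q in (N ∩ Ω) ×ˢ Ioc 0 t₀, 2 ^ (p - 1) * (((ENNReal.ofReal q.2)⁻¹ *
          ∫⁻ y in B, d (q.1, q.1 + q.2 • y)) ^ p + ((ENNReal.ofReal q.2)⁻¹ * W q) ^ p) := by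
        refine setLIntegral_mono' hQ fun q hq => ?_
        refine le_trans ?_ (ENNReal.rpow_add_le_mul_rpow_add_rpow _ _ (by linarith))
        rw [← mul_add]
        gcongr
        exact hosc q hq
    _ = 2 ^ (p - 1) * ((∫⁻ q in (N ∩ Ω) ×ˢ Ioc 0 t₀, ((ENNReal.ofReal q.2)⁻¹ *
          ∫⁻ y in B, d (q.1, q.1 + q.2 • y)) ^ p) +
          ∫⁻ q in (N ∩ Ω) ×ˢ Ioc 0 t₀, ((ENNReal.ofReal q.2)⁻¹ * W q) ^ p) := by
        rw [lintegral_const_mul' _ _ h2t, lintegral_add_right]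
        exact (Measurable.mul (by fun_prop) hWm).pow_const p
    _ ≤ 2 ^ (p - 1) * (traceConst B R p * S +
          ENNReal.ofReal (1 / (p - 1)) * (volume B ^ p * C) * S) := by gcongr
    _ = _ := by ring

/-- The estimate with the test function in a fractional Sobolev space, in a window. The test
function is extended to the half-space by averages over the cones opposite to those of the chart,
so that the extension vanishes at points over the complement of `Ω`. -/
theorem ConeChart.jacobianBound_sobolev (hn : 2 ≤ n) {Ω N : Set 𝔼} {ν : 𝔼} {κ t₀ : ℝ}
    (h : ConeChart Ω N ν κ t₀) (hΩ : IsOpen Ω) {χ : 𝔼 → ℝ}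
    (hχ : ContDiff ℝ 1 χ) (hχc : HasCompactSupport χ) (hχN : tsupport χ ⊆ N) :
    JacobianBound Ω χ (fun f => traceEnergy Ω ((n : ℝ) + 1) f ^ (1 / ((n : ℝ) + 1)))
      (fun ψ => ((∫⁻ x in Ω, ‖ψ x‖ₑ ^ ((n : ℝ) + 1)) + traceEnergy Ω ((n : ℝ) + 1) ψ) ^
        (1 / ((n : ℝ) + 1))) := by
  have hn1 : (1 : ℝ) ≤ n := by exact_mod_cast (by omega : 1 ≤ n)
  obtain ⟨C, hC⟩ := h.exists_enorm_integral_cutoff_mul_le hΩ hχ hχc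
  set p : ℝ := (n : ℝ) + 1 with hp
  have hp1 : 1 ≤ p := by linarith
  have hp0 : 0 < p := by linarith
  obtain ⟨η, hη, hηc, hηs, hη1⟩ := exists_contDiff_kernel (-ν) h.κ_pos
  have hη' : ContDiff ℝ 1 η := hη.of_le (by norm_num)
  obtain ⟨C₁, hC₁⟩ := exists_enorm_fderiv_coneAverage_le (μ := (volume : Measure 𝔼)) hη hηc
  obtain ⟨C₂, hC₂⟩ := exists_lintegral_coneAverage_rpow_le hη.continuous hηc hp1 t₀
  obtain ⟨C₃, hC₃t, hC₃⟩ := h.exists_lintegral_coneOscillation_neg_le hn hΩ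
  set T := traceConst (Metric.closedBall ν κ) (‖ν‖ + κ + 1) p with hT
  have hTt : T ≠ ∞ := traceConst_ne_top measure_closedBall_lt_top.ne _ hp1
  have h2t : (2 : ℝ≥0∞) ^ (p - 1) ≠ ∞ :=
    ENNReal.rpow_ne_top_of_nonneg (by linarith) ENNReal.ofNat_ne_top
  have hC₁t : (C₁ : ℝ≥0∞) ^ p ≠ ∞ := ENNReal.rpow_ne_top_of_nonneg hp0.le ENNReal.coe_ne_top
  set A : ℝ≥0∞ := 2 ^ (p - 1) * (C₁ ^ p * C₃ + C₂) with hA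
  have hAt : A ≠ ∞ := ENNReal.mul_ne_top h2t (ENNReal.add_ne_top.2
    ⟨ENNReal.mul_ne_top hC₁t hC₃t, ENNReal.coe_ne_top⟩)
  refine ⟨C * (A ^ (1 / p) * (T ^ (1 / p)) ^ n), ?_, fun f hf ψ hψ hψc hψs => ?_⟩
  · exact ENNReal.mul_ne_top ENNReal.coe_ne_top (ENNReal.mul_ne_top
      (ENNReal.rpow_ne_top_of_nonneg (by positivity) hAt)
      (ENNReal.pow_ne_top (ENNReal.rpow_ne_top_of_nonneg (by positivity) hTt)))
  set b := coneAverage volume η ψ with hb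
  have hb1 : ContDiff ℝ 1 b := contDiff_coneAverage hη' hηc hψ
  -- The extension of `ψ` lives over `D`. Points of `D` in the window are in `Ω`, as they are moved
  -- into the support of `ψ` by one of the opposite directions.
  set D : Set 𝔼 := (fun z : 𝔼 × ℝ × 𝔼 => z.1 - z.2.1 • z.2.2) ''
    (tsupport ψ ×ˢ Icc 0 t₀ ×ˢ Metric.closedBall (-ν) κ) with hD
  have hDc : IsCompact D :=
    (hψc.isCompact.prod (isCompact_Icc.prod (isCompact_closedBall (-ν) κ))).image (by fun_prop)
  set K := tsupport χ ∩ D with hK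
  have hKc : IsCompact K := hχc.isCompact.inter_right hDc.isClosed
  have hKN : K ⊆ N ∩ Ω := by
    rintro x ⟨hx, ⟨z, t, y⟩, ⟨hz, ht, hy⟩, hzx⟩
    refine ⟨hχN hx, h.mem_of_add_mem x (hχN hx) t ht y hy ?_⟩
    rw [← hzx, sub_add_cancel]
    exact hψs hz
  obtain ⟨L, g, hL, hKL, hLΩ, hcone, hg, hgf, hle⟩ := hC f hf K hKc hKN b hb1 (by
    intro q hq h1 h2
    obtain ⟨y, hy, hqy⟩ := exists_mem_tsupport_of_mem_tsupport_coneAverage hηc hq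
    rw [hηs] at hy
    exact ⟨h1, (q.1 + q.2 • y, q.2, y), ⟨hqy, h2, hy⟩, add_sub_cancel_right _ _⟩)
  have hb0 : ∀ x, b (x, 0) = ψ x := fun x => coneAverage_zero η ψ x hη1
  simp only [hb0] at hle
  set S := (∫⁻ x in Ω, ‖ψ x‖ₑ ^ p) + traceEnergy Ω p ψ with hS
  set F : Fin n → 𝔼 × ℝ → ℝ≥0∞ := fun i q =>
    (ENNReal.ofReal q.2)⁻¹ * coneOscillation (Metric.closedBall ν κ) (g i) q with hF
  have hFm : ∀ i, Measurable (F i) := fun i => by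
    have := measurable_coneOscillation (Metric.closedBall ν κ) (hg i)
    fun_prop
  set G : 𝔼 × ℝ → ℝ≥0∞ := fun q => ‖fderiv ℝ b q‖ₑ + ‖b q‖ₑ with hG
  have hDbm : Measurable fun q => ‖fderiv ℝ b q‖ₑ :=
    (hb1.continuous_fderiv one_ne_zero).measurable.enorm
  have hbm : Measurable fun q => ‖b q‖ₑ := hb1.continuous.measurable.enorm
  have hGm : Measurable G := hDbm.add hbm
  have hGS : ∫⁻ q in K ×ˢ Ioc 0 t₀, G q ^ p ≤ A * S := by
    have h1 : ∫⁻ q in K ×ˢ Ioc 0 t₀, ‖fderiv ℝ b q‖ₑ ^ p ≤ C₁ ^ p * (C₃ * S) := by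
      calc ∫⁻ q in K ×ˢ Ioc 0 t₀, ‖fderiv ℝ b q‖ₑ ^ p
          ≤ ∫⁻ q in K ×ˢ Ioc 0 t₀, C₁ ^ p * ((ENNReal.ofReal q.2)⁻¹ *
              coneOscillation (Metric.closedBall (-ν) κ) ψ q) ^ p := by
            refine setLIntegral_mono' (hKc.isClosed.measurableSet.prod measurableSet_Ioc)
              fun q hq => ?_
            rw [← ENNReal.mul_rpow_of_nonneg _ _ hp0.le, ← mul_assoc]
            gcongr
            have := hC₁ ψ hψ q hq.2.1
            rwa [hηs] at this
        _ = C₁ ^ p * ∫⁻ q in K ×ˢ Ioc 0 t₀, ((ENNReal.ofReal q.2)⁻¹ *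
              coneOscillation (Metric.closedBall (-ν) κ) ψ q) ^ p :=
            lintegral_const_mul' _ _ hC₁t
        _ ≤ _ := by
            gcongr
            exact (lintegral_mono_set (prod_mono_left hKN)).trans
              (hC₃ ψ hψ.continuous hψc hψs)
    have h2 : ∫⁻ q in K ×ˢ Ioc 0 t₀, ‖b q‖ₑ ^ p ≤ C₂ * S := by
      refine (lintegral_mono_set (prod_mono_left (subset_univ K))).trans
        ((hC₂ ψ hψ.continuous).trans ?_)
      gcongr
      refine le_trans (le_of_eq ?_) le_self_add
      refine (setLIntegral_eq_of_support_subset fun x hx => hψs (subset_tsupport ψ ?_)).symm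
      rintro h0
      exact hx (by simp only [h0, enorm_zero, ENNReal.zero_rpow_of_pos hp0])
    calc ∫⁻ q in K ×ˢ Ioc 0 t₀, G q ^ p
        ≤ ∫⁻ q in K ×ˢ Ioc 0 t₀, 2 ^ (p - 1) * (‖fderiv ℝ b q‖ₑ ^ p + ‖b q‖ₑ ^ p) :=
          lintegral_mono fun q => ENNReal.rpow_add_le_mul_rpow_add_rpow _ _ hp1
      _ = 2 ^ (p - 1) * ((∫⁻ q in K ×ˢ Ioc 0 t₀, ‖fderiv ℝ b q‖ₑ ^ p) +
            ∫⁻ q in K ×ˢ Ioc 0 t₀, ‖b q‖ₑ ^ p) := by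
          rw [lintegral_const_mul' _ _ h2t, lintegral_add_right _ (hbm.pow_const p)]
      _ ≤ 2 ^ (p - 1) * (C₁ ^ p * (C₃ * S) + C₂ * S) := by gcongr
      _ = _ := by ring
  calc ‖∫ x in Ω, χ x * ψ x * jacobian f x‖ₑ
      ≤ C * ∫⁻ q in K ×ˢ Ioc 0 t₀, G q * ∏ i, F i q := hle
    _ ≤ C * ((A * S) ^ (1 / p) * ∏ i, (T * traceEnergy Ω p (f i)) ^ (1 / p)) := by
        gcongr
        refine (lintegral_mul_prod_le_mul_prod_rpow _ hFm hGm).trans ?_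
        gcongr with i
        exact h.lintegral_coneOscillation_rpow_le hKc.isClosed.measurableSet hL hKL hLΩ hcone (hg i)
          (hgf i) hp1 (by linarith)
    _ = _ := by
        rw [prod_mul_rpow_eq _ _ (by positivity), Fintype.card_fin,
          ENNReal.mul_rpow_of_nonneg _ _ (by positivity)]
        ring

/-! ### Partition of unity and telescoping -/

theorem hasFDerivAt_component {u : 𝔼 → 𝔼} {x : 𝔼} (hu : DifferentiableAt ℝ u x) (i : Fin n) :
    HasFDerivAt (fun x => u x i) ((EuclideanSpace.proj i : 𝔼 →L[ℝ] ℝ).comp (fderiv ℝ u x)) x :=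
  (EuclideanSpace.proj i : 𝔼 →L[ℝ] ℝ).hasFDerivAt.comp x hu.hasFDerivAt

theorem det_fderiv_eq_jacobian {u : 𝔼 → 𝔼} {x : 𝔼} (hu : DifferentiableAt ℝ u x) :
    (fderiv ℝ u x).det = jacobian (fun i x => u x i) x := by
  rw [ContinuousLinearMap.det, ← LinearMap.det_toMatrix (EuclideanSpace.basisFun (Fin n) ℝ).toBasis,
    jacobian]
  congr 1
  ext i j
  rw [LinearMap.toMatrix_apply, Matrix.of_apply, (hasFDerivAt_component hu i).fderiv]
  simp

/-- The components of the `i`-th summand in the telescoping expansion of a difference of two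
Jacobian determinants: those of `u` before the place `i`, the difference at `i`, those of `v`
after it. -/
def telescopingFamily (u v : Fin n → EuclideanSpace ℝ (Fin n) → ℝ) (i : Fin n) :
    Fin n → EuclideanSpace ℝ (Fin n) → ℝ :=
  fun j => if j < i then u j else if i = j then fun x => u j x - v j x else v j

theorem jacobian_sub_jacobian {u v : Fin n → 𝔼 → ℝ} {x : 𝔼}
    (hu : ∀ i, DifferentiableAt ℝ (u i) x) (hv : ∀ i, DifferentiableAt ℝ (v i) x) :
    jacobian u x - jacobian v x = ∑ i, jacobian (telescopingFamily u v i) x := by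
  set e := EuclideanSpace.basisFun (Fin n) ℝ with he
  have h := (Matrix.detRowAlternating (n := Fin n) (R := ℝ)).toMultilinearMap.map_sub_map_piecewise
    (fun i j => fderiv ℝ (u i) x (e j)) (fun i j => fderiv ℝ (v i) x (e j)) Finset.univ
  rw [Finset.piecewise_univ] at h
  refine h.trans (Finset.sum_congr rfl fun i _ => ?_)
  change Matrix.det _ = Matrix.det _
  congr 1
  ext j k
  simp only [Finset.mem_univ, true_imp_iff, Matrix.of_apply, telescopingFamily]
  split_ifs with h1 h2
  · rfl
  · rw [fderiv_fun_sub (hu j) (hv j)]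
    rfl
  · rfl

theorem integrableOn_mul_jacobian {Ω : Set 𝔼} (hΩ : IsOpen Ω) {f : Fin n → 𝔼 → ℝ}
    (hf : ∀ i, ContDiffOn ℝ 1 (f i) Ω) {ψ : 𝔼 → ℝ} (hψ : Continuous ψ) (hψc : HasCompactSupport ψ)
    (hψs : tsupport ψ ⊆ Ω) : IntegrableOn (fun x => ψ x * jacobian f x) Ω := by
  have hc : ContinuousOn (fun x => ψ x * jacobian f x) Ω := by
    refine hψ.continuousOn.mul ?_
    rw [continuousOn_iff_continuous_domRestrict]
    refine Continuous.matrix_det (continuous_matrix fun i j => ?_)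
    have h1 : ContinuousOn (fun x => fderiv ℝ (f i) x (EuclideanSpace.basisFun (Fin n) ℝ j)) Ω :=
      ((hf i).continuousOn_fderiv_of_isOpen hΩ le_rfl).clm_apply continuousOn_const
    exact continuousOn_iff_continuous_domRestrict.1 h1
  refine ((hc.mono hψs).integrableOn_compact hψc.isCompact).of_forall_sdiff_eq_zero
    hΩ.measurableSet fun x hx => ?_
  rw [image_eq_zero_of_notMem_tsupport hx.2, zero_mul]

theorem JacobianBound.of_sum {Ω : Set 𝔼} (hΩ : IsOpen Ω) {ι : Type*} [Fintype ι] {χ : ι → 𝔼 → ℝ}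
    (hχ : ∀ i, Continuous (χ i)) (hχ1 : ∀ x ∈ Ω, ∑ i, χ i x = 1) {N M : (𝔼 → ℝ) → ℝ≥0∞}
    (h : ∀ i, JacobianBound Ω (χ i) N M) : JacobianBound Ω (fun _ => 1) N M := by
  choose C hCt hC using h
  refine ⟨∑ i, C i, ENNReal.sum_ne_top.2 fun i _ => hCt i, fun f hf ψ hψ hψc hψs => ?_⟩
  have h1 : ∫ x in Ω, 1 * ψ x * jacobian f x = ∑ i, ∫ x in Ω, χ i x * ψ x * jacobian f x := by
    rw [← integral_finsetSum]
    · refine setIntegral_congr_fun hΩ.measurableSet fun x hx => ?_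
      rw [← Finset.sum_mul, ← Finset.sum_mul, hχ1 x hx]
    · intro i _
      exact integrableOn_mul_jacobian hΩ hf ((hχ i).mul hψ.continuous) hψc.mul_left
        (tsupport_mul_subset_right.trans hψs)
  rw [h1]
  refine (enorm_sum_le _ _).trans ?_
  rw [Finset.sum_mul, Finset.sum_mul]
  exact Finset.sum_le_sum fun i _ => hC i f hf ψ hψ hψc hψs

/-- Estimates in the windows of charts add up to an estimate on `Ω`, by a partition of unity. -/
theorem JacobianBound.of_coneChart (hn : 2 ≤ n) {Ω : Set 𝔼} (hΩ : IsOpen Ω)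
    (hb : Bornology.IsBounded Ω) (hlip : HasLipschitzBoundary Ω) {N M : (𝔼 → ℝ) → ℝ≥0∞}
    (h : ∀ (W : Set 𝔼) (ν : 𝔼) (κ t₀ : ℝ), ConeChart Ω W ν κ t₀ → ∀ χ : 𝔼 → ℝ, ContDiff ℝ 1 χ →
      HasCompactSupport χ → tsupport χ ⊆ W → JacobianBound Ω χ N M) :
    JacobianBound Ω (fun _ => 1) N M := by
  choose! W ν κ t₀ hmem hW using fun (x : 𝔼) (hx : x ∈ closure Ω) => exists_coneChart hn hΩ hlip hx
  obtain ⟨s, hs, hcover⟩ := hb.isCompact_closure.elim_nhds_subcover W fun x hx =>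
    (hW x hx).isOpen.mem_nhds (hmem x hx)
  obtain ⟨ρ, hρ⟩ := SmoothPartitionOfUnity.exists_isSubordinate (modelWithCornersSelf ℝ 𝔼)
    isClosed_closure (fun i : s => W i) (fun i => (hW i (hs i i.2)).isOpen) (by
      rwa [iUnion_subtype])
  have hρ1 : ∀ i, ContDiff ℝ 1 (ρ i) := fun i => (ρ i).contMDiff.contDiff.of_le (by simp)
  refine JacobianBound.of_sum hΩ (χ := fun i => ρ i) (fun i => (hρ1 i).continuous)
    (fun x hx => ?_) fun i => ?_
  · rw [← finsum_eq_sum_of_fintype]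
    exact ρ.sum_eq_one (subset_closure hx)
  · refine h _ _ _ _ (hW i (hs i i.2)) _ (hρ1 i) ?_ (hρ i)
    exact Metric.isCompact_of_isClosed_isBounded (isClosed_tsupport _)
      ((hW i (hs i i.2)).isBounded.subset (hρ i))

/-- Passage from an estimate for one Jacobian determinant to an estimate for a difference, which is
a sum of Jacobian determinants with a difference as one of the components. -/
theorem JacobianBound.exists_le {Ω : Set 𝔼} (hΩ : IsOpen Ω) {N M : (𝔼 → ℝ) → ℝ≥0∞}
    (h : JacobianBound Ω (fun _ => 1) N M) {N' : (𝔼 → 𝔼) → ℝ≥0∞}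
    (hN : ∀ (u : 𝔼 → 𝔼) (i : Fin n), N (fun x => u x i) ≤ N' u) :
    ∃ C : ℝ≥0, ∀ u v : 𝔼 → 𝔼, ContDiffOn ℝ 1 u Ω → ContDiffOn ℝ 1 v Ω → ∀ ψ : 𝔼 → ℝ,
      ContDiff ℝ 1 ψ → HasCompactSupport ψ → tsupport ψ ⊆ Ω →
      ENNReal.ofReal |jacobianPairing Ω u ψ - jacobianPairing Ω v ψ| ≤
        C * (N' (u - v) * (N' u + N' v) ^ (n - 1) * M ψ) := by
  obtain ⟨C, hCt, hC⟩ := h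
  have hCt' : n * C ≠ ∞ := ENNReal.mul_ne_top (ENNReal.natCast_ne_top n) hCt
  refine ⟨(n * C).toNNReal, fun u v hu hv ψ hψ hψc hψs => ?_⟩
  rw [ENNReal.coe_toNNReal hCt']
  set U : Fin n → 𝔼 → ℝ := fun i x => u x i with hU
  set V : Fin n → 𝔼 → ℝ := fun i x => v x i with hV
  have hUc : ∀ i, ContDiffOn ℝ 1 (U i) Ω := fun i =>
    (EuclideanSpace.proj i : 𝔼 →L[ℝ] ℝ).contDiff.comp_contDiffOn hu
  have hVc : ∀ i, ContDiffOn ℝ 1 (V i) Ω := fun i =>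
    (EuclideanSpace.proj i : 𝔼 →L[ℝ] ℝ).contDiff.comp_contDiffOn hv
  have hdiff : ∀ {f : 𝔼 → ℝ}, ContDiffOn ℝ 1 f Ω → ∀ x ∈ Ω, DifferentiableAt ℝ f x :=
    fun hf x hx => (hf.contDiffAt (hΩ.mem_nhds hx)).differentiableAt one_ne_zero
  have hpair : ∀ w : 𝔼 → 𝔼, ContDiffOn ℝ 1 w Ω →
      jacobianPairing Ω w ψ = ∫ x in Ω, ψ x * jacobian (fun i x => w x i) x := by
    intro w hw
    refine setIntegral_congr_fun hΩ.measurableSet fun x hx => ?_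
    simp only
    rw [det_fderiv_eq_jacobian ((hw.contDiffAt (hΩ.mem_nhds hx)).differentiableAt one_ne_zero),
      mul_comm]
  have hTc : ∀ i j, ContDiffOn ℝ 1 (telescopingFamily U V i j) Ω := by
    intro i j
    unfold telescopingFamily
    split_ifs
    · exact hUc j
    · exact (hUc j).sub (hVc j)
    · exact hVc j
  have hsum : jacobianPairing Ω u ψ - jacobianPairing Ω v ψ =
      ∑ i, ∫ x in Ω, 1 * ψ x * jacobian (telescopingFamily U V i) x := by
    simp only [one_mul]
    rw [hpair u hu, hpair v hv, ← integral_sub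
      (integrableOn_mul_jacobian hΩ hUc hψ.continuous hψc hψs)
      (integrableOn_mul_jacobian hΩ hVc hψ.continuous hψc hψs), ← integral_finsetSum]
    · refine setIntegral_congr_fun hΩ.measurableSet fun x hx => ?_
      rw [← mul_sub, jacobian_sub_jacobian (fun i => hdiff (hUc i) x hx)
        (fun i => hdiff (hVc i) x hx), Finset.mul_sum]
    · exact fun i _ => integrableOn_mul_jacobian hΩ (hTc i) hψ.continuous hψc hψs
  have hprod : ∀ i, ∏ j, N (telescopingFamily U V i j) ≤
      N' (u - v) * (N' u + N' v) ^ (n - 1) := by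
    intro i
    rw [← Finset.mul_prod_erase Finset.univ _ (Finset.mem_univ i)]
    refine mul_le_mul' ?_ ?_
    · have h1 : telescopingFamily U V i i = fun x => (u - v) x i := by
        simp only [telescopingFamily, lt_irrefl, if_false, if_true]
        rfl
      rw [h1]
      exact hN (u - v) i
    · refine (Finset.prod_le_pow_card _ _ (N' u + N' v) fun j hj => ?_).trans_eq ?_
      · have hji : i ≠ j := (Finset.ne_of_mem_erase hj).symm
        simp only [telescopingFamily, hji, if_false]
        split_ifs
        · exact (hN u j).trans le_self_add
        · exact (hN v j).trans le_add_self
      · rw [Finset.card_erase_of_mem (Finset.mem_univ i), Finset.card_univ, Fintype.card_fin]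
  rw [← Real.enorm_eq_ofReal_abs, hsum]
  refine (enorm_sum_le _ _).trans ?_
  calc ∑ i, ‖∫ x in Ω, 1 * ψ x * jacobian (telescopingFamily U V i) x‖ₑ
      ≤ ∑ _i : Fin n, C * (N' (u - v) * (N' u + N' v) ^ (n - 1)) * M ψ := by
        refine Finset.sum_le_sum fun i _ => (hC _ (hTc i) ψ hψ hψc hψs).trans ?_
        gcongr
        exact hprod i
    _ = _ := by
        rw [Finset.sum_const, Finset.card_univ, Fintype.card_fin, nsmul_eq_mul]
        ring

theorem enorm_component_sub_le (u : 𝔼 → 𝔼) (i : Fin n) (x y : 𝔼) :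
    ‖u x i - u y i‖ₑ ≤ ‖u x - u y‖ₑ := by
  rw [← ofReal_norm, ← ofReal_norm]
  exact ENNReal.ofReal_le_ofReal (PiLp.norm_apply_le (u x - u y) i)

theorem traceEnergy_component_rpow_le_sobolevNorm (Ω : Set 𝔼) {s p : ℝ} (hp : 0 < p)
    (hsp : s * p = p - 1) (u : 𝔼 → 𝔼) (i : Fin n) :
    traceEnergy Ω p (fun x => u x i) ^ (1 / p) ≤ sobolevNorm Ω s p u := by
  refine le_trans ?_ le_add_self
  rw [gagliardoSeminorm, traceEnergy, hsp, add_sub_assoc]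
  gcongr
  exact enorm_component_sub_le u i _ _

theorem add_traceEnergy_rpow_le_sobolevNorm (Ω : Set 𝔼) {s p : ℝ} (hp : 1 ≤ p)
    (hsp : s * p = p - 1) (ψ : 𝔼 → ℝ) :
    ((∫⁻ x in Ω, ‖ψ x‖ₑ ^ p) + traceEnergy Ω p ψ) ^ (1 / p) ≤ sobolevNorm Ω s p ψ := by
  have hp0 : 0 < p := by linarith
  refine (ENNReal.rpow_add_le_add_rpow _ _ (by positivity) (by rwa [div_le_one hp0])).trans_eq ?_
  rw [sobolevNorm, gagliardoSeminorm, traceEnergy, hsp, add_sub_assoc,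
    eLpNorm_eq_lintegral_rpow_enorm_toReal (by simpa using hp0) ENNReal.ofReal_ne_top,
    ENNReal.toReal_ofReal hp0.le]

theorem holderSeminorm_component_le_holderNorm (Ω : Set 𝔼) {α : ℝ} (u : 𝔼 → 𝔼)
    (i : Fin n) : holderSeminorm Ω α (fun x => u x i) ≤ holderNorm Ω α u := by
  refine le_trans ?_ le_add_self
  unfold holderSeminorm
  gcongr
  exact enorm_component_sub_le u i _ _

end DistribJacobian

theorem proposition1 (n : ℕ) (hn : 2 ≤ n) (Ω : Set (EuclideanSpace ℝ (Fin n)))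
    (hΩ_open : IsOpen Ω) (hΩ_bdd : Bornology.IsBounded Ω)
    (hΩ_lip : DistribJacobian.HasLipschitzBoundary Ω)
    (α : ℝ) (hα : α ∈ Set.Ioo (((n : ℝ) - 1) / n) 1) :
    ∃ C : ℝ≥0, 0 < C ∧
      ∀ u v : EuclideanSpace ℝ (Fin n) → EuclideanSpace ℝ (Fin n),
        ContDiffOn ℝ 1 u Ω → ContDiffOn ℝ 1 v Ω →
      ∀ ψ : EuclideanSpace ℝ (Fin n) → ℝ,
        ContDiff ℝ 1 ψ → HasCompactSupport ψ → tsupport ψ ⊆ Ω →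
        ENNReal.ofReal |DistribJacobian.jacobianPairing Ω u ψ
            - DistribJacobian.jacobianPairing Ω v ψ| ≤
          C * min
            (DistribJacobian.sobolevNorm Ω (((n : ℝ) - 1) / n) n (u - v)
              * (DistribJacobian.sobolevNorm Ω (((n : ℝ) - 1) / n) n u
                + DistribJacobian.sobolevNorm Ω (((n : ℝ) - 1) / n) n v) ^ (n - 1)
              * eLpNorm (gradient ψ) ∞ (volume.restrict Ω))
            (min
              (DistribJacobian.sobolevNorm Ω ((n : ℝ) / (n + 1)) (n + 1) (u - v)
                * (DistribJacobian.sobolevNorm Ω ((n : ℝ) / (n + 1)) (n + 1) u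
                  + DistribJacobian.sobolevNorm Ω ((n : ℝ) / (n + 1)) (n + 1) v) ^ (n - 1)
                * DistribJacobian.sobolevNorm Ω ((n : ℝ) / (n + 1)) (n + 1) ψ)
              (DistribJacobian.holderNorm Ω α (u - v)
                * (DistribJacobian.holderNorm Ω α u
                  + DistribJacobian.holderNorm Ω α v) ^ (n - 1)
                * eLpNorm (gradient ψ) 1 (volume.restrict Ω))) := by
  have hn0 : (0 : ℝ) < n := by exact_mod_cast (by omega : 0 < n)
  have hα' : (n : ℝ) - 1 < α * n := (div_lt_iff₀ hn0).1 hα.1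
  have hα0 : 0 ≤ α :=
    (div_nonneg (sub_nonneg.2 (by exact_mod_cast (by omega : 1 ≤ n))) hn0.le).trans hα.1.le
  obtain ⟨C₁, h₁⟩ := (DistribJacobian.JacobianBound.of_coneChart hn hΩ_open hΩ_bdd hΩ_lip
    fun _ _ _ _ h _ hχ hχc hχN => h.jacobianBound_top hn hΩ_open hΩ_bdd hχ hχc hχN).exists_le
      hΩ_open (N' := DistribJacobian.sobolevNorm Ω (((n : ℝ) - 1) / n) n) fun u i =>
        DistribJacobian.traceEnergy_component_rpow_le_sobolevNorm Ω hn0 (by field_simp) u i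
  obtain ⟨C₂, h₂⟩ := (DistribJacobian.JacobianBound.of_coneChart hn hΩ_open hΩ_bdd hΩ_lip
    fun _ _ _ _ h _ hχ hχc hχN => h.jacobianBound_sobolev hn hΩ_open hχ hχc hχN).exists_le
      hΩ_open (N' := DistribJacobian.sobolevNorm Ω ((n : ℝ) / (n + 1)) (n + 1)) fun u i =>
        DistribJacobian.traceEnergy_component_rpow_le_sobolevNorm Ω (by positivity)
          (by field_simp; ring) u i
  obtain ⟨C₃, h₃⟩ := (DistribJacobian.JacobianBound.of_coneChart hn hΩ_open hΩ_bdd hΩ_lip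
    fun _ _ _ _ h _ hχ hχc hχN => h.jacobianBound_one hn hΩ_open hΩ_bdd hχ hχc hχN hα0
      (by linarith)).exists_le
      hΩ_open (N' := DistribJacobian.holderNorm Ω α) fun u i =>
        DistribJacobian.holderSeminorm_component_le_holderNorm Ω u i
  refine ⟨C₁ + C₂ + C₃ + 1, by positivity, fun u v hu hv ψ hψ hψc hψs => ?_⟩
  have hC₁ : (C₁ : ℝ≥0∞) ≤ ((C₁ + C₂ + C₃ + 1 : ℝ≥0) : ℝ≥0∞) := by
    exact_mod_cast by rw [add_assoc, add_assoc]; exact le_self_add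
  have hC₂ : (C₂ : ℝ≥0∞) ≤ ((C₁ + C₂ + C₃ + 1 : ℝ≥0) : ℝ≥0∞) := by
    exact_mod_cast by rw [add_comm C₁, add_assoc, add_assoc]; exact le_self_add
  have hC₃ : (C₃ : ℝ≥0∞) ≤ ((C₁ + C₂ + C₃ + 1 : ℝ≥0) : ℝ≥0∞) := by
    exact_mod_cast by rw [add_comm _ C₃, add_assoc]; exact le_self_add
  have hmono : Monotone fun a : ℝ≥0∞ => ((C₁ + C₂ + C₃ + 1 : ℝ≥0) : ℝ≥0∞) * a :=
    fun _ _ hab => mul_le_mul_right hab _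
  rw [hmono.map_min, hmono.map_min]
  refine le_min ?_ (le_min ?_ ?_)
  · exact (h₁ u v hu hv ψ hψ hψc hψs).trans (mul_le_mul_left hC₁ _)
  · refine (h₂ u v hu hv ψ hψ hψc hψs).trans (mul_le_mul' hC₂ (mul_le_mul_right ?_ _))
    exact DistribJacobian.add_traceEnergy_rpow_le_sobolevNorm Ω (by linarith)
      (by field_simp; ring) ψ
  · exact (h₃ u v hu hv ψ hψ hψc hψs).trans (mul_le_mul_left hC₃ _)
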